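/- Let $\mathcal C$ be a category. Recall the following notions. An algebraic weak factorisation system (AWFS) $(\mathsf L,\mathsf R)$ on $\mathcal C$ is a functorial factorisation $f=\rho_f\cdot\lambda_f$ on $\mathcal C$, with associated copointed endofunctor $(L,\epsilon)$, $Lf=\lambda_f$, and pointed endofunctor $(R,\eta)$, $Rf=\rho_f$, of $\mathcal C^{\mathbf 2}$, together with an extension of $(L,\epsilon)$ to a comonad $\mathsf L=(L,\epsilon,\Delta)$, an extension of $(R,\eta)$ to a monad $\mathsf R=(R,\eta,\mu)$, and a distributive law $\delta\colon LR\Rightarrow RL$ of $\mathsf L$ over $\mathsf R$ with $\mathrm{dom}\cdot\delta=\mathrm{cod}\cdot\Delta$ and $\mathrm{cod}\cdot\delta=\mathrm{dom}\cdot\mu$. Its coalgebras and algebras form double categories $\mathsf L\text{-}\mathbb{C}\mathrm{oalg}$ and $\mathsf R\text{-}\mathbb{A}\mathrm{lg}$ over the double category $\mathrm{Sq}(\mathcal C)$ of commutative squares: objects and horizontal arrows are those of $\mathcal C$, vertical arrows are (co)algebras, cells are maps of (co)algebras, and vertical composition is the canonical composition of (co)algebras. For a double functor $U\colon\mathbb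 J\to\mathrm{Sq}(\mathcal C)$ from a (possibly large) double category, $\mathbb J^{\pitchfork\!\!\pitchfork}\to\mathrm{Sq}(\mathcal C)$ is the double category over $\mathrm{Sq}(\mathcal C)$ whose vertical arrows are arrows $g$ of $\mathcal C$ equipped with a choice of diagonal fillers $\phi_{j}(u,v)$ for all squares $(u,v)\colon Uj\to g$, with $j$ a vertical arrow of $\mathbb J$, natural with respect to the cells of $\mathbb J$ and satisfying $\phi_{j\cdot i}(u,v)=\phi_j(\phi_i(u,v\cdot Uj),v)$; cells are squares that commute with the chosen fillers, and vertical composition is given by successive lifting. The AWFS $(\mathsf L,\mathsf R)$ is (class-)cofibrantly generated by $U$ if $\mathsf R\text{-}\mathbb{A}\mathrm{lg}\cong\mathbb J^{\pitchfork\!\!\pitchfork}$ over $\mathrm{Sq}(\mathcal C)$. Let $\mathbf{AWFS}_{\mathrm{ladj}}$ be the 2-category whose objects are categories equipped with an AWFS, whose 1-cells are oplax morphisms of AWFS $(F,\alpha)$, $\alpha_f\colon FEf\to E'Ff$, together with a chosen right adjoint $G$ of $F$, and whose 2-cells are the natural transformations $F\Rightarrow F'$ compatible with $\alpha$ and $\alpha'$.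 Let $\mathbf{DBL}/\mathrm{Sq}(-)_{\mathrm{ladj}}$ be the 2-category whose objects are double functors $\mathbb J\to\mathrm{Sq}(\mathcal C)$, whose 1-cells from $U\colon\mathbb J\to\mathrm{Sq}(\mathcal C)$ to $U'\colon\mathbb J'\to\mathrm{Sq}(\mathcal D)$ are functors $F\colon\mathcal C\to\mathcal D$ with a chosen right adjoint together with a double functor $\bar F\colon\mathbb J\to\mathbb J'$ such that $U'\bar F=\mathrm{Sq}(F)\,U$, and whose 2-cells are pairs of a natural transformation $\alpha\colon F\Rightarrow F'$ and a horizontal transformation $\bar\alpha\colon\bar F\Rightarrow\bar F'$ such that $U'\bar\alpha=\mathrm{Sq}(\alpha)\,U$. Sending an AWFS to its double category of coalgebras over $\mathrm{Sq}$ defines a 2-functor $\mathbb{C}\mathrm{oalg}(-)\colon\mathbf{AWFS}_{\mathrm{ladj}}\to\mathbf{DBL}/\mathrm{Sq}(-)_{\mathrm{ladj}}$. **Proposition.** If the AWFS $(\mathsf L,\mathsf R)$ on $\mathcal C$ is (class-)cofibrantly generated by $U\colon\mathbb J\to\mathrm{Sq}(\mathcal C)$, then it provides a left 2-adjoint at $U$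 for $\mathbb{C}\mathrm{oalg}(-)\colon\mathbf{AWFS}_{\mathrm{ladj}}\to\mathbf{DBL}/\mathrm{Sq}(-)_{\mathrm{ladj}}$. That is, there is a 1-cell $\eta\colon U\to\mathsf L\text{-}\mathbb{C}\mathrm{oalg}$ of $\mathbf{DBL}/\mathrm{Sq}(-)_{\mathrm{ladj}}$ such that for every AWFS $(\mathsf L',\mathsf R')$ on a category $\mathcal D$, applying $\mathbb{C}\mathrm{oalg}(-)$ and precomposing with $\eta$ gives an isomorphism of categories $$\mathbf{AWFS}_{\mathrm{ladj}}\bigl((\mathsf L,\mathsf R),(\mathsf L',\mathsf R')\bigr)\;\cong\;\mathbf{DBL}/\mathrm{Sq}(-)_{\mathrm{ladj}}\bigl(U,\;\mathsf L'\text{-}\mathbb{C}\mathrm{oalg}\bigr),$$ which is then automatically 2-natural in $(\mathsf L',\mathsf R')$. -/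

import Mathlib

open CategoryTheory

universe v u

namespace AlgFact

/-! ## Strict double categories -/

/-- A (strict) double category, i.e. an internal category in the category of locally small
categories, in elementary form: objects and horizontal arrows form a category, objects and vertical
arrows form a category, and the cells
```
a --f--> c
|        |
p        q
v        v
b --g--> d
```
compose horizontally and vertically. Horizontal and vertical composition are written in
diagrammatic order. -/
structure DblCat where
  Ob : Type u
  [hor : Category.{v} Ob]
  V : Ob → Ob → Type (max u v)
  vid : ∀ a : Ob, V a a
  vcomp : ∀ {a b c : Ob}, V a b → V b c → V a c
  vid_vcomp : ∀ {a b : Ob} (p : V a b), vcomp (vid a) p = p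
  vcomp_vid : ∀ {a b : Ob} (p : V a b), vcomp p (vid b) = p
  vassoc : ∀ {a b c d : Ob} (p : V a b) (q : V b c) (r : V c d),
    vcomp (vcomp p q) r = vcomp p (vcomp q r)
  /-- `Cell p q f g` : cells with left side `p`, right side `q`, top `f` and bottom `g`. -/
  Cell : ∀ {a b c d : Ob}, V a b → V c d → (a ⟶ c) → (b ⟶ d) → Type v
  hidCell : ∀ {a b : Ob} (p : V a b), Cell p p (𝟙 a) (𝟙 b)
  hcomp : ∀ {a b c d a' b' : Ob} {p : V a b} {q : V c d} {r : V a' b'} {f : a ⟶ c} {g : b ⟶ d}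
    {f' : c ⟶ a'} {g' : d ⟶ b'}, Cell p q f g → Cell q r f' g' → Cell p r (f ≫ f') (g ≫ g')
  vidCell : ∀ {a b : Ob} (f : a ⟶ b), Cell (vid a) (vid b) f f
  vcompCell : ∀ {a b c a' b' c' : Ob} {p : V a b} {q : V b c} {p' : V a' b'} {q' : V b' c'}
    {f : a ⟶ a'} {g : b ⟶ b'} {h : c ⟶ c'},
    Cell p p' f g → Cell q q' g h → Cell (vcomp p q) (vcomp p' q') f h
  id_hcomp : ∀ {a b c d : Ob} {p : V a b} {q : V c d} {f : a ⟶ c} {g : b ⟶ d}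
    (α : Cell p q f g), HEq (hcomp (hidCell p) α) α
  hcomp_id : ∀ {a b c d : Ob} {p : V a b} {q : V c d} {f : a ⟶ c} {g : b ⟶ d}
    (α : Cell p q f g), HEq (hcomp α (hidCell q)) α
  hassoc : ∀ {a₁ b₁ a₂ b₂ a₃ b₃ a₄ b₄ : Ob} {p₁ : V a₁ b₁} {p₂ : V a₂ b₂} {p₃ : V a₃ b₃}
    {p₄ : V a₄ b₄} {f₁ : a₁ ⟶ a₂} {g₁ : b₁ ⟶ b₂} {f₂ : a₂ ⟶ a₃} {g₂ : b₂ ⟶ b₃} {f₃ : a₃ ⟶ a₄}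
    {g₃ : b₃ ⟶ b₄} (α : Cell p₁ p₂ f₁ g₁) (β : Cell p₂ p₃ f₂ g₂) (γ : Cell p₃ p₄ f₃ g₃),
    HEq (hcomp (hcomp α β) γ) (hcomp α (hcomp β γ))
  id_vcompCell : ∀ {a b c d : Ob} {p : V a b} {q : V c d} {f : a ⟶ c} {g : b ⟶ d}
    (α : Cell p q f g), HEq (vcompCell (vidCell f) α) α
  vcompCell_id : ∀ {a b c d : Ob} {p : V a b} {q : V c d} {f : a ⟶ c} {g : b ⟶ d}
    (α : Cell p q f g), HEq (vcompCell α (vidCell g)) α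
  vassocCell : ∀ {a₁ a₂ a₃ a₄ b₁ b₂ b₃ b₄ : Ob} {p₁ : V a₁ a₂} {p₂ : V a₂ a₃} {p₃ : V a₃ a₄}
    {q₁ : V b₁ b₂} {q₂ : V b₂ b₃} {q₃ : V b₃ b₄} {f₁ : a₁ ⟶ b₁} {f₂ : a₂ ⟶ b₂} {f₃ : a₃ ⟶ b₃}
    {f₄ : a₄ ⟶ b₄} (α : Cell p₁ q₁ f₁ f₂) (β : Cell p₂ q₂ f₂ f₃) (γ : Cell p₃ q₃ f₃ f₄),
    HEq (vcompCell (vcompCell α β) γ) (vcompCell α (vcompCell β γ))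
  hidCell_vid : ∀ a : Ob, hidCell (vid a) = vidCell (𝟙 a)
  hidCell_vcomp : ∀ {a b c : Ob} (p : V a b) (q : V b c),
    hidCell (vcomp p q) = vcompCell (hidCell p) (hidCell q)
  vidCell_comp : ∀ {a b c : Ob} (f : a ⟶ b) (g : b ⟶ c),
    vidCell (f ≫ g) = hcomp (vidCell f) (vidCell g)
  interchange : ∀ {a₁ a₂ a₃ b₁ b₂ b₃ c₁ c₂ c₃ : Ob} {p₁ : V a₁ a₂} {p₂ : V a₂ a₃} {q₁ : V b₁ b₂}
    {q₂ : V b₂ b₃} {r₁ : V c₁ c₂} {r₂ : V c₂ c₃} {f₁ : a₁ ⟶ b₁} {f₂ : a₂ ⟶ b₂} {f₃ : a₃ ⟶ b₃}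
    {g₁ : b₁ ⟶ c₁} {g₂ : b₂ ⟶ c₂} {g₃ : b₃ ⟶ c₃}
    (α : Cell p₁ q₁ f₁ f₂) (α' : Cell p₂ q₂ f₂ f₃) (β : Cell q₁ r₁ g₁ g₂) (β' : Cell q₂ r₂ g₂ g₃),
    hcomp (vcompCell α α') (vcompCell β β') = vcompCell (hcomp α β) (hcomp α' β')

attribute [instance] DblCat.hor

namespace DblCat

variable {J : DblCat.{v, u}}

theorem hcomp_heq {a b c d a' b' : J.Ob} {p₁ p₂ : J.V a b} {q₁ q₂ : J.V c d} {r₁ r₂ : J.V a' b'}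
    {f₁ f₂ : a ⟶ c} {g₁ g₂ : b ⟶ d} {f₁' f₂' : c ⟶ a'} {g₁' g₂' : d ⟶ b'}
    {α₁ : J.Cell p₁ q₁ f₁ g₁} {α₂ : J.Cell p₂ q₂ f₂ g₂}
    {β₁ : J.Cell q₁ r₁ f₁' g₁'} {β₂ : J.Cell q₂ r₂ f₂' g₂'}
    (hp : p₁ = p₂) (hq : q₁ = q₂) (hr : r₁ = r₂) (hf : f₁ = f₂) (hg : g₁ = g₂) (hf' : f₁' = f₂')
    (hg' : g₁' = g₂') (hα : HEq α₁ α₂) (hβ : HEq β₁ β₂) :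
    HEq (J.hcomp α₁ β₁) (J.hcomp α₂ β₂) := by
  subst hp hq hr hf hg hf' hg'
  cases hα
  cases hβ
  rfl

theorem vcompCell_heq {a b c a' b' c' : J.Ob} {p₁ p₂ : J.V a b} {q₁ q₂ : J.V b c}
    {p₁' p₂' : J.V a' b'} {q₁' q₂' : J.V b' c'} {f₁ f₂ : a ⟶ a'} {g₁ g₂ : b ⟶ b'} {h₁ h₂ : c ⟶ c'}
    {α₁ : J.Cell p₁ p₁' f₁ g₁} {α₂ : J.Cell p₂ p₂' f₂ g₂}
    {β₁ : J.Cell q₁ q₁' g₁ h₁} {β₂ : J.Cell q₂ q₂' g₂ h₂}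
    (hp : p₁ = p₂) (hq : q₁ = q₂) (hp' : p₁' = p₂') (hq' : q₁' = q₂') (hf : f₁ = f₂) (hg : g₁ = g₂)
    (hh : h₁ = h₂) (hα : HEq α₁ α₂) (hβ : HEq β₁ β₂) :
    HEq (J.vcompCell α₁ β₁) (J.vcompCell α₂ β₂) := by
  subst hp hq hp' hq' hf hg hh
  cases hα
  cases hβ
  rfl

theorem hidCell_heq {a b : J.Ob} {p q : J.V a b} (h : p = q) : HEq (J.hidCell p) (J.hidCell q) := by
  subst h
  rfl

theorem vidCell_heq {a b : J.Ob} {f g : a ⟶ b} (h : f = g) : HEq (J.vidCell f) (J.vidCell g) := by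
  subst h
  rfl

end DblCat

/-- A double functor. The functor `hor` is its action on objects and horizontal arrows. -/
structure DblFunctor (J K : DblCat.{v, u}) where
  hor : J.Ob ⥤ K.Ob
  vmap : ∀ {a b : J.Ob}, J.V a b → K.V (hor.obj a) (hor.obj b)
  cmap : ∀ {a b c d : J.Ob} {p : J.V a b} {q : J.V c d} {f : a ⟶ c} {g : b ⟶ d},
    J.Cell p q f g → K.Cell (vmap p) (vmap q) (hor.map f) (hor.map g)
  vmap_vid : ∀ a : J.Ob, vmap (J.vid a) = K.vid (hor.obj a)
  vmap_vcomp : ∀ {a b c : J.Ob} (p : J.V a b) (q : J.V b c),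
    vmap (J.vcomp p q) = K.vcomp (vmap p) (vmap q)
  cmap_hidCell : ∀ {a b : J.Ob} (p : J.V a b), HEq (cmap (J.hidCell p)) (K.hidCell (vmap p))
  cmap_hcomp : ∀ {a b c d a' b' : J.Ob} {p : J.V a b} {q : J.V c d} {r : J.V a' b'} {f : a ⟶ c}
    {g : b ⟶ d} {f' : c ⟶ a'} {g' : d ⟶ b'} (α : J.Cell p q f g) (β : J.Cell q r f' g'),
    HEq (cmap (J.hcomp α β)) (K.hcomp (cmap α) (cmap β))
  cmap_vidCell : ∀ {a b : J.Ob} (f : a ⟶ b), HEq (cmap (J.vidCell f)) (K.vidCell (hor.map f))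
  cmap_vcompCell : ∀ {a b c a' b' c' : J.Ob} {p : J.V a b} {q : J.V b c} {p' : J.V a' b'}
    {q' : J.V b' c'} {f : a ⟶ a'} {g : b ⟶ b'} {h : c ⟶ c'}
    (α : J.Cell p p' f g) (β : J.Cell q q' g h),
    HEq (cmap (J.vcompCell α β)) (K.vcompCell (cmap α) (cmap β))

namespace DblFunctor

variable {J K M N : DblCat.{v, u}}

theorem cmap_heq (F : DblFunctor J K) {a b c d : J.Ob} {p₁ p₂ : J.V a b} {q₁ q₂ : J.V c d}
    {f₁ f₂ : a ⟶ c} {g₁ g₂ : b ⟶ d} {α₁ : J.Cell p₁ q₁ f₁ g₁} {α₂ : J.Cell p₂ q₂ f₂ g₂}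
    (hp : p₁ = p₂) (hq : q₁ = q₂) (hf : f₁ = f₂) (hg : g₁ = g₂) (hα : HEq α₁ α₂) :
    HEq (F.cmap α₁) (F.cmap α₂) := by
  subst hp hq hf hg
  cases hα
  rfl

/-- The identity double functor. -/
def id (J : DblCat.{v, u}) : DblFunctor J J where
  hor := 𝟭 J.Ob
  vmap p := p
  cmap α := α
  vmap_vid _ := rfl
  vmap_vcomp _ _ := rfl
  cmap_hidCell _ := HEq.rfl
  cmap_hcomp _ _ := HEq.rfl
  cmap_vidCell _ := HEq.rfl
  cmap_vcompCell _ _ := HEq.rfl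

/-- Composition of double functors, in diagrammatic order. -/
def comp (F : DblFunctor J K) (G : DblFunctor K M) : DblFunctor J M where
  hor := F.hor ⋙ G.hor
  vmap p := G.vmap (F.vmap p)
  cmap α := G.cmap (F.cmap α)
  vmap_vid a := by rw [F.vmap_vid, G.vmap_vid]; rfl
  vmap_vcomp p q := by rw [F.vmap_vcomp, G.vmap_vcomp]
  cmap_hidCell p := (G.cmap_heq rfl rfl (F.hor.map_id _) (F.hor.map_id _) (F.cmap_hidCell p)).trans
    (G.cmap_hidCell _)
  cmap_hcomp α β := (G.cmap_heq rfl rfl (F.hor.map_comp _ _) (F.hor.map_comp _ _)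
    (F.cmap_hcomp α β)).trans (G.cmap_hcomp _ _)
  cmap_vidCell f := (G.cmap_heq (F.vmap_vid _) (F.vmap_vid _) rfl rfl (F.cmap_vidCell f)).trans
    (G.cmap_vidCell _)
  cmap_vcompCell α β := (G.cmap_heq (F.vmap_vcomp _ _) (F.vmap_vcomp _ _) rfl rfl
    (F.cmap_vcompCell α β)).trans (G.cmap_vcompCell _ _)

theorem id_comp (F : DblFunctor J K) : (id J).comp F = F := rfl

theorem comp_id (F : DblFunctor J K) : F.comp (id K) = F := rfl

theorem comp_assoc (F : DblFunctor J K) (G : DblFunctor K M) (H : DblFunctor M N) :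
    (F.comp G).comp H = F.comp (G.comp H) := rfl

end DblFunctor

/-- A horizontal transformation between double functors. -/
structure HorTrans {J K : DblCat.{v, u}} (F G : DblFunctor J K) where
  hor : F.hor ⟶ G.hor
  cell : ∀ {a b : J.Ob} (p : J.V a b), K.Cell (F.vmap p) (G.vmap p) (hor.app a) (hor.app b)
  cell_naturality : ∀ {a b c d : J.Ob} {p : J.V a b} {q : J.V c d} {f : a ⟶ c} {g : b ⟶ d}
    (α : J.Cell p q f g), HEq (K.hcomp (F.cmap α) (cell q)) (K.hcomp (cell p) (G.cmap α))
  cell_vid : ∀ a : J.Ob, HEq (cell (J.vid a)) (K.vidCell (hor.app a))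
  cell_vcomp : ∀ {a b c : J.Ob} (p : J.V a b) (q : J.V b c),
    HEq (cell (J.vcomp p q)) (K.vcompCell (cell p) (cell q))

namespace HorTrans

variable {J K M : DblCat.{v, u}}

theorem ext' {F G : DblFunctor J K} {α β : HorTrans F G} (h : α.hor = β.hor)
    (hc : ∀ {a b : J.Ob} (p : J.V a b), HEq (α.cell p) (β.cell p)) : α = β := by
  obtain ⟨a, c, _, _, _⟩ := α
  obtain ⟨a', c', _, _, _⟩ := β
  obtain rfl : a = a' := h
  have : @c = @c' := by
    funext x y p
    exact eq_of_heq (hc p)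
  subst this
  rfl

/-- The identity transformation. -/
def id (F : DblFunctor J K) : HorTrans F F where
  hor := 𝟙 F.hor
  cell p := K.hidCell (F.vmap p)
  cell_naturality α := (K.hcomp_id _).trans (K.id_hcomp _).symm
  cell_vid a := (DblCat.hidCell_heq (F.vmap_vid a)).trans (heq_of_eq (K.hidCell_vid _))
  cell_vcomp p q := (DblCat.hidCell_heq (F.vmap_vcomp p q)).trans (heq_of_eq (K.hidCell_vcomp _ _))

/-- Composition of horizontal transformations. -/
def comp {F G H : DblFunctor J K} (α : HorTrans F G) (β : HorTrans G H) : HorTrans F H where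
  hor := α.hor ≫ β.hor
  cell p := K.hcomp (α.cell p) (β.cell p)
  cell_naturality {a b c d p q f g} φ := by
    refine (K.hassoc _ _ _).symm.trans ?_
    refine (DblCat.hcomp_heq rfl rfl rfl (α.hor.naturality f) (α.hor.naturality g) rfl rfl
      (α.cell_naturality φ) HEq.rfl).trans ?_
    refine (K.hassoc _ _ _).trans ?_
    refine (DblCat.hcomp_heq rfl rfl rfl rfl rfl (β.hor.naturality f) (β.hor.naturality g) HEq.rfl
      (β.cell_naturality φ)).trans ?_
    exact (K.hassoc _ _ _).symm
  cell_vid a := (DblCat.hcomp_heq (F.vmap_vid a) (G.vmap_vid a) (H.vmap_vid a) rfl rfl rfl rfl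
    (α.cell_vid a) (β.cell_vid a)).trans (heq_of_eq (K.vidCell_comp _ _).symm)
  cell_vcomp p q := (DblCat.hcomp_heq (F.vmap_vcomp p q) (G.vmap_vcomp p q) (H.vmap_vcomp p q)
    rfl rfl rfl rfl (α.cell_vcomp p q) (β.cell_vcomp p q)).trans (heq_of_eq (K.interchange _ _ _ _))

/-- Whiskering on the left by a double functor. -/
def whiskerLeft (F : DblFunctor J K) {G H : DblFunctor K M} (β : HorTrans G H) :
    HorTrans (F.comp G) (F.comp H) where
  hor := Functor.whiskerLeft F.hor β.hor
  cell p := β.cell (F.vmap p)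
  cell_naturality φ := β.cell_naturality (F.cmap φ)
  cell_vid a := by
    have : HEq (β.cell (F.vmap (J.vid a))) (β.cell (K.vid (F.hor.obj a))) := by rw [F.vmap_vid]
    exact this.trans (β.cell_vid _)
  cell_vcomp p q := by
    have : HEq (β.cell (F.vmap (J.vcomp p q))) (β.cell (K.vcomp (F.vmap p) (F.vmap q))) := by
      rw [F.vmap_vcomp]
    exact this.trans (β.cell_vcomp _ _)

/-- Whiskering on the right by a double functor. -/
def whiskerRight {F G : DblFunctor J K} (α : HorTrans F G) (H : DblFunctor K M) :
    HorTrans (F.comp H) (G.comp H) where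
  hor := Functor.whiskerRight α.hor H.hor
  cell p := H.cmap (α.cell p)
  cell_naturality {a b c d p q f g} φ := (H.cmap_hcomp _ _).symm.trans
    ((H.cmap_heq rfl rfl (α.hor.naturality f) (α.hor.naturality g) (α.cell_naturality φ)).trans
      (H.cmap_hcomp _ _))
  cell_vid a := (H.cmap_heq (F.vmap_vid a) (G.vmap_vid a) rfl rfl (α.cell_vid a)).trans
    (H.cmap_vidCell _)
  cell_vcomp p q := (H.cmap_heq (F.vmap_vcomp p q) (G.vmap_vcomp p q) rfl rfl
    (α.cell_vcomp p q)).trans (H.cmap_vcompCell _ _)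

end HorTrans

/-! ## Concrete double categories -/

/-- A proposition regarded as a type with at most one element. -/
structure Holds (P : Prop) : Type v where
  prf : P

instance (P : Prop) : Subsingleton (Holds.{v} P) := ⟨fun ⟨_⟩ ⟨_⟩ => rfl⟩

theorem holds_heq {P Q : Prop} (h : P = Q) (a : Holds.{v} P) (b : Holds.{v} Q) : HEq a b := by
  subst h
  exact heq_of_eq (Subsingleton.elim a b)

/-- A double category whose objects and horizontal arrows are those of `C`, and in which
there is at most one cell with a given boundary. -/
structure ThinData (C : Type u) [Category.{v} C] where
  V : C → C → Type (max u v)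
  vid : ∀ a : C, V a a
  vcomp : ∀ {a b c : C}, V a b → V b c → V a c
  vid_vcomp : ∀ {a b : C} (p : V a b), vcomp (vid a) p = p
  vcomp_vid : ∀ {a b : C} (p : V a b), vcomp p (vid b) = p
  vassoc : ∀ {a b c d : C} (p : V a b) (q : V b c) (r : V c d),
    vcomp (vcomp p q) r = vcomp p (vcomp q r)
  /-- `IsCell p q f g`: there is a cell with left `p`, right `q`, top `f` and bottom `g`. -/
  IsCell : ∀ {a b c d : C}, V a b → V c d → (a ⟶ c) → (b ⟶ d) → Prop
  hid : ∀ {a b : C} (p : V a b), IsCell p p (𝟙 a) (𝟙 b)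
  hcomp : ∀ {a b c d a' b' : C} {p : V a b} {q : V c d} {r : V a' b'} {f : a ⟶ c} {g : b ⟶ d}
    {f' : c ⟶ a'} {g' : d ⟶ b'}, IsCell p q f g → IsCell q r f' g' → IsCell p r (f ≫ f') (g ≫ g')
  vidCell : ∀ {a b : C} (f : a ⟶ b), IsCell (vid a) (vid b) f f
  vcompCell : ∀ {a b c a' b' c' : C} {p : V a b} {q : V b c} {p' : V a' b'} {q' : V b' c'}
    {f : a ⟶ a'} {g : b ⟶ b'} {h : c ⟶ c'},
    IsCell p p' f g → IsCell q q' g h → IsCell (vcomp p q) (vcomp p' q') f h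

/-- The double category given by `ThinData`. -/
def ThinData.dbl {C : Type u} [Category.{v} C] (T : ThinData C) : DblCat.{v, u} where
  Ob := C
  V := T.V
  vid := T.vid
  vcomp := T.vcomp
  vid_vcomp := T.vid_vcomp
  vcomp_vid := T.vcomp_vid
  vassoc := T.vassoc
  Cell p q f g := Holds (T.IsCell p q f g)
  hidCell p := ⟨T.hid p⟩
  hcomp α β := ⟨T.hcomp α.prf β.prf⟩
  vidCell f := ⟨T.vidCell f⟩
  vcompCell α β := ⟨T.vcompCell α.prf β.prf⟩
  id_hcomp _ := holds_heq (by rw [Category.id_comp, Category.id_comp]) _ _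
  hcomp_id _ := holds_heq (by rw [Category.comp_id, Category.comp_id]) _ _
  hassoc _ _ _ := holds_heq (by rw [Category.assoc, Category.assoc]) _ _
  id_vcompCell _ := holds_heq (by rw [T.vid_vcomp, T.vid_vcomp]) _ _
  vcompCell_id _ := holds_heq (by rw [T.vcomp_vid, T.vcomp_vid]) _ _
  vassocCell _ _ _ := holds_heq (by rw [T.vassoc, T.vassoc]) _ _
  hidCell_vid _ := rfl
  hidCell_vcomp _ _ := rfl
  vidCell_comp _ _ := rfl
  interchange _ _ _ _ := rfl

/-- A double functor between double categories given by `ThinData`. -/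
def ThinData.functor {C D : Type u} [Category.{v} C] [Category.{v} D] {S : ThinData C}
    {T : ThinData D} (F : C ⥤ D) (vmap : ∀ {a b : C}, S.V a b → T.V (F.obj a) (F.obj b))
    (h : ∀ {a b c d : C} {p : S.V a b} {q : S.V c d} {f : a ⟶ c} {g : b ⟶ d},
      S.IsCell p q f g → T.IsCell (vmap p) (vmap q) (F.map f) (F.map g))
    (hid : ∀ a : C, vmap (S.vid a) = T.vid (F.obj a))
    (hcomp : ∀ {a b c : C} (p : S.V a b) (q : S.V b c),
      vmap (S.vcomp p q) = T.vcomp (vmap p) (vmap q)) : DblFunctor S.dbl T.dbl where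
  hor := F
  vmap := vmap
  cmap α := ⟨h α.prf⟩
  vmap_vid := hid
  vmap_vcomp := hcomp
  cmap_hidCell _ := holds_heq (congrArg₂ (fun x y => T.IsCell _ _ x y) (F.map_id _) (F.map_id _)) _ _
  cmap_hcomp _ _ := holds_heq
    (congrArg₂ (fun x y => T.IsCell _ _ x y) (F.map_comp _ _) (F.map_comp _ _)) _ _
  cmap_vidCell _ := holds_heq
    (congrArg₂ (fun x y => T.IsCell x y _ _) (hid _) (hid _)) _ _
  cmap_vcompCell _ _ := holds_heq
    (congrArg₂ (fun x y => T.IsCell x y _ _) (hcomp _ _) (hcomp _ _)) _ _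

theorem ThinData.functor_ext {J : DblCat.{v, u}} {D : Type u} [Category.{v} D]
    {T : ThinData D} {F G : DblFunctor J T.dbl} (h : F.hor = G.hor)
    (hv : ∀ {a b : J.Ob} (p : J.V a b), HEq (F.vmap p) (G.vmap p)) : F = G := by
  obtain ⟨a, w, c, _, _, _, _, _, _⟩ := F
  obtain ⟨a', w', c', _, _, _, _, _, _⟩ := G
  obtain rfl : a = a' := h
  have : @w = @w' := by
    funext x y p
    exact eq_of_heq (hv p)
  subst this
  have : @c = @c' := by
    funext _ _ _ _ _ _ _ _ _
    exact Subsingleton.elim (α := Holds _) _ _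
  subst this
  rfl

/-- A vertical arrow of `Sq C`. -/
structure VArr {C : Type u} [Category.{v} C] (a b : C) : Type (max u v) where
  arr : a ⟶ b

/-- Data for `Sq C`. -/
def sqData (C : Type u) [Category.{v} C] : ThinData C where
  V a b := VArr a b
  vid a := ⟨𝟙 a⟩
  vcomp p q := ⟨p.arr ≫ q.arr⟩
  vid_vcomp p := by simp
  vcomp_vid p := by simp
  vassoc p q r := by simp
  IsCell p q f g := p.arr ≫ g = f ≫ q.arr
  hid p := by simp
  hcomp h h' := by rw [reassoc_of% h, h', Category.assoc]
  vidCell f := by simp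
  vcompCell h h' := by
    dsimp only
    rw [Category.assoc, h', reassoc_of% h]

/-- The double category `Sq C` of commutative squares in `C`. -/
def Sq (C : Type u) [Category.{v} C] : DblCat.{v, u} := (sqData C).dbl

/-- The double functor `Sq F : Sq C → Sq D`. -/
def sqMap {C D : Type u} [Category.{v} C] [Category.{v} D] (F : C ⥤ D) :
    DblFunctor (Sq C) (Sq D) :=
  ThinData.functor (S := sqData C) (T := sqData D) F (fun p => ⟨F.map p.arr⟩)
    (fun {a b c d p q f g} h => by
      change F.map _ ≫ F.map _ = F.map _ ≫ F.map _
      rw [← F.map_comp, ← F.map_comp]; exact congrArg _ h)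
    (fun a => congrArg VArr.mk (F.map_id a))
    (fun p q => congrArg VArr.mk (F.map_comp p.arr q.arr))

/-- The horizontal transformation `Sq γ : Sq F ⇒ Sq G`. -/
def sqMap₂ {C D : Type u} [Category.{v} C] [Category.{v} D] {F G : C ⥤ D} (γ : F ⟶ G) :
    HorTrans (sqMap F) (sqMap G) where
  hor := γ
  cell p := ⟨γ.naturality p.arr⟩
  cell_naturality {a b c d p q f g} _ := holds_heq
    (congrArg₂ (fun x y => (sqData D).IsCell _ _ x y) (γ.naturality f) (γ.naturality g)) _ _
  cell_vid a := holds_heq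
    (congrArg₂ (fun x y => (sqData D).IsCell x y _ _) ((sqMap F).vmap_vid a)
      ((sqMap G).vmap_vid a)) _ _
  cell_vcomp p q := holds_heq
    (congrArg₂ (fun x y => (sqData D).IsCell x y _ _) ((sqMap F).vmap_vcomp p q)
      ((sqMap G).vmap_vcomp p q)) _ _

/-! ## Algebraic weak factorisation systems -/

/-- A functorial factorisation, i.e. a section `f ↦ (lam f, E f, rho f)` of the composition functor
from composable pairs to arrows. -/
structure FunctorialFactorisation (C : Type u) [Category.{v} C] where
  E : Arrow C ⥤ C
  lam : Arrow.leftFunc ⟶ E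
  rho : E ⟶ Arrow.rightFunc
  fac : ∀ f : Arrow C, lam.app f ≫ rho.app f = f.hom

namespace FunctorialFactorisation

variable {C : Type u} [Category.{v} C] (A : FunctorialFactorisation C)

/-- The functor `f ↦ lam f`. -/
def L : Arrow C ⥤ Arrow C where
  obj f := Arrow.mk (A.lam.app f)
  map φ := Arrow.homMk φ.left (A.E.map φ) (A.lam.naturality φ)

/-- The functor `f ↦ rho f`. -/
def R : Arrow C ⥤ Arrow C where
  obj f := Arrow.mk (A.rho.app f)
  map φ := Arrow.homMk (A.E.map φ) φ.right (A.rho.naturality φ)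

/-- The counit `(1, rho f) : lam f ⟶ f`. -/
def ε : A.L ⟶ 𝟭 (Arrow C) where
  app f := Arrow.homMk (u := 𝟙 f.left) (v := A.rho.app f)
    ((Category.id_comp _).trans (A.fac f).symm)
  naturality f g φ := by
    ext
    · exact (Category.comp_id _).trans (Category.id_comp _).symm
    · exact A.rho.naturality φ

/-- The unit `(lam f, 1) : f ⟶ rho f`. -/
def η : 𝟭 (Arrow C) ⟶ A.R where
  app f := Arrow.homMk (u := A.lam.app f) (v := 𝟙 f.right)
    ((A.fac f).trans (Category.comp_id _).symm)
  naturality f g φ := by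
    ext
    · exact A.lam.naturality φ
    · exact (Category.comp_id _).trans (Category.id_comp _).symm

end FunctorialFactorisation

/-- An algebraic weak factorisation structure on a functorial factorisation: extensions of `(L, ε)`
to a comonad and of `(R, η)` to a monad, and a distributive law `LR ⇒ RL` of the comonad over the
monad whose underlying transformation `δ` satisfies `dom δ = cod Δ` and `cod δ = dom μ`. -/
structure AWFSStructure {C : Type u} [Category.{v} C] (A : FunctorialFactorisation C) where
  Δ : A.L ⟶ A.L ⋙ A.L
  Δ_counit : ∀ f, Δ.app f ≫ A.ε.app (A.L.obj f) = 𝟙 (A.L.obj f)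
  Δ_map_counit : ∀ f, Δ.app f ≫ A.L.map (A.ε.app f) = 𝟙 (A.L.obj f)
  Δ_coassoc : ∀ f, Δ.app f ≫ A.L.map (Δ.app f) = Δ.app f ≫ Δ.app (A.L.obj f)
  μ : A.R ⋙ A.R ⟶ A.R
  μ_unit : ∀ f, A.η.app (A.R.obj f) ≫ μ.app f = 𝟙 (A.R.obj f)
  μ_map_unit : ∀ f, A.R.map (A.η.app f) ≫ μ.app f = 𝟙 (A.R.obj f)
  μ_assoc : ∀ f, A.R.map (μ.app f) ≫ μ.app f = μ.app (A.R.obj f) ≫ μ.app f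
  δ : A.R ⋙ A.L ⟶ A.L ⋙ A.R
  δ_dom : ∀ f, (δ.app f).left = (Δ.app f).right
  δ_cod : ∀ f, (δ.app f).right = (μ.app f).left
  δ_unit : ∀ f, A.L.map (A.η.app f) ≫ δ.app f = A.η.app (A.L.obj f)
  δ_counit : ∀ f, δ.app f ≫ A.R.map (A.ε.app f) = A.ε.app (A.R.obj f)
  δ_mul : ∀ f, A.L.map (μ.app f) ≫ δ.app f
    = δ.app (A.R.obj f) ≫ A.R.map (δ.app f) ≫ μ.app (A.L.obj f)
  δ_comul : ∀ f, δ.app f ≫ A.R.map (Δ.app f)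
    = Δ.app (A.R.obj f) ≫ A.L.map (δ.app f) ≫ δ.app (A.L.obj f)

/-- An algebraic weak factorisation system on `C`. -/
structure AWFS (C : Type u) [Category.{v} C] extends FunctorialFactorisation C where
  str : AWFSStructure toFunctorialFactorisation

namespace AWFS

variable {C : Type u} [Category.{v} C] (A : AWFS C)

/-- The middle object of the factorisation of `f`. -/
abbrev ob {a b : C} (f : a ⟶ b) : C := A.E.obj (Arrow.mk f)

/-- The left part of the factorisation of `f`. -/
def l {a b : C} (f : a ⟶ b) : a ⟶ A.ob f := A.lam.app (Arrow.mk f)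

/-- The right part of the factorisation of `f`. -/
def r {a b : C} (f : a ⟶ b) : A.ob f ⟶ b := A.rho.app (Arrow.mk f)

/-- The map `E(h, k) : E f ⟶ E g` induced by a square `(h, k) : f ⟶ g`. -/
def em {a b c d : C} {f : a ⟶ b} {g : c ⟶ d} (h : a ⟶ c) (k : b ⟶ d) (w : h ≫ g = f ≫ k) :
    A.ob f ⟶ A.ob g :=
  A.E.map (Arrow.homMk (f := Arrow.mk f) (g := Arrow.mk g) h k w)

/-- The codomain component of the comultiplication at `f`. -/
def sig {a b : C} (f : a ⟶ b) : A.ob f ⟶ A.ob (A.l f) := (A.str.Δ.app (Arrow.mk f)).right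

/-- The domain component of the multiplication at `f`. -/
def pi {a b : C} (f : a ⟶ b) : A.ob (A.r f) ⟶ A.ob f := (A.str.μ.app (Arrow.mk f)).left

section

variable {a b c d e e' : C} {f : a ⟶ b} {g : c ⟶ d} {x : e ⟶ e'}

theorem l_r (f : a ⟶ b) : A.l f ≫ A.r f = f := A.fac (Arrow.mk f)

theorem em_em {h : a ⟶ c} {k : b ⟶ d} (w : h ≫ g = f ≫ k) {h' : c ⟶ e} {k' : d ⟶ e'}
    (w' : h' ≫ x = g ≫ k') : A.em h k w ≫ A.em h' k' w' =
      A.em (h ≫ h') (k ≫ k') (by rw [Category.assoc, w', reassoc_of% w]) := by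
  rw [em, em, ← A.E.map_comp]
  rfl

theorem em_congr {h h' : a ⟶ c} {k k' : b ⟶ d} {w : h ≫ g = f ≫ k} (hh : h = h') (hk : k = k') :
    A.em h k w = A.em h' k' (by rw [← hh, ← hk, w]) := by
  subst hh hk
  rfl

theorem l_em {h : a ⟶ c} {k : b ⟶ d} (w : h ≫ g = f ≫ k) :
    A.l f ≫ A.em h k w = h ≫ A.l g :=
  (A.lam.naturality (Arrow.homMk (f := Arrow.mk f) (g := Arrow.mk g) h k w)).symm

theorem em_r {h : a ⟶ c} {k : b ⟶ d} (w : h ≫ g = f ≫ k) :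
    A.em h k w ≫ A.r g = A.r f ≫ k :=
  A.rho.naturality (Arrow.homMk (f := Arrow.mk f) (g := Arrow.mk g) h k w)

theorem Δ_left (f : Arrow C) : (A.str.Δ.app f).left = 𝟙 f.left := by
  have := congrArg CommaMorphism.left (A.str.Δ_counit f)
  exact (Category.comp_id _).symm.trans this

theorem μ_right (f : Arrow C) : (A.str.μ.app f).right = 𝟙 f.right := by
  have := congrArg CommaMorphism.right (A.str.μ_unit f)
  exact (Category.id_comp _).symm.trans this

theorem l_sig (f : a ⟶ b) : A.l f ≫ A.sig f = A.l (A.l f) := by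
  have := (A.str.Δ.app (Arrow.mk f)).w
  have h := A.Δ_left (Arrow.mk f)
  refine this.symm.trans ?_
  change (A.str.Δ.app (Arrow.mk f)).left ≫ _ = _
  rw [h]
  exact Category.id_comp _

theorem sig_r (f : a ⟶ b) : A.sig f ≫ A.r (A.l f) = 𝟙 _ :=
  congrArg CommaMorphism.right (A.str.Δ_counit (Arrow.mk f))

theorem sig_em_r (f : a ⟶ b) : A.sig f ≫ A.em (𝟙 a) (A.r f)
    (by rw [Category.id_comp, A.l_r]) = 𝟙 _ :=
  congrArg CommaMorphism.right (A.str.Δ_map_counit (Arrow.mk f))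

theorem em_sig {h : a ⟶ c} {k : b ⟶ d} (w : h ≫ g = f ≫ k) :
    A.em h k w ≫ A.sig g = A.sig f ≫ A.em h (A.em h k w) (A.l_em w).symm :=
  congrArg CommaMorphism.right
    (A.str.Δ.naturality (Arrow.homMk (f := Arrow.mk f) (g := Arrow.mk g) h k w))

theorem sig_sig (f : a ⟶ b) : A.sig f ≫ A.em (𝟙 a) (A.sig f)
    (by rw [Category.id_comp, A.l_sig]) = A.sig f ≫ A.sig (A.l f) := by
  refine Eq.trans ?_ (congrArg CommaMorphism.right (A.str.Δ_coassoc (Arrow.mk f)))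
  change A.sig f ≫ _ = A.sig f ≫ _
  congr 1
  change A.E.map _ = A.E.map _
  congr 1
  ext
  · exact (A.Δ_left (Arrow.mk f)).symm
  · rfl

theorem pi_r (f : a ⟶ b) : A.pi f ≫ A.r f = A.r (A.r f) := by
  have := (A.str.μ.app (Arrow.mk f)).w
  have h := A.μ_right (Arrow.mk f)
  refine this.trans ?_
  change _ ≫ (A.str.μ.app (Arrow.mk f)).right = _
  rw [h]
  exact Category.comp_id _

theorem l_pi (f : a ⟶ b) : A.l (A.r f) ≫ A.pi f = 𝟙 _ :=
  congrArg CommaMorphism.left (A.str.μ_unit (Arrow.mk f))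

theorem em_l_pi (f : a ⟶ b) : A.em (A.l f) (𝟙 b)
    (by rw [Category.comp_id, A.l_r]) ≫ A.pi f = 𝟙 _ :=
  congrArg CommaMorphism.left (A.str.μ_map_unit (Arrow.mk f))

theorem pi_em {h : a ⟶ c} {k : b ⟶ d} (w : h ≫ g = f ≫ k) :
    A.pi f ≫ A.em h k w = A.em (A.em h k w) k (A.em_r w) ≫ A.pi g :=
  (congrArg CommaMorphism.left
    (A.str.μ.naturality (Arrow.homMk (f := Arrow.mk f) (g := Arrow.mk g) h k w))).symm

theorem pi_pi (f : a ⟶ b) : A.em (A.pi f) (𝟙 b)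
    (by rw [Category.comp_id, A.pi_r]) ≫ A.pi f = A.pi (A.r f) ≫ A.pi f := by
  refine Eq.trans ?_ (congrArg CommaMorphism.left (A.str.μ_assoc (Arrow.mk f)))
  change _ ≫ A.pi f = _ ≫ A.pi f
  congr 1
  change A.E.map _ = A.E.map _
  congr 1
  ext
  · rfl
  · exact (A.μ_right (Arrow.mk f)).symm

theorem pi_sig (f : a ⟶ b) : A.pi f ≫ A.sig f = A.sig (A.r f) ≫
    A.em (A.sig f) (A.pi f) (by rw [A.sig_r, A.l_pi]) ≫ A.pi (A.l f) := by
  have h := congrArg CommaMorphism.right (A.str.δ_comul (Arrow.mk f))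
  have h1 := A.str.δ_cod (Arrow.mk f)
  have h2 := A.str.δ_cod (A.L.obj (Arrow.mk f))
  refine Eq.trans ?_ (h.trans ?_)
  · exact congrArg (· ≫ A.sig f) h1.symm
  · change A.sig (A.r f) ≫ A.E.map (A.str.δ.app (Arrow.mk f)) ≫ (A.str.δ.app _).right = _
    congr 1
    refine congrArg₂ (· ≫ ·) ?_ h2
    change _ = A.E.map _
    congr 1
    ext
    · exact A.str.δ_dom _
    · exact A.str.δ_cod _

end

/-! ### Coalgebras -/

/-- An `L`-coalgebra `a ⟶ b`: an arrow `f : a ⟶ b` together with `s : b ⟶ E f` such that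
`(1, s) : f ⟶ lam f` is a coalgebra structure for the comonad `L`. -/
structure Coalg (a b : C) : Type (max u v) extends VArr a b where
  s : b ⟶ A.ob arr
  arr_s : arr ≫ s = A.l arr
  s_r : s ≫ A.r arr = 𝟙 b
  s_sig : s ≫ A.sig arr = s ≫ A.em (𝟙 a) s (by rw [Category.id_comp, arr_s])

/-- `(h, k)` is a map of coalgebras `p ⟶ q`. -/
def IsCoalgMap {a b c d : C} (p : A.Coalg a b) (q : A.Coalg c d) (h : a ⟶ c) (k : b ⟶ d) : Prop :=
  ∃ w : h ≫ q.arr = p.arr ≫ k, p.s ≫ A.em h k w = k ≫ q.s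

namespace Coalg

variable {A}
variable {a b c d e e' x x' y y' : C}

theorem ext_s {p q : A.Coalg a b} (h : p.arr = q.arr) (hs : HEq p.s q.s) : p = q := by
  obtain ⟨⟨f⟩, s, _, _, _⟩ := p
  obtain ⟨⟨f'⟩, s', _, _, _⟩ := q
  obtain rfl : f = f' := h
  obtain rfl : s = s' := eq_of_heq hs
  rfl

/-- The canonical lifting of a coalgebra against the free algebra on `z`. -/
def Φ (p : A.Coalg a b) {z : x ⟶ y} (m : a ⟶ A.ob z) (n : b ⟶ y) (w : m ≫ A.r z = p.arr ≫ n) :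
    b ⟶ A.ob z :=
  p.s ≫ A.em m n w ≫ A.pi z

theorem Φ_congr (p : A.Coalg a b) {z : x ⟶ y} {m m' : a ⟶ A.ob z} {n n' : b ⟶ y}
    {w : m ≫ A.r z = p.arr ≫ n} (hm : m = m') (hn : n = n') :
    p.Φ m n w = p.Φ m' n' (by rw [← hm, ← hn, w]) := by
  subst hm hn
  rfl

theorem arr_Φ (p : A.Coalg a b) {z : x ⟶ y} {m : a ⟶ A.ob z} {n : b ⟶ y}
    (w : m ≫ A.r z = p.arr ≫ n) : p.arr ≫ p.Φ m n w = m := by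
  rw [Φ, reassoc_of% p.arr_s, reassoc_of% (A.l_em w), A.l_pi, Category.comp_id]

theorem Φ_r (p : A.Coalg a b) {z : x ⟶ y} {m : a ⟶ A.ob z} {n : b ⟶ y}
    (w : m ≫ A.r z = p.arr ≫ n) : p.Φ m n w ≫ A.r z = n := by
  rw [Φ, Category.assoc, Category.assoc, A.pi_r, A.em_r, reassoc_of% p.s_r]

theorem Φ_map (p : A.Coalg a b) {z : x ⟶ y} {z' : x' ⟶ y'} {m : a ⟶ A.ob z} {n : b ⟶ y}
    (w : m ≫ A.r z = p.arr ≫ n) {t : A.ob z ⟶ A.ob z'} {k : y ⟶ y'}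
    (ht : t ≫ A.r z' = A.r z ≫ k) (ht' : A.pi z ≫ t = A.em t k ht ≫ A.pi z') :
    p.Φ m n w ≫ t = p.Φ (m ≫ t) (n ≫ k) (by rw [Category.assoc, ht, reassoc_of% w]) := by
  simp only [Φ, Category.assoc]
  rw [ht', reassoc_of% (A.em_em w ht)]

theorem free_map {z : x ⟶ y} {z' : x' ⟶ y'} {m : x ⟶ A.ob z'} {n : y ⟶ y'}
    (w : m ≫ A.r z' = z ≫ n) : ∃ ht : (A.em m n w ≫ A.pi z') ≫ A.r z' = A.r z ≫ n,
      A.pi z ≫ (A.em m n w ≫ A.pi z') = A.em (A.em m n w ≫ A.pi z') n ht ≫ A.pi z' := by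
  refine ⟨by rw [Category.assoc, A.pi_r, A.em_r], ?_⟩
  rw [reassoc_of% (A.pi_em w), ← A.pi_pi, reassoc_of% (A.em_em (A.em_r w))]
  congr 1
  exact A.em_congr rfl (Category.comp_id _)

theorem Φ_self (p : A.Coalg a b) : p.Φ (z := p.arr) (A.l p.arr) (𝟙 b)
    (by rw [A.l_r, Category.comp_id]) = p.s := by
  rw [Φ, A.em_l_pi, Category.comp_id]

theorem Φ_natural {p : A.Coalg a b} {q : A.Coalg c d} {h : a ⟶ c} {k : b ⟶ d}
    (hk : A.IsCoalgMap p q h k) {z : x ⟶ y} {m : c ⟶ A.ob z} {n : d ⟶ y}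
    (w : m ≫ A.r z = q.arr ≫ n) :
    p.Φ (h ≫ m) (k ≫ n) (by rw [Category.assoc, w, reassoc_of% hk.1]) = k ≫ q.Φ m n w := by
  obtain ⟨w', e⟩ := hk
  rw [Φ, Φ, ← reassoc_of% e, reassoc_of% (A.em_em w' w)]

/-- The coalgebra structure on an identity. -/
def one (A : AWFS C) (a : C) : A.Coalg a a where
  arr := 𝟙 a
  s := A.l (𝟙 a)
  arr_s := Category.id_comp _
  s_r := A.l_r _
  s_sig := by rw [A.l_sig, A.l_em, Category.id_comp]

/-- The intermediate lifting used for the composite of coalgebras. -/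
def mid (p : A.Coalg a b) (q : A.Coalg b c) {k : a ⟶ c} (hk : k = p.arr ≫ q.arr) :
    b ⟶ A.ob k :=
  p.Φ (A.l k) q.arr (by rw [A.l_r, hk])

/-- The structure map of the composite coalgebra: lift `(lam k, 1) : k ⟶ rho k` first against `p`
and then against `q`, where `k` is the composite arrow. -/
def compS (p : A.Coalg a b) (q : A.Coalg b c) {k : a ⟶ c} (hk : k = p.arr ≫ q.arr) :
    c ⟶ A.ob k :=
  q.Φ (p.mid q hk) (𝟙 c) (by rw [mid, Φ_r, Category.comp_id])

theorem compS_coassoc (p : A.Coalg a b) (q : A.Coalg b c) {k : a ⟶ c} (hk : k = p.arr ≫ q.arr)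
    (hS : k ≫ p.compS q hk = A.l k) :
    p.compS q hk ≫ A.sig k = p.compS q hk ≫ A.em (𝟙 a) (p.compS q hk)
      (by rw [Category.id_comp, hS]) := by
  have hqS : q.arr ≫ p.compS q hk = p.mid q hk := arr_Φ _ _
  -- composing a lifting against `rho k` with `sig k`
  have key : ∀ {a' b' : C} (z : A.Coalg a' b') (m : a' ⟶ A.ob k) (n : b' ⟶ c)
      (w : m ≫ A.r k = z.arr ≫ n) (hn : m ≫ A.em (𝟙 a) (p.compS q hk)
        (by rw [Category.id_comp, hS]) = m ≫ A.sig k) (hn' : z.Φ m n w = n ≫ p.compS q hk),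
      z.Φ m n w ≫ A.sig k = z.Φ m n w ≫ A.em (𝟙 a) (p.compS q hk)
        (by rw [Category.id_comp, hS]) := by
    intro a' b' z m n w hn hn'
    have e0 : 𝟙 a ≫ A.l k = k ≫ p.compS q hk := by rw [Category.id_comp, hS]
    have e1 := z.Φ_map w (A.em_r e0) (A.pi_em e0)
    rw [e1]
    have hpi := A.pi_sig k
    have w1 := w
    simp only [Φ, Category.assoc]
    rw [hpi, reassoc_of% (A.em_sig w), reassoc_of% z.s_sig]
    rw [reassoc_of% (A.em_em (f := z.arr) (g := A.l z.arr) (h := 𝟙 a') (k := z.s)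
      (by rw [Category.id_comp, z.arr_s]) (A.l_em w).symm)]
    rw [reassoc_of% (A.em_em (f := z.arr) (g := A.l (A.r k)) (x := A.r (A.l k)))]
    congr 2
    refine A.em_congr ?_ ?_
    · exact hn.symm
    · rw [Category.assoc]; exact hn'
  have hw : p.mid q hk = q.arr ≫ p.compS q hk := hqS.symm
  have k1 := key p (A.l k) q.arr (by rw [A.l_r, hk])
    (by rw [A.l_em, A.l_sig, Category.id_comp]) hw
  exact key q (p.mid q hk) (𝟙 c) (by rw [mid, Φ_r, Category.comp_id]) k1.symm
    (Category.id_comp _).symm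

/-- Vertical composition of coalgebras. -/
def comp (p : A.Coalg a b) (q : A.Coalg b c) : A.Coalg a c where
  arr := p.arr ≫ q.arr
  s := p.compS q rfl
  arr_s := by rw [compS, Category.assoc, arr_Φ, mid, arr_Φ]
  s_r := by rw [compS, Φ_r]
  s_sig := compS_coassoc p q rfl (by rw [compS, Category.assoc, arr_Φ, mid, arr_Φ])

theorem eq_comp {p : A.Coalg a b} {q : A.Coalg b c} {t : A.Coalg a c} (hk : t.arr = p.arr ≫ q.arr)
    (hs : t.s = p.compS q hk) : t = p.comp q := by
  obtain ⟨⟨f⟩, s, _, _, _⟩ := t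
  dsimp at hk hs
  subst hk
  subst hs
  rfl

theorem Φ_comp (p : A.Coalg a b) (q : A.Coalg b c) {z : x ⟶ y} {m : a ⟶ A.ob z} {n : c ⟶ y}
    (w : m ≫ A.r z = (p.comp q).arr ≫ n) :
    (p.comp q).Φ m n w = q.Φ (p.Φ m (q.arr ≫ n) (by rw [w]; exact Category.assoc _ _ _)) n
      (by rw [Φ_r]) := by
  obtain ⟨h1, h2⟩ := free_map w
  change p.compS q rfl ≫ A.em m n w ≫ A.pi z = _
  refine (Φ_map q _ h1 h2).trans (Φ_congr _ ?_ (Category.id_comp _))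
  refine (Φ_map p _ h1 h2).trans (Φ_congr _ ?_ rfl)
  change A.l (p.comp q).arr ≫ _ = _
  rw [reassoc_of% (A.l_em w), A.l_pi, Category.comp_id]

theorem ext_Φ {p q : A.Coalg a b} (h : p.arr = q.arr)
    (hΦ : ∀ {x y : C} (z : x ⟶ y) (m : a ⟶ A.ob z) (n : b ⟶ y) (w : m ≫ A.r z = p.arr ≫ n)
      (w' : m ≫ A.r z = q.arr ≫ n), p.Φ m n w = q.Φ m n w') : p = q := by
  have h1 := p.Φ_self
  have h2 := q.Φ_self
  obtain ⟨⟨f⟩, s, _, _, _⟩ := p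
  obtain ⟨⟨f'⟩, s', _, _, _⟩ := q
  dsimp at h
  subst h
  refine ext_s rfl (heq_of_eq ?_)
  exact h1.symm.trans ((hΦ _ _ _ _ _).trans h2)

theorem one_Φ {z : x ⟶ y} {m : a ⟶ A.ob z} {n : a ⟶ y} (w : m ≫ A.r z = (one A a).arr ≫ n) :
    (one A a).Φ m n w = m :=
  (Category.id_comp _).symm.trans (arr_Φ _ w)

theorem one_comp (p : A.Coalg a b) : (one A a).comp p = p := by
  refine ext_Φ (Category.id_comp _) fun z m n w w' => ?_
  rw [Φ_comp]
  exact Φ_congr _ (one_Φ _) rfl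

theorem comp_one (p : A.Coalg a b) : p.comp (one A b) = p := by
  refine ext_Φ (Category.comp_id _) fun z m n w w' => ?_
  rw [Φ_comp, one_Φ]
  exact Φ_congr _ rfl (Category.id_comp _)

theorem comp_assoc (p : A.Coalg a b) (q : A.Coalg b c) (t : A.Coalg c d) :
    (p.comp q).comp t = p.comp (q.comp t) := by
  refine ext_Φ (Category.assoc _ _ _) fun z m n w w' => ?_
  refine (Φ_comp _ _ w).trans (Eq.trans ?_ (Φ_comp _ _ w').symm)
  refine Eq.trans ?_ (Φ_comp _ _ _).symm
  refine Φ_congr _ ((Φ_comp _ _ _).trans (Φ_congr _ (Φ_congr _ rfl ?_) rfl)) rfl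
  exact (Category.assoc _ _ _).symm

end Coalg

/-- Data for `DCoalg`. -/
def coalgData : ThinData C where
  V a b := A.Coalg a b
  vid a := Coalg.one A a
  vcomp p q := p.comp q
  vid_vcomp p := p.one_comp
  vcomp_vid p := p.comp_one
  vassoc p q t := p.comp_assoc q t
  IsCell p q f g := A.IsCoalgMap p q f g
  hid p := ⟨by rw [Category.id_comp, Category.comp_id], by
    have : A.em (𝟙 _) (𝟙 _) (by rw [Category.id_comp, Category.comp_id]) = 𝟙 (A.ob p.arr) :=
      A.E.map_id _
    rw [this, Category.id_comp, Category.comp_id]⟩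
  hcomp := by
    rintro _ _ _ _ _ _ p q t f g f' g' ⟨w, h⟩ ⟨w', h'⟩
    refine ⟨by rw [Category.assoc, w', reassoc_of% w], ?_⟩
    rw [← A.em_em w w', reassoc_of% h, h', Category.assoc]
  vidCell f := ⟨(Category.comp_id _).trans (Category.id_comp _).symm, A.l_em _⟩
  vcompCell := by
    rintro a b c a' b' c' p q p' q' f g h hp hq
    have w1 := hp.1
    have w2 := hq.1
    have w : f ≫ p'.arr ≫ q'.arr = (p.arr ≫ q.arr) ≫ h := by
      rw [reassoc_of% w1, w2, Category.assoc]
    refine ⟨w, ?_⟩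
    change p.compS q rfl ≫ A.em f h w = h ≫ p'.compS q' rfl
    rw [Coalg.compS, Coalg.compS, Coalg.Φ_map _ _ (A.em_r w) (A.pi_em w), ← Coalg.Φ_natural hq]
    refine Coalg.Φ_congr _ ?_ ((Category.id_comp _).trans (Category.comp_id _).symm)
    rw [Coalg.mid, Coalg.mid, Coalg.Φ_map _ _ (A.em_r w) (A.pi_em w), ← Coalg.Φ_natural hp]
    exact Coalg.Φ_congr _ (A.l_em w) w2.symm

/-- The double category of `L`-coalgebras. -/
def DCoalg : DblCat.{v, u} := A.coalgData.dbl

/-- The forgetful double functor `DCoalg ⟶ Sq C`. -/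
def coalgForget : DblFunctor A.DCoalg (Sq C) :=
  ThinData.functor (S := A.coalgData) (T := sqData C) (𝟭 C) (fun p => p.toVArr)
    (fun h => h.1.symm) (fun _ => rfl) (fun _ _ => rfl)

end AWFS

namespace AWFS

variable {C : Type u} [Category.{v} C] (A : AWFS C)

/-! ### Algebras -/

/-- An `R`-algebra `a ⟶ b`: an arrow `f : a ⟶ b` together with `p : E f ⟶ a` such that
`(p, 1) : rho f ⟶ f` is an algebra structure for the monad `R`. -/
structure Alg (a b : C) : Type (max u v) extends VArr a b where
  p : A.ob arr ⟶ a
  l_p : A.l arr ≫ p = 𝟙 a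
  p_arr : p ≫ arr = A.r arr
  pi_p : A.pi arr ≫ p = A.em p (𝟙 b) (by rw [Category.comp_id, p_arr]) ≫ p

/-- `(h, k)` is a map of algebras `p ⟶ q`. -/
def IsAlgMap {a b c d : C} (p : A.Alg a b) (q : A.Alg c d) (h : a ⟶ c) (k : b ⟶ d) : Prop :=
  ∃ w : h ≫ q.arr = p.arr ≫ k, A.em h k w ≫ q.p = p.p ≫ h

namespace Alg

variable {A}
variable {a b c d x x' y y' : C}

theorem ext_p {p q : A.Alg a b} (h : p.arr = q.arr) (hs : HEq p.p q.p) : p = q := by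
  obtain ⟨⟨f⟩, s, _, _, _⟩ := p
  obtain ⟨⟨f'⟩, s', _, _, _⟩ := q
  obtain rfl : f = f' := h
  obtain rfl : s = s' := eq_of_heq hs
  rfl

/-- The canonical lifting of the cofree coalgebra on `z` against an algebra. -/
def Ψ (q : A.Alg a b) {z : x ⟶ y} (m : x ⟶ a) (n : A.ob z ⟶ b) (w : m ≫ q.arr = A.l z ≫ n) :
    A.ob z ⟶ a :=
  A.sig z ≫ A.em m n w ≫ q.p

theorem Ψ_congr (q : A.Alg a b) {z : x ⟶ y} {m m' : x ⟶ a} {n n' : A.ob z ⟶ b}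
    {w : m ≫ q.arr = A.l z ≫ n} (hm : m = m') (hn : n = n') :
    q.Ψ m n w = q.Ψ m' n' (by rw [← hm, ← hn, w]) := by
  subst hm hn
  rfl

theorem l_Ψ (q : A.Alg a b) {z : x ⟶ y} {m : x ⟶ a} {n : A.ob z ⟶ b}
    (w : m ≫ q.arr = A.l z ≫ n) : A.l z ≫ q.Ψ m n w = m := by
  rw [Ψ, reassoc_of% (A.l_sig z), reassoc_of% (A.l_em w), q.l_p, Category.comp_id]

theorem Ψ_arr (q : A.Alg a b) {z : x ⟶ y} {m : x ⟶ a} {n : A.ob z ⟶ b}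
    (w : m ≫ q.arr = A.l z ≫ n) : q.Ψ m n w ≫ q.arr = n := by
  rw [Ψ, Category.assoc, Category.assoc, q.p_arr, A.em_r, reassoc_of% (A.sig_r z)]

theorem Ψ_map (q : A.Alg a b) {z : x ⟶ y} {z' : x' ⟶ y'} {m : x ⟶ a} {n : A.ob z ⟶ b}
    (w : m ≫ q.arr = A.l z ≫ n) {t : A.ob z' ⟶ A.ob z} {k : x' ⟶ x}
    (ht : k ≫ A.l z = A.l z' ≫ t) (ht' : t ≫ A.sig z = A.sig z' ≫ A.em k t ht) :
    t ≫ q.Ψ m n w = q.Ψ (k ≫ m) (t ≫ n) (by rw [Category.assoc, w, reassoc_of% ht]) := by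
  simp only [Ψ]
  rw [reassoc_of% ht', reassoc_of% (A.em_em ht w)]

theorem cofree_map {z : x ⟶ y} {z' : x' ⟶ y'} {m : x' ⟶ x} {n : A.ob z' ⟶ y}
    (w : m ≫ z = A.l z' ≫ n) : ∃ ht : m ≫ A.l z = A.l z' ≫ (A.sig z' ≫ A.em m n w),
      (A.sig z' ≫ A.em m n w) ≫ A.sig z = A.sig z' ≫ A.em m (A.sig z' ≫ A.em m n w) ht := by
  refine ⟨by rw [reassoc_of% (A.l_sig z'), A.l_em], ?_⟩
  rw [Category.assoc, A.em_sig w, ← reassoc_of% (A.sig_sig z'), A.em_em]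
  congr 1
  exact A.em_congr (Category.id_comp _) rfl

theorem Ψ_self (q : A.Alg a b) : q.Ψ (z := q.arr) (𝟙 a) (A.r q.arr)
    (by rw [A.l_r, Category.id_comp]) = q.p := by
  rw [Ψ, reassoc_of% (A.sig_em_r q.arr)]

theorem Ψ_natural {p : A.Alg a b} {q : A.Alg c d} {h : a ⟶ c} {k : b ⟶ d}
    (hk : A.IsAlgMap p q h k) {z : x ⟶ y} {m : x ⟶ a} {n : A.ob z ⟶ b}
    (w : m ≫ p.arr = A.l z ≫ n) :
    q.Ψ (m ≫ h) (n ≫ k) (by rw [Category.assoc, hk.1, reassoc_of% w]) = p.Ψ m n w ≫ h := by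
  have e := hk.2
  have h1 := A.em_em w hk.1
  simp only [Ψ, Category.assoc]
  rw [← reassoc_of% h1]
  exact congrArg _ (congrArg _ e)

/-- The algebra structure on an identity. -/
def one (A : AWFS C) (a : C) : A.Alg a a where
  arr := 𝟙 a
  p := A.r (𝟙 a)
  l_p := A.l_r _
  p_arr := Category.comp_id _
  pi_p := by rw [A.pi_r, A.em_r, Category.comp_id]

/-- The intermediate lifting used for the composite of algebras. -/
def mid (p : A.Alg a b) (q : A.Alg b c) {k : a ⟶ c} (hk : k = p.arr ≫ q.arr) :
    A.ob k ⟶ b :=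
  q.Ψ p.arr (A.r k) (by rw [A.l_r, hk])

/-- The structure map of the composite algebra: lift `(1, rho k) : lam k ⟶ k` first against `q`
and then against `p`, where `k` is the composite arrow. -/
def compP (p : A.Alg a b) (q : A.Alg b c) {k : a ⟶ c} (hk : k = p.arr ≫ q.arr) :
    A.ob k ⟶ a :=
  p.Ψ (𝟙 a) (p.mid q hk) (by rw [mid, l_Ψ, Category.id_comp])

theorem compP_assoc (p : A.Alg a b) (q : A.Alg b c) {k : a ⟶ c} (hk : k = p.arr ≫ q.arr)
    (hS : p.compP q hk ≫ k = A.r k) :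
    A.pi k ≫ p.compP q hk = A.em (p.compP q hk) (𝟙 c)
      (by rw [Category.comp_id, hS]) ≫ p.compP q hk := by
  have hqS : p.compP q hk ≫ p.arr = p.mid q hk := Ψ_arr _ _
  -- composing `pi k` with a lifting of `lam k`
  have key : ∀ {a' b' : C} (z : A.Alg a' b') (m : a ⟶ a') (n : A.ob k ⟶ b')
      (w : m ≫ z.arr = A.l k ≫ n) (hn : A.em (p.compP q hk) (𝟙 c)
        (by rw [Category.comp_id, hS]) ≫ n = A.pi k ≫ n) (hn' : z.Ψ m n w = p.compP q hk ≫ m),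
      A.pi k ≫ z.Ψ m n w = A.em (p.compP q hk) (𝟙 c)
        (by rw [Category.comp_id, hS]) ≫ z.Ψ m n w := by
    intro a' b' z m n w hn hn'
    have e0 : p.compP q hk ≫ k = A.r k ≫ 𝟙 c := by rw [Category.comp_id, hS]
    have e1 := z.Ψ_map w (A.l_em e0).symm (A.em_sig e0)
    rw [e1]
    have hpi := A.pi_sig k
    simp only [Ψ]
    rw [reassoc_of% hpi, reassoc_of% (A.pi_em w), z.pi_p]
    rw [reassoc_of% (A.em_em (f := A.r (A.l k)) (g := A.r z.arr) (x := z.arr)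
      (A.em_r w) (by rw [Category.comp_id, z.p_arr]))]
    rw [reassoc_of% (A.em_em (f := A.l (A.r k)) (g := A.r (A.l k)) (x := z.arr))]
    congr 2
    refine A.em_congr ?_ ?_
    · exact hn'
    · exact (congrArg _ (Category.comp_id _)).trans hn.symm
  have k1 := key q p.arr (A.r k) (by rw [A.l_r, hk])
    (by rw [A.em_r, A.pi_r, Category.comp_id]) hqS.symm
  exact key p (𝟙 a) (p.mid q hk) (by rw [mid, l_Ψ, Category.id_comp]) k1.symm
    (Category.comp_id _).symm

/-- Vertical composition of algebras. -/
def comp (p : A.Alg a b) (q : A.Alg b c) : A.Alg a c where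
  arr := p.arr ≫ q.arr
  p := p.compP q rfl
  l_p := by rw [compP, l_Ψ]
  p_arr := by rw [compP, ← Category.assoc, Ψ_arr, mid, Ψ_arr]
  pi_p := compP_assoc p q rfl (by rw [compP, ← Category.assoc, Ψ_arr, mid, Ψ_arr])

theorem Ψ_comp (p : A.Alg a b) (q : A.Alg b c) {z : x ⟶ y} {m : x ⟶ a} {n : A.ob z ⟶ c}
    (w : m ≫ (p.comp q).arr = A.l z ≫ n) :
    (p.comp q).Ψ m n w = p.Ψ m (q.Ψ (m ≫ p.arr) n (by rw [← w]; exact Category.assoc _ _ _))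
      (by rw [l_Ψ]) := by
  obtain ⟨h1, h2⟩ := cofree_map w
  refine (Category.assoc _ _ _).symm.trans ?_
  refine (Ψ_map p _ h1 h2).trans (Ψ_congr _ (Category.comp_id _) ?_)
  refine (Ψ_map q _ h1 h2).trans (Ψ_congr _ rfl ?_)
  change _ ≫ A.r (p.comp q).arr = _
  rw [Category.assoc, A.em_r, reassoc_of% (A.sig_r z)]

theorem ext_Ψ {p q : A.Alg a b} (h : p.arr = q.arr)
    (hΨ : ∀ {x y : C} (z : x ⟶ y) (m : x ⟶ a) (n : A.ob z ⟶ b) (w : m ≫ p.arr = A.l z ≫ n)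
      (w' : m ≫ q.arr = A.l z ≫ n), p.Ψ m n w = q.Ψ m n w') : p = q := by
  have h1 := p.Ψ_self
  have h2 := q.Ψ_self
  obtain ⟨⟨f⟩, s, _, _, _⟩ := p
  obtain ⟨⟨f'⟩, s', _, _, _⟩ := q
  dsimp at h
  subst h
  refine ext_p rfl (heq_of_eq ?_)
  exact h1.symm.trans ((hΨ _ _ _ _ _).trans h2)

theorem one_Ψ {z : x ⟶ y} {m : x ⟶ a} {n : A.ob z ⟶ a} (w : m ≫ (one A a).arr = A.l z ≫ n) :
    (one A a).Ψ m n w = n :=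
  (Category.comp_id _).symm.trans (Ψ_arr _ w)

theorem one_comp (p : A.Alg a b) : (one A a).comp p = p := by
  refine ext_Ψ (Category.id_comp _) fun z m n w w' => ?_
  refine (Ψ_comp _ _ w).trans ((one_Ψ _).trans ?_)
  exact Ψ_congr _ (Category.comp_id _) rfl

theorem comp_one (p : A.Alg a b) : p.comp (one A b) = p := by
  refine ext_Ψ (Category.comp_id _) fun z m n w w' => ?_
  refine (Ψ_comp _ _ w).trans ?_
  exact Ψ_congr _ rfl (one_Ψ _)

theorem comp_assoc (p : A.Alg a b) (q : A.Alg b c) (t : A.Alg c d) :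
    (p.comp q).comp t = p.comp (q.comp t) := by
  refine ext_Ψ (Category.assoc _ _ _) fun z m n w w' => ?_
  refine (Ψ_comp _ _ w).trans (Eq.trans ?_ (Ψ_comp _ _ w').symm)
  refine (Ψ_comp _ _ _).trans ?_
  refine Ψ_congr _ rfl (Eq.trans ?_ (Ψ_comp _ _ _).symm)
  refine Ψ_congr _ rfl (Ψ_congr _ ?_ rfl)
  exact (Category.assoc _ _ _).symm

end Alg

/-- Data for `DAlg`. -/
def algData : ThinData C where
  V a b := A.Alg a b
  vid a := Alg.one A a
  vcomp p q := p.comp q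
  vid_vcomp p := p.one_comp
  vcomp_vid p := p.comp_one
  vassoc p q t := p.comp_assoc q t
  IsCell p q f g := A.IsAlgMap p q f g
  hid p := ⟨by rw [Category.id_comp, Category.comp_id], by
    have : A.em (𝟙 _) (𝟙 _) (by rw [Category.id_comp, Category.comp_id]) = 𝟙 (A.ob p.arr) :=
      A.E.map_id _
    rw [this, Category.id_comp, Category.comp_id]⟩
  hcomp := by
    rintro _ _ _ _ _ _ p q t f g f' g' ⟨w, h⟩ ⟨w', h'⟩
    refine ⟨by rw [Category.assoc, w', reassoc_of% w], ?_⟩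
    rw [← A.em_em w w', Category.assoc, h', reassoc_of% h]
  vidCell f := ⟨(Category.comp_id _).trans (Category.id_comp _).symm, A.em_r _⟩
  vcompCell := by
    rintro a b c a' b' c' p q p' q' f g h hp hq
    have w1 := hp.1
    have w2 := hq.1
    have w : f ≫ p'.arr ≫ q'.arr = (p.arr ≫ q.arr) ≫ h := by
      rw [reassoc_of% w1, w2, Category.assoc]
    refine ⟨w, ?_⟩
    change A.em f h w ≫ p'.compP q' rfl = p.compP q rfl ≫ f
    rw [Alg.compP, Alg.compP, Alg.Ψ_map _ _ (A.l_em w).symm (A.em_sig w), ← Alg.Ψ_natural hp]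
    refine Alg.Ψ_congr _ ((Category.comp_id _).trans (Category.id_comp _).symm) ?_
    rw [Alg.mid, Alg.mid, Alg.Ψ_map _ _ (A.l_em w).symm (A.em_sig w), ← Alg.Ψ_natural hq]
    exact Alg.Ψ_congr _ w1 (A.em_r w)

/-- The double category of `R`-algebras. -/
def DAlg : DblCat.{v, u} := A.algData.dbl

/-- The forgetful double functor `DAlg ⟶ Sq C`. -/
def algForget : DblFunctor A.DAlg (Sq C) :=
  ThinData.functor (S := A.algData) (T := sqData C) (𝟭 C) (fun p => p.toVArr)
    (fun h => h.1.symm) (fun _ => rfl) (fun _ _ => rfl)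

end AWFS

/-! ## Lifting operations and cofibrant generation -/

section Lifting

variable {C : Type u} [Category.{v} C] {J : DblCat.{v, u}} (U : DblFunctor J (Sq C))

/-- The object of `C` underlying an object of `J`. -/
def uobj (i : J.Ob) : C := U.hor.obj i

/-- The arrow of `C` underlying a horizontal arrow of `J`. -/
def umap {i j : J.Ob} (f : i ⟶ j) : uobj U i ⟶ uobj U j := U.hor.map f

/-- The arrow of `C` underlying a vertical arrow of `J`. -/
def uarr {i j : J.Ob} (p : J.V i j) : uobj U i ⟶ uobj U j := (U.vmap p).arr

theorem uarr_umap {i j i' j' : J.Ob} {p : J.V i j} {q : J.V i' j'} {f : i ⟶ i'} {g : j ⟶ j'}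
    (α : J.Cell p q f g) : uarr U p ≫ umap U g = umap U f ≫ uarr U q := (U.cmap α).prf

theorem uarr_vcomp {i j k : J.Ob} (p : J.V i j) (q : J.V j k) :
    uarr U (J.vcomp p q) = uarr U p ≫ uarr U q :=
  congrArg VArr.arr (U.vmap_vcomp p q)

theorem uarr_vid (i : J.Ob) : uarr U (J.vid i) = 𝟙 (uobj U i) :=
  congrArg VArr.arr (U.vmap_vid i)

/-- An arrow `arr : a ⟶ b` of `C` equipped with a lifting operation against `U : J ⟶ Sq C`: a
choice of diagonal fillers for all squares from `U p`, with `p` a vertical arrow of `J`, to `arr`,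
natural with respect to the cells of `J` and compatible with vertical composition in `J`. -/
structure LiftArr (a b : C) : Type (max u v) extends VArr a b where
  lift : ∀ {i j : J.Ob} (p : J.V i j) (x : uobj U i ⟶ a) (y : uobj U j ⟶ b),
    uarr U p ≫ y = x ≫ arr → (uobj U j ⟶ a)
  uarr_lift : ∀ {i j : J.Ob} (p : J.V i j) (x : uobj U i ⟶ a) (y : uobj U j ⟶ b)
    (w : uarr U p ≫ y = x ≫ arr), uarr U p ≫ lift p x y w = x
  lift_arr : ∀ {i j : J.Ob} (p : J.V i j) (x : uobj U i ⟶ a) (y : uobj U j ⟶ b)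
    (w : uarr U p ≫ y = x ≫ arr), lift p x y w ≫ arr = y
  natural : ∀ {i j i' j' : J.Ob} {p : J.V i j} {q : J.V i' j'} {f : i ⟶ i'} {g : j ⟶ j'}
    (α : J.Cell p q f g) (x : uobj U i' ⟶ a) (y : uobj U j' ⟶ b) (w : uarr U q ≫ y = x ≫ arr),
    lift p (umap U f ≫ x) (umap U g ≫ y)
      (by rw [reassoc_of% (uarr_umap U α), w, Category.assoc]) = umap U g ≫ lift q x y w
  vertical : ∀ {i j k : J.Ob} (p : J.V i j) (q : J.V j k) (x : uobj U i ⟶ a) (y : uobj U k ⟶ b)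
    (w : uarr U (J.vcomp p q) ≫ y = x ≫ arr),
    lift (J.vcomp p q) x y w =
      lift q (lift p x (uarr U q ≫ y) (by rw [← w, uarr_vcomp, Category.assoc])) y
        (by rw [lift_arr])

namespace LiftArr

variable {U}
variable {a b c d : C}

theorem ext' {s t : LiftArr U a b} (h : s.arr = t.arr)
    (hl : ∀ {i j : J.Ob} (p : J.V i j) (x : uobj U i ⟶ a) (y : uobj U j ⟶ b)
      (w : uarr U p ≫ y = x ≫ s.arr) (w' : uarr U p ≫ y = x ≫ t.arr),
      s.lift p x y w = t.lift p x y w') : s = t := by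
  obtain ⟨⟨f⟩, l, _, _, _, _⟩ := s
  obtain ⟨⟨f'⟩, l', _, _, _, _⟩ := t
  obtain rfl : f = f' := h
  have : @l = @l' := by
    funext i j p x y w
    exact hl p x y w w
  subst this
  rfl

theorem lift_congr (s : LiftArr U a b) {i j : J.Ob} (p : J.V i j) {x x' : uobj U i ⟶ a}
    {y y' : uobj U j ⟶ b} {w : uarr U p ≫ y = x ≫ s.arr} (hx : x = x') (hy : y = y') :
    s.lift p x y w = s.lift p x' y' (by rw [← hx, ← hy, w]) := by
  subst hx hy
  rfl

/-- The (unique) lifting operation on an identity. -/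
def one (a : C) : LiftArr U a a where
  arr := 𝟙 a
  lift p x y w := y
  uarr_lift p x y w := by rw [w, Category.comp_id]
  lift_arr p x y w := Category.comp_id _
  natural α x y w := rfl
  vertical p q x y w := rfl

/-- The composite lifting operation: lift first against `t` and then against `s`. -/
def comp (s : LiftArr U a b) (t : LiftArr U b c) : LiftArr U a c where
  arr := s.arr ≫ t.arr
  lift p x y w := s.lift p x (t.lift p (x ≫ s.arr) y (by rw [w, Category.assoc]))
    (t.uarr_lift _ _ _ _)
  uarr_lift p x y w := s.uarr_lift _ _ _ _
  lift_arr p x y w := by rw [reassoc_of% (s.lift_arr), t.lift_arr]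
  natural {i j i' j' p q f g} α x y w := by
    rw [← s.natural α]
    refine s.lift_congr _ rfl ?_
    rw [← t.natural α]
    exact t.lift_congr _ (Category.assoc _ _ _) rfl
  vertical p q x y w := by
    rw [s.vertical]
    refine s.lift_congr _ (s.lift_congr _ rfl ?_) ?_
    · rw [t.vertical, t.uarr_lift]
    · rw [t.vertical]
      refine t.lift_congr _ ?_ rfl
      rw [s.lift_arr]

/-- `(h, k)` is a map of arrows with lifting operation. -/
def IsMap (s : LiftArr U a b) (t : LiftArr U c d) (h : a ⟶ c) (k : b ⟶ d) : Prop :=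
  ∃ e : h ≫ t.arr = s.arr ≫ k, ∀ {i j : J.Ob} (p : J.V i j) (x : uobj U i ⟶ a) (y : uobj U j ⟶ b)
    (w : uarr U p ≫ y = x ≫ s.arr), s.lift p x y w ≫ h =
      t.lift p (x ≫ h) (y ≫ k) (by rw [reassoc_of% w, Category.assoc, e])

end LiftArr

/-- Data for the double category of arrows with a lifting operation. -/
def rlData : ThinData C where
  V a b := LiftArr U a b
  vid a := LiftArr.one a
  vcomp s t := s.comp t
  vid_vcomp s := LiftArr.ext' (Category.id_comp _) fun p x y w w' =>
    s.lift_congr _ (Category.comp_id _) rfl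
  vcomp_vid s := LiftArr.ext' (Category.comp_id _) fun p x y w w' => rfl
  vassoc s t r := LiftArr.ext' (Category.assoc _ _ _) fun p x y w w' =>
    s.lift_congr _ rfl (t.lift_congr _ rfl (r.lift_congr _ (Category.assoc _ _ _).symm rfl))
  IsCell s t f g := s.IsMap t f g
  hid s := ⟨by rw [Category.id_comp, Category.comp_id], fun p x y w => by
    rw [Category.comp_id]
    exact s.lift_congr _ (Category.comp_id _).symm (Category.comp_id _).symm⟩
  hcomp := by
    rintro _ _ _ _ _ _ s t r f g f' g' ⟨e, h⟩ ⟨e', h'⟩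
    refine ⟨by rw [Category.assoc, e', reassoc_of% e], fun p x y w => ?_⟩
    rw [← Category.assoc, h, h']
    exact r.lift_congr _ (Category.assoc _ _ _) (Category.assoc _ _ _)
  vidCell f := ⟨(Category.comp_id _).trans (Category.id_comp _).symm, fun _ _ _ _ => rfl⟩
  vcompCell := by
    rintro a b c a' b' c' s t s' t' f g h ⟨e, hs⟩ ⟨e', ht⟩
    refine ⟨?_, fun p x y w => ?_⟩
    · change f ≫ s'.arr ≫ t'.arr = (s.arr ≫ t.arr) ≫ h
      rw [reassoc_of% e, e', Category.assoc]
    · refine (hs _ _ _ _).trans (s'.lift_congr _ rfl ?_)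
      refine (ht _ _ _ _).trans (t'.lift_congr _ ?_ rfl)
      rw [Category.assoc, Category.assoc, e]

/-- The double category of arrows of `C` with a lifting operation against `U : J ⟶ Sq C`. -/
def Drl : DblCat.{v, u} := (rlData U).dbl

/-- The forgetful double functor to `Sq C`. -/
def rlForget : DblFunctor (Drl U) (Sq C) :=
  ThinData.functor (S := rlData U) (T := sqData C) (𝟭 C) (fun p => p.toVArr)
    (fun h => h.1.symm) (fun _ => rfl) (fun _ _ => rfl)

end Lifting

/-- Two double categories over a third one are isomorphic over it. -/
def IsoOver {K M N : DblCat.{v, u}} (P : DblFunctor K N) (Q : DblFunctor M N) : Prop :=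
  ∃ (F : DblFunctor K M) (G : DblFunctor M K),
    F.comp G = DblFunctor.id K ∧ G.comp F = DblFunctor.id M ∧ F.comp Q = P

/-- `A` is (class-)cofibrantly generated by the (possibly large) double category `U : J ⟶ Sq C`:
the double category of `R`-algebras is isomorphic over `Sq C` to the double category of arrows
with a lifting operation against `J`. -/
def IsCofibrantlyGenerated {C : Type u} [Category.{v} C] (A : AWFS C) {J : DblCat.{v, u}}
    (U : DblFunctor J (Sq C)) : Prop :=
  IsoOver A.algForget (rlForget U)

/-! ## The 2-category of double categories over `Sq(-)` and left adjoint morphisms -/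

namespace HorTrans

variable {J K M N : DblCat.{v, u}}

theorem id_comp {F G : DblFunctor J K} (α : HorTrans F G) : (id F).comp α = α :=
  ext' (Category.id_comp _) fun _ => K.id_hcomp _

theorem comp_id {F G : DblFunctor J K} (α : HorTrans F G) : α.comp (id G) = α :=
  ext' (Category.comp_id _) fun _ => K.hcomp_id _

theorem assoc {F G H I : DblFunctor J K} (α : HorTrans F G) (β : HorTrans G H)
    (γ : HorTrans H I) : (α.comp β).comp γ = α.comp (β.comp γ) :=
  ext' (Category.assoc _ _ _) fun _ => K.hassoc _ _ _

theorem whiskerLeft_id (F : DblFunctor J K) (G : DblFunctor K M) :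
    whiskerLeft F (id G) = id (F.comp G) := rfl

theorem whiskerLeft_comp (F : DblFunctor J K) {G H I : DblFunctor K M} (α : HorTrans G H)
    (β : HorTrans H I) :
    whiskerLeft F (α.comp β) = (whiskerLeft F α).comp (whiskerLeft F β) := rfl

theorem id_whiskerRight (F : DblFunctor J K) (G : DblFunctor K M) :
    whiskerRight (id F) G = id (F.comp G) :=
  ext' (Functor.whiskerRight_id _) fun _ => G.cmap_hidCell _

theorem comp_whiskerRight {F G H : DblFunctor J K} (α : HorTrans F G) (β : HorTrans G H)
    (I : DblFunctor K M) :
    whiskerRight (α.comp β) I = (whiskerRight α I).comp (whiskerRight β I) :=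
  ext' (Functor.whiskerRight_comp _ _ _) fun _ => I.cmap_hcomp _ _

theorem exchange {F G : DblFunctor J K} {H I : DblFunctor K M} (α : HorTrans F G)
    (β : HorTrans H I) :
    (whiskerLeft F β).comp (whiskerRight α I) = (whiskerRight α H).comp (whiskerLeft G β) :=
  ext' (by ext a; exact (β.hor.naturality _).symm) fun p => (β.cell_naturality (α.cell p)).symm

theorem comp_heq {F F' G G' H H' : DblFunctor J K} (hF : F = F') (hG : G = G') (hH : H = H')
    {α : HorTrans F G} {β : HorTrans G H} {α' : HorTrans F' G'} {β' : HorTrans G' H'}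
    (hα : HEq α α') (hβ : HEq β β') : HEq (α.comp β) (α'.comp β') := by
  subst hF hG hH
  cases hα
  cases hβ
  rfl

theorem id_heq {F F' : DblFunctor J K} (hF : F = F') : HEq (id F) (id F') := by
  subst hF
  rfl

theorem whiskerLeft_heq {F F' : DblFunctor J K} {G G' H H' : DblFunctor K M} (hF : F = F')
    (hG : G = G') (hH : H = H') {β : HorTrans G H} {β' : HorTrans G' H'} (hβ : HEq β β') :
    HEq (whiskerLeft F β) (whiskerLeft F' β') := by
  subst hF hG hH
  cases hβ
  rfl

theorem whiskerRight_heq {F F' G G' : DblFunctor J K} {H H' : DblFunctor K M} (hF : F = F')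
    (hG : G = G') (hH : H = H') {α : HorTrans F G} {α' : HorTrans F' G'} (hα : HEq α α') :
    HEq (whiskerRight α H) (whiskerRight α' H') := by
  subst hF hG hH
  cases hα
  rfl

theorem ext_thin {D : Type u} [Category.{v} D] {T : ThinData D} {F G : DblFunctor J T.dbl}
    {α β : HorTrans F G} (h : α.hor = β.hor) : α = β := by
  obtain ⟨a, c, _, _, _⟩ := α
  obtain ⟨a', c', _, _, _⟩ := β
  obtain rfl : a = a' := h
  have : @c = @c' := by
    funext _ _ _
    exact Subsingleton.elim (α := Holds _) _ _
  subst this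
  rfl

end HorTrans

/-- An object of `DBL / Sq(-)_ladj`: a double functor `U : J ⟶ Sq C`. -/
structure DblOver where
  C : Type u
  [cat : Category.{v} C]
  J : DblCat.{v, u}
  U : DblFunctor J (Sq C)

attribute [instance] DblOver.cat

namespace DblOver

/-- A 1-cell of `DBL / Sq(-)_ladj`: a functor `F` with a chosen right adjoint `G`, and a double
functor `bar` lying strictly over `Sq F`. -/
structure Map (X Y : DblOver.{v, u}) where
  F : X.C ⥤ Y.C
  G : Y.C ⥤ X.C
  adj : F ⊣ G
  bar : DblFunctor X.J Y.J
  comm : bar.comp Y.U = X.U.comp (sqMap F)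

theorem Map.ext' {X Y : DblOver.{v, u}} {P Q : Map X Y} (hF : P.F = Q.F) (hG : P.G = Q.G)
    (hadj : HEq P.adj Q.adj) (hbar : P.bar = Q.bar) : P = Q := by
  obtain ⟨F, G, a, b, _⟩ := P
  obtain ⟨F', G', a', b', _⟩ := Q
  obtain rfl : F = F' := hF
  obtain rfl : G = G' := hG
  obtain rfl : a = a' := eq_of_heq hadj
  obtain rfl : b = b' := hbar
  rfl

/-- A 2-cell of `DBL / Sq(-)_ladj`: a natural transformation `γ : F ⇒ F'` together with a
horizontal transformation `bar` with `U' bar = Sq γ U`. -/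
structure Cell₂ {X Y : DblOver.{v, u}} (P Q : Map X Y) where
  γ : P.F ⟶ Q.F
  bar : HorTrans P.bar Q.bar
  comm : HEq (HorTrans.whiskerRight bar Y.U) (HorTrans.whiskerLeft X.U (sqMap₂ γ))

theorem Cell₂.ext' {X Y : DblOver.{v, u}} {P Q : Map X Y} {σ τ : Cell₂ P Q} (h : σ.γ = τ.γ)
    (hb : σ.bar = τ.bar) : σ = τ := by
  obtain ⟨_, _, _⟩ := σ
  obtain ⟨_, _, _⟩ := τ
  obtain rfl := h
  obtain rfl := hb
  rfl

instance {X Y : DblOver.{v, u}} : Category (Map X Y) where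
  Hom P Q := Cell₂ P Q
  id P := ⟨𝟙 P.F, HorTrans.id P.bar, by
    rw [HorTrans.id_whiskerRight]
    refine (HorTrans.id_heq P.comm).trans (heq_of_eq ?_)
    exact HorTrans.ext_thin rfl⟩
  comp {P Q R} σ τ := ⟨σ.γ ≫ τ.γ, σ.bar.comp τ.bar, by
    rw [HorTrans.comp_whiskerRight]
    refine (HorTrans.comp_heq P.comm Q.comm R.comm σ.comm τ.comm).trans (heq_of_eq ?_)
    exact HorTrans.ext_thin rfl⟩
  id_comp σ := Cell₂.ext' (Category.id_comp _) (HorTrans.id_comp _)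
  comp_id σ := Cell₂.ext' (Category.comp_id _) (HorTrans.comp_id _)
  assoc σ τ ρ := Cell₂.ext' (Category.assoc _ _ _) (HorTrans.assoc _ _ _)

/-- Identity 1-cell. -/
def idMap (X : DblOver.{v, u}) : Map X X where
  F := 𝟭 X.C
  G := 𝟭 X.C
  adj := Adjunction.id
  bar := DblFunctor.id X.J
  comm := ThinData.functor_ext rfl fun _ => HEq.rfl

/-- Composite 1-cell. -/
def compMap {X Y Z : DblOver.{v, u}} (P : Map X Y) (Q : Map Y Z) : Map X Z where
  F := P.F ⋙ Q.F
  G := Q.G ⋙ P.G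
  adj := P.adj.comp Q.adj
  bar := P.bar.comp Q.bar
  comm := by
    rw [DblFunctor.comp_assoc, Q.comm, ← DblFunctor.comp_assoc, P.comm, DblFunctor.comp_assoc]
    rfl

/-- Left whiskering. -/
def whiskL {X Y Z : DblOver.{v, u}} (P : Map X Y) {Q R : Map Y Z} (τ : Q ⟶ R) :
    compMap P Q ⟶ compMap P R where
  γ := Functor.whiskerLeft P.F τ.γ
  bar := HorTrans.whiskerLeft P.bar τ.bar
  comm := (HorTrans.whiskerLeft_heq (F := P.bar) rfl Q.comm R.comm τ.comm).trans
    (HorTrans.whiskerLeft_heq (β := sqMap₂ τ.γ) P.comm rfl rfl HEq.rfl)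

/-- Right whiskering. -/
def whiskR {X Y Z : DblOver.{v, u}} {P Q : Map X Y} (σ : P ⟶ Q) (R : Map Y Z) :
    compMap P R ⟶ compMap Q R where
  γ := Functor.whiskerRight σ.γ R.F
  bar := HorTrans.whiskerRight σ.bar R.bar
  comm := by
    have h1 : HEq (HorTrans.whiskerRight σ.bar (R.bar.comp Z.U))
        (HorTrans.whiskerRight σ.bar (Y.U.comp (sqMap R.F))) := by rw [R.comm]
    exact h1.trans (HorTrans.whiskerRight_heq (H := sqMap R.F) P.comm Q.comm rfl σ.comm)

theorem adj_id_comp {C D : Type u} [Category.{v} C] [Category.{v} D] {F : C ⥤ D} {G : D ⥤ C}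
    (adj : F ⊣ G) : Adjunction.id.comp adj = adj := by
  ext; simp [Adjunction.comp_unit_app]

theorem adj_comp_id {C D : Type u} [Category.{v} C] [Category.{v} D] {F : C ⥤ D} {G : D ⥤ C}
    (adj : F ⊣ G) : adj.comp Adjunction.id = adj := by
  ext; simp [Adjunction.comp_unit_app]

theorem adj_assoc {C D E E' : Type u} [Category.{v} C] [Category.{v} D] [Category.{v} E]
    [Category.{v} E'] {F : C ⥤ D} {G : D ⥤ C} {F' : D ⥤ E} {G' : E ⥤ D} {F'' : E ⥤ E'}
    {G'' : E' ⥤ E} (adj : F ⊣ G) (adj' : F' ⊣ G') (adj'' : F'' ⊣ G'') :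
    (adj.comp adj').comp adj'' = adj.comp (adj'.comp adj'') := by
  ext; simp [Adjunction.comp_unit_app]

/-- The 2-cell between two 1-cells with the same underlying functor and double functor,
all of whose components are identities. -/
def idIso {X Y : DblOver.{v, u}} {F : X.C ⥤ Y.C} {G : Y.C ⥤ X.C} {a a' : F ⊣ G}
    {b : DblFunctor X.J Y.J} {c c' : b.comp Y.U = X.U.comp (sqMap F)} :
    Map.mk F G a b c ≅ Map.mk F G a' b c' where
  hom := ⟨𝟙 F, HorTrans.id b, Cell₂.comm (𝟙 (Map.mk F G a b c))⟩
  inv := ⟨𝟙 F, HorTrans.id b, Cell₂.comm (𝟙 (Map.mk F G a b c))⟩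
  hom_inv_id := Cell₂.ext' (Category.id_comp _) (HorTrans.id_comp _)
  inv_hom_id := Cell₂.ext' (Category.id_comp _) (HorTrans.id_comp _)

theorem eqToHom_γ {X Y : DblOver.{v, u}} {P Q : Map X Y} (h : P = Q) :
    Cell₂.γ (eqToHom h) = eqToHom (congrArg Map.F h) := by
  subst h
  rfl

theorem eqToHom_bar {X Y : DblOver.{v, u}} {P Q : Map X Y} (h : P = Q) :
    HEq (Cell₂.bar (eqToHom h)) (HorTrans.id P.bar) := by
  subst h
  rfl

theorem idIso_eq {X Y : DblOver.{v, u}} {F : X.C ⥤ Y.C} {G : Y.C ⥤ X.C} {a a' : F ⊣ G}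
    {b : DblFunctor X.J Y.J} {c c' : b.comp Y.U = X.U.comp (sqMap F)}
    (h : (Map.mk F G a b c) = Map.mk F G a' b c') :
    (idIso : Map.mk F G a b c ≅ Map.mk F G a' b c') = eqToIso h := by
  have : a = a' := by cases h; rfl
  subst this
  rfl

instance : Bicategory DblOver.{v, u} where
  Hom X Y := Map X Y
  id X := idMap X
  comp P Q := compMap P Q
  whiskerLeft P _ _ τ := whiskL P τ
  whiskerRight σ R := whiskR σ R
  associator P Q R := idIso
  leftUnitor P := idIso
  rightUnitor P := idIso
  whiskerLeft_id _ _ := Cell₂.ext' rfl rfl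
  whiskerLeft_comp _ _ _ _ _ _ := Cell₂.ext' rfl rfl
  id_whiskerLeft τ := by
    refine Cell₂.ext' ?_ ?_
    · exact ((Category.id_comp _).trans (Category.comp_id _)).symm
    · exact ((HorTrans.id_comp _).trans (HorTrans.comp_id _)).symm
  comp_whiskerLeft P Q _ _ τ := by
    refine Cell₂.ext' ?_ ?_
    · exact ((Category.id_comp _).trans (Category.comp_id _)).symm
    · exact ((HorTrans.id_comp _).trans (HorTrans.comp_id _)).symm
  id_whiskerRight _ Q := by
    refine Cell₂.ext' ?_ ?_
    · exact Functor.whiskerRight_id _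
    · exact HorTrans.id_whiskerRight _ _
  comp_whiskerRight _ _ R := by
    refine Cell₂.ext' ?_ ?_
    · exact Functor.whiskerRight_comp _ _ _
    · exact HorTrans.comp_whiskerRight _ _ _
  whiskerRight_id σ := by
    refine Cell₂.ext' ?_ ?_
    · exact ((Category.id_comp _).trans (Category.comp_id _)).symm
    · exact ((HorTrans.id_comp _).trans (HorTrans.comp_id _)).symm
  whiskerRight_comp σ Q R := by
    refine Cell₂.ext' ?_ ?_
    · exact ((Category.id_comp _).trans (Category.comp_id _)).symm
    · exact ((HorTrans.id_comp _).trans (HorTrans.comp_id _)).symm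
  whisker_assoc P _ _ τ R := by
    refine Cell₂.ext' ?_ ?_
    · exact ((Category.id_comp _).trans (Category.comp_id _)).symm
    · exact ((HorTrans.id_comp _).trans (HorTrans.comp_id _)).symm
  whisker_exchange {_ _ _ P Q R S} σ τ := by
    refine Cell₂.ext' ?_ ?_
    · exact NatTrans.ext (funext fun a => (τ.γ.naturality (σ.γ.app a)).symm)
    · exact HorTrans.exchange σ.bar τ.bar
  pentagon P Q R S := by
    refine Cell₂.ext' ?_ ?_
    · refine NatTrans.ext (funext fun a => ?_)
      exact (congrArg (fun x => x ≫ 𝟙 _ ≫ 𝟙 _) (S.F.map_id _)).trans (Category.id_comp _)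
    · refine (congrArg (fun x => HorTrans.comp x _) (HorTrans.id_whiskerRight _ _)).trans ?_
      exact HorTrans.id_comp _
  triangle P Q := by
    refine Cell₂.ext' ?_ ?_
    · exact NatTrans.ext (funext fun a => (Category.id_comp _).trans (Q.F.map_id _).symm)
    · exact (HorTrans.id_comp _).trans (HorTrans.id_whiskerRight _ _).symm

instance : Bicategory.Strict DblOver.{v, u} where
  id_comp P := by
    refine Map.ext' ?_ ?_ ?_ ?_
    · rfl
    · rfl
    · exact heq_of_eq (adj_id_comp _)
    · rfl
  comp_id P := by
    refine Map.ext' ?_ ?_ ?_ ?_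
    · rfl
    · rfl
    · exact heq_of_eq (adj_comp_id _)
    · rfl
  assoc P Q R := by
    refine Map.ext' ?_ ?_ ?_ ?_
    · rfl
    · rfl
    · exact heq_of_eq (adj_assoc _ _ _)
    · rfl
  leftUnitor_eqToIso P := by exact idIso_eq _
  rightUnitor_eqToIso P := by exact idIso_eq _
  associator_eqToIso P Q R := by exact idIso_eq _

end DblOver

/-! ## The 2-category of algebraic weak factorisation systems and left adjoint morphisms -/

/-- Maps `α f : F (E f) ⟶ E' (F f)`, natural in `f` and compatible with the two parts of the
factorisations. -/
structure OplaxData {C D : Type u} [Category.{v} C] [Category.{v} D] (A : AWFS C) (B : AWFS D)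
    (F : C ⥤ D) where
  α : A.E ⋙ F ⟶ F.mapArrow ⋙ B.E
  lam_α : ∀ f : Arrow C, F.map (A.lam.app f) ≫ α.app f = B.lam.app (F.mapArrow.obj f)
  α_rho : ∀ f : Arrow C, α.app f ≫ B.rho.app (F.mapArrow.obj f) = F.map (A.rho.app f)

namespace OplaxData

variable {C D : Type u} [Category.{v} C] [Category.{v} D] {A : AWFS C} {B : AWFS D} {F : C ⥤ D}
  (σ : OplaxData A B F)

/-- The induced transformation `(1, α) : F L ⇒ L' F`. -/
def toL : A.L ⋙ F.mapArrow ⟶ F.mapArrow ⋙ B.L where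
  app f := Arrow.homMk (f := F.mapArrow.obj (A.L.obj f)) (g := B.L.obj (F.mapArrow.obj f))
    (𝟙 (F.obj f.left)) (σ.α.app f) ((Category.id_comp _).trans (σ.lam_α f).symm)
  naturality f g φ := by
    ext
    · exact (Category.comp_id _).trans (Category.id_comp _).symm
    · exact σ.α.naturality φ

/-- The induced transformation `(α, 1) : F R ⇒ R' F`. -/
def toR : A.R ⋙ F.mapArrow ⟶ F.mapArrow ⋙ B.R where
  app f := Arrow.homMk (f := F.mapArrow.obj (A.R.obj f)) (g := B.R.obj (F.mapArrow.obj f))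
    (σ.α.app f) (𝟙 (F.obj f.right)) ((σ.α_rho f).trans (Category.comp_id _).symm)
  naturality f g φ := by
    ext
    · exact σ.α.naturality φ
    · exact (Category.comp_id _).trans (Category.id_comp _).symm

end OplaxData

/-- An oplax morphism of algebraic weak factorisation systems with underlying functor `F`: the
transformation `(1, α)` is an oplax morphism of comonads and `(α, 1)` is an oplax morphism
of monads. (Compatibility of these with the counits and units is already contained in the
equations of `OplaxData`.) -/
structure OplaxMor {C D : Type u} [Category.{v} C] [Category.{v} D] (A : AWFS C) (B : AWFS D)
    (F : C ⥤ D) extends OplaxData A B F where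
  comul : ∀ f : Arrow C, F.mapArrow.map (A.str.Δ.app f) ≫ toOplaxData.toL.app (A.L.obj f) ≫
      B.L.map (toOplaxData.toL.app f) = toOplaxData.toL.app f ≫ B.str.Δ.app (F.mapArrow.obj f)
  mul : ∀ f : Arrow C, F.mapArrow.map (A.str.μ.app f) ≫ toOplaxData.toR.app f =
      toOplaxData.toR.app (A.R.obj f) ≫ B.R.map (toOplaxData.toR.app f) ≫
        B.str.μ.app (F.mapArrow.obj f)

/-- The morphism of arrows `F f ⟶ G f` induced by a natural transformation. -/
def arrowApp {C D : Type u} [Category.{v} C] [Category.{v} D] {F G : C ⥤ D} (γ : F ⟶ G)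
    (f : Arrow C) : F.mapArrow.obj f ⟶ G.mapArrow.obj f :=
  Arrow.homMk (f := F.mapArrow.obj f) (g := G.mapArrow.obj f) (γ.app f.left) (γ.app f.right)
    (γ.naturality f.hom).symm

namespace OplaxMor

theorem ext' {C D : Type u} [Category.{v} C] [Category.{v} D] {A : AWFS C} {B : AWFS D}
    {F : C ⥤ D} {σ τ : OplaxMor A B F} (h : ∀ f, σ.α.app f = τ.α.app f) : σ = τ := by
  obtain ⟨⟨α, _, _⟩, _, _⟩ := σ
  obtain ⟨⟨β, _, _⟩, _, _⟩ := τ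
  obtain rfl : α = β := NatTrans.ext (funext h)
  rfl

/-- The identity oplax morphism. -/
def id {C : Type u} [Category.{v} C] (A : AWFS C) : OplaxMor A A (𝟭 C) where
  α := { app := fun f => 𝟙 (A.E.obj f)
         naturality := fun _ _ φ => (Category.comp_id _).trans (Category.id_comp _).symm }
  lam_α f := Category.comp_id _
  α_rho f := Category.id_comp _
  comul f := (congrArg (fun x => A.str.Δ.app f ≫ x)
    ((Category.id_comp _).trans (A.L.map_id (A.L.obj f)))).trans
      ((Category.comp_id _).trans (Category.id_comp _).symm)
  mul f := by
    change A.str.μ.app f ≫ 𝟙 (A.R.obj f) =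
      𝟙 (A.R.obj (A.R.obj f)) ≫ A.R.map (𝟙 (A.R.obj f)) ≫ A.str.μ.app f
    rw [A.R.map_id, Category.id_comp, Category.comp_id]
    exact (Category.id_comp _).symm

variable {C D E : Type u} [Category.{v} C] [Category.{v} D] [Category.{v} E] {A : AWFS C}
  {B : AWFS D} {K : AWFS E} {F : C ⥤ D} {G : D ⥤ E}

/-- Composition of the underlying data of oplax morphisms. -/
def compData (σ : OplaxMor A B F) (τ : OplaxMor B K G) : OplaxData A K (F ⋙ G) where
  α := { app := fun f => G.map (σ.α.app f) ≫ τ.α.app (F.mapArrow.obj f)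
         naturality := fun f g φ => by
          have h1 := σ.α.naturality φ
          have h2 := τ.α.naturality (F.mapArrow.map φ)
          change G.map (F.map (A.E.map φ)) ≫ _ ≫ _ = (_ ≫ _) ≫ K.E.map _
          rw [Category.assoc]
          refine Eq.trans ?_ (congrArg (fun x => G.map (σ.α.app f) ≫ x) h2)
          refine (Category.assoc _ _ _).symm.trans (Eq.trans ?_ (Category.assoc _ _ _))
          refine congrArg (fun x => x ≫ τ.α.app (F.mapArrow.obj g)) ?_
          refine (G.map_comp _ _).symm.trans (Eq.trans ?_ (G.map_comp _ _))
          exact congrArg (fun x => G.map x) h1 }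
  lam_α f := by
    change G.map (F.map (A.lam.app f)) ≫ G.map (σ.α.app f) ≫ τ.α.app (F.mapArrow.obj f) = _
    rw [← G.map_comp_assoc, σ.lam_α]
    exact τ.lam_α _
  α_rho f := by
    change (G.map (σ.α.app f) ≫ τ.α.app (F.mapArrow.obj f)) ≫ K.rho.app _ = _
    rw [Category.assoc]
    refine (congrArg (fun x => G.map (σ.α.app f) ≫ x) (τ.α_rho (F.mapArrow.obj f))).trans ?_
    refine (G.map_comp _ _).symm.trans ?_
    exact congrArg (fun x => G.map x) (σ.α_rho f)

theorem compData_toL (σ : OplaxMor A B F) (τ : OplaxMor B K G) (f : Arrow C) :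
    (compData σ τ).toL.app f =
      G.mapArrow.map (σ.toL.app f) ≫ τ.toL.app (F.mapArrow.obj f) := by
  ext
  · change 𝟙 _ = G.map (𝟙 _) ≫ 𝟙 _
    rw [G.map_id]
    exact (Category.comp_id _).symm
  · rfl

theorem compData_toR (σ : OplaxMor A B F) (τ : OplaxMor B K G) (f : Arrow C) :
    (compData σ τ).toR.app f =
      G.mapArrow.map (σ.toR.app f) ≫ τ.toR.app (F.mapArrow.obj f) := by
  ext
  · rfl
  · change 𝟙 _ = G.map (𝟙 _) ≫ 𝟙 _
    rw [G.map_id]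
    exact (Category.comp_id _).symm

theorem abs_comul {X : Type u} [Category.{v} X] {x₀ x₁ x₂ x₃ x₄ x₅ y z : X} {a : x₀ ⟶ x₁}
    {b : x₁ ⟶ x₂} {c : x₂ ⟶ x₃} {d : x₃ ⟶ x₄} {e : x₄ ⟶ x₅} {b' : x₂ ⟶ y} {c' : y ⟶ x₄}
    {w : X} {m : x₀ ⟶ w} {n : w ⟶ y} {t : w ⟶ z} {k : z ⟶ x₅} (h₁ : a ≫ b ≫ b' = m ≫ n)
    (h₂ : n ≫ c' ≫ e = t ≫ k) (h₃ : c ≫ d = b' ≫ c') :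
    a ≫ (b ≫ c) ≫ (d ≫ e) = (m ≫ t) ≫ k := by
  have h₁' := congrArg (fun x => x ≫ c' ≫ e) h₁
  simp only [Category.assoc] at h₁' ⊢
  rw [reassoc_of% h₃, h₁', h₂]

theorem abs_mul {X : Type u} [Category.{v} X] {x₀ x₁ x₂ x₃ x₄ x₅ y z : X} {a : x₀ ⟶ x₁}
    {b : x₀ ⟶ x₂} {c : x₂ ⟶ x₃} {d : x₃ ⟶ x₄} {e : x₄ ⟶ x₅} {b' : x₂ ⟶ y} {c' : y ⟶ x₄}
    {w : X} {m : x₁ ⟶ w} {n : y ⟶ w} {t : w ⟶ z} {k : x₅ ⟶ z} (h₁ : a ≫ m = b ≫ b' ≫ n)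
    (h₂ : n ≫ t = c' ≫ e ≫ k) (h₃ : c ≫ d = b' ≫ c') :
    a ≫ (m ≫ t) = (b ≫ c) ≫ (d ≫ e) ≫ k := by
  simp only [Category.assoc]
  rw [reassoc_of% h₁, h₂, reassoc_of% h₃]

/-- Composition of oplax morphisms. -/
def comp (σ : OplaxMor A B F) (τ : OplaxMor B K G) : OplaxMor A K (F ⋙ G) where
  toOplaxData := compData σ τ
  comul f := by
    have h1 := congrArg (fun x => G.mapArrow.map x) (σ.comul f)
    have h2 := τ.comul (F.mapArrow.obj f)
    have h3 := τ.toL.naturality (σ.toL.app f)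
    simp only [Functor.map_comp] at h1
    rw [compData_toL, compData_toL]
    refine (congrArg (fun x => G.mapArrow.map (F.mapArrow.map (A.str.Δ.app f)) ≫
      (G.mapArrow.map (σ.toL.app (A.L.obj f)) ≫ τ.toL.app (F.mapArrow.obj (A.L.obj f))) ≫ x)
        (K.L.map_comp _ _)).trans ?_
    exact abs_comul h1 h2 h3.symm
  mul f := by
    have h1 := congrArg (fun x => G.mapArrow.map x) (σ.mul f)
    have h2 := τ.mul (F.mapArrow.obj f)
    have h3 := τ.toR.naturality (σ.toR.app f)
    simp only [Functor.map_comp] at h1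
    rw [compData_toR, compData_toR]
    refine Eq.trans ?_ (congrArg (fun x => (G.mapArrow.map (σ.toR.app (A.R.obj f)) ≫
      τ.toR.app (F.mapArrow.obj (A.R.obj f))) ≫ x ≫
        K.str.μ.app (G.mapArrow.obj (F.mapArrow.obj f))) (K.R.map_comp _ _).symm)
    exact abs_mul h1 h2 h3.symm

end OplaxMor

/-- An object of the 2-category `AWFS_ladj`: a category with an algebraic weak factorisation
system. -/
structure AWFSLadj where
  C : Type u
  [cat : Category.{v} C]
  awfs : AWFS C

attribute [instance] AWFSLadj.cat

namespace AWFSLadj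

/-- A 1-cell of `AWFS_ladj`: an oplax morphism whose underlying functor `F` comes with a chosen
right adjoint `G`. -/
structure Map (X Y : AWFSLadj.{v, u}) where
  F : X.C ⥤ Y.C
  G : Y.C ⥤ X.C
  adj : F ⊣ G
  oplax : OplaxMor X.awfs Y.awfs F

theorem Map.ext' {X Y : AWFSLadj.{v, u}} {P Q : Map X Y} (hF : P.F = Q.F) (hG : P.G = Q.G)
    (hadj : HEq P.adj Q.adj) (ho : HEq P.oplax Q.oplax) : P = Q := by
  obtain ⟨F, G, a, b⟩ := P
  obtain ⟨F', G', a', b'⟩ := Q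
  obtain rfl : F = F' := hF
  obtain rfl : G = G' := hG
  obtain rfl : a = a' := eq_of_heq hadj
  obtain rfl : b = b' := eq_of_heq ho
  rfl

/-- A 2-cell of `AWFS_ladj`: a natural transformation `γ : F ⇒ F'` commuting with the structure
maps of the oplax morphisms. -/
structure Cell₂ {X Y : AWFSLadj.{v, u}} (P Q : Map X Y) where
  γ : P.F ⟶ Q.F
  comm : ∀ f : Arrow X.C, P.oplax.α.app f ≫ Y.awfs.E.map (arrowApp γ f) =
    γ.app (X.awfs.E.obj f) ≫ Q.oplax.α.app f

theorem Cell₂.ext' {X Y : AWFSLadj.{v, u}} {P Q : Map X Y} {σ τ : Cell₂ P Q} (h : σ.γ = τ.γ) :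
    σ = τ := by
  obtain ⟨_, _⟩ := σ
  obtain ⟨_, _⟩ := τ
  obtain rfl := h
  rfl

instance {X Y : AWFSLadj.{v, u}} : Category (Map X Y) where
  Hom P Q := Cell₂ P Q
  id P := ⟨𝟙 P.F, fun f => by
    have : arrowApp (𝟙 P.F) f = 𝟙 (P.F.mapArrow.obj f) := rfl
    rw [this]
    refine (congrArg _ (Y.awfs.E.map_id _)).trans ?_
    exact (Category.comp_id _).trans (Category.id_comp _).symm⟩
  comp {P Q R} σ τ := ⟨σ.γ ≫ τ.γ, fun f => by
    have : arrowApp (σ.γ ≫ τ.γ) f = arrowApp σ.γ f ≫ arrowApp τ.γ f := rfl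
    rw [this, Functor.map_comp]
    refine (Category.assoc _ _ _).symm.trans ?_
    refine (congrArg (fun x => x ≫ _) (σ.comm f)).trans ?_
    refine (Category.assoc _ _ _).trans ?_
    refine (congrArg (fun x => σ.γ.app _ ≫ x) (τ.comm f)).trans ?_
    exact (Category.assoc _ _ _).symm⟩
  id_comp σ := Cell₂.ext' (Category.id_comp _)
  comp_id σ := Cell₂.ext' (Category.comp_id _)
  assoc σ τ ρ := Cell₂.ext' (Category.assoc _ _ _)

/-- Identity 1-cell. -/
def idMap (X : AWFSLadj.{v, u}) : Map X X where
  F := 𝟭 X.C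
  G := 𝟭 X.C
  adj := Adjunction.id
  oplax := OplaxMor.id X.awfs

/-- Composite 1-cell. -/
def compMap {X Y Z : AWFSLadj.{v, u}} (P : Map X Y) (Q : Map Y Z) : Map X Z where
  F := P.F ⋙ Q.F
  G := Q.G ⋙ P.G
  adj := P.adj.comp Q.adj
  oplax := P.oplax.comp Q.oplax

/-- Left whiskering. -/
def whiskL {X Y Z : AWFSLadj.{v, u}} (P : Map X Y) {Q R : Map Y Z} (τ : Q ⟶ R) :
    compMap P Q ⟶ compMap P R where
  γ := Functor.whiskerLeft P.F τ.γ
  comm f := by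
    have h := τ.comm (P.F.mapArrow.obj f)
    have n := τ.γ.naturality (P.oplax.α.app f)
    refine (Category.assoc _ _ _).trans ?_
    refine (congrArg (fun x => Q.F.map (P.oplax.α.app f) ≫ x) h).trans ?_
    refine (Category.assoc _ _ _).symm.trans ?_
    refine (congrArg (fun x => x ≫ R.oplax.α.app (P.F.mapArrow.obj f)) n).trans ?_
    exact Category.assoc _ _ _

/-- Right whiskering. -/
def whiskR {X Y Z : AWFSLadj.{v, u}} {P Q : Map X Y} (σ : P ⟶ Q) (R : Map Y Z) :
    compMap P R ⟶ compMap Q R where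
  γ := Functor.whiskerRight σ.γ R.F
  comm f := by
    have h := congrArg (fun x => R.F.map x) (σ.comm f)
    have n := R.oplax.α.naturality (arrowApp σ.γ f)
    refine (Category.assoc _ _ _).trans ?_
    refine (congrArg (fun x => R.F.map (P.oplax.α.app f) ≫ x) n.symm).trans ?_
    refine (Category.assoc _ _ _).symm.trans ?_
    refine Eq.trans ?_ (Category.assoc _ _ _)
    refine congrArg (fun x => x ≫ R.oplax.α.app (Q.F.mapArrow.obj f)) ?_
    exact (R.F.map_comp _ _).symm.trans (h.trans (R.F.map_comp _ _))

/-- The 2-cell with identity components between two 1-cells with the same underlying functor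
and the same structure maps. -/
def idIso {X Y : AWFSLadj.{v, u}} {F : X.C ⥤ Y.C} {G : Y.C ⥤ X.C} {a a' : F ⊣ G}
    {o o' : OplaxMor X.awfs Y.awfs F} (h : o = o') :
    Map.mk F G a o ≅ Map.mk F G a' o' where
  hom := ⟨𝟙 F, by subst h; exact Cell₂.comm (𝟙 (Map.mk F G a o))⟩
  inv := ⟨𝟙 F, by subst h; exact Cell₂.comm (𝟙 (Map.mk F G a o))⟩
  hom_inv_id := Cell₂.ext' (Category.id_comp _)
  inv_hom_id := Cell₂.ext' (Category.id_comp _)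

theorem eqToHom_γ {X Y : AWFSLadj.{v, u}} {P Q : Map X Y} (h : P = Q) :
    Cell₂.γ (eqToHom h) = eqToHom (congrArg Map.F h) := by
  subst h
  rfl

theorem idIso_eq {X Y : AWFSLadj.{v, u}} {F : X.C ⥤ Y.C} {G : Y.C ⥤ X.C} {a a' : F ⊣ G}
    {o o' : OplaxMor X.awfs Y.awfs F} (ho : o = o') (h : Map.mk F G a o = Map.mk F G a' o') :
    (idIso ho : Map.mk F G a o ≅ Map.mk F G a' o') = eqToIso h := by
  have : a = a' := by cases h; rfl
  subst this
  subst ho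
  rfl

theorem oplax_id_comp {X Y : AWFSLadj.{v, u}} (P : Map X Y) :
    (OplaxMor.id X.awfs).comp P.oplax = P.oplax :=
  OplaxMor.ext' fun f => (congrArg (fun x => x ≫ P.oplax.α.app f) (P.F.map_id _)).trans
    (Category.id_comp _)

theorem oplax_comp_id {X Y : AWFSLadj.{v, u}} (P : Map X Y) :
    P.oplax.comp (OplaxMor.id Y.awfs) = P.oplax :=
  OplaxMor.ext' fun f => Category.comp_id _

theorem oplax_assoc {X Y Z W : AWFSLadj.{v, u}} (P : Map X Y) (Q : Map Y Z) (R : Map Z W) :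
    (P.oplax.comp Q.oplax).comp R.oplax = P.oplax.comp (Q.oplax.comp R.oplax) :=
  OplaxMor.ext' fun f => (congrArg (fun x => x ≫ R.oplax.α.app _) (R.F.map_comp _ _)).trans
    (Category.assoc _ _ _)

/-- The associator. -/
def assocIso {X Y Z W : AWFSLadj.{v, u}} (P : Map X Y) (Q : Map Y Z) (R : Map Z W) :
    compMap (compMap P Q) R ≅ compMap P (compMap Q R) :=
  idIso (a := (P.adj.comp Q.adj).comp R.adj) (a' := P.adj.comp (Q.adj.comp R.adj))
    (oplax_assoc P Q R)

/-- The left unitor. -/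
def leftIso {X Y : AWFSLadj.{v, u}} (P : Map X Y) : compMap (idMap X) P ≅ P :=
  idIso (a := Adjunction.id.comp P.adj) (a' := P.adj) (oplax_id_comp P)

/-- The right unitor. -/
def rightIso {X Y : AWFSLadj.{v, u}} (P : Map X Y) : compMap P (idMap Y) ≅ P :=
  idIso (a := P.adj.comp Adjunction.id) (a' := P.adj) (oplax_comp_id P)

instance : Bicategory AWFSLadj.{v, u} where
  Hom X Y := Map X Y
  id X := idMap X
  comp P Q := compMap P Q
  whiskerLeft P _ _ τ := whiskL P τ
  whiskerRight σ R := whiskR σ R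
  associator P Q R := assocIso P Q R
  leftUnitor P := leftIso P
  rightUnitor P := rightIso P
  whiskerLeft_id _ _ := Cell₂.ext' rfl
  whiskerLeft_comp _ _ _ _ _ _ := Cell₂.ext' rfl
  id_whiskerLeft τ := by
    refine Cell₂.ext' ?_
    exact ((Category.id_comp _).trans (Category.comp_id _)).symm
  comp_whiskerLeft P Q _ _ τ := by
    refine Cell₂.ext' ?_
    exact ((Category.id_comp _).trans (Category.comp_id _)).symm
  id_whiskerRight _ Q := by
    refine Cell₂.ext' ?_
    exact Functor.whiskerRight_id _
  comp_whiskerRight _ _ R := by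
    refine Cell₂.ext' ?_
    exact Functor.whiskerRight_comp _ _ _
  whiskerRight_id σ := by
    refine Cell₂.ext' ?_
    exact ((Category.id_comp _).trans (Category.comp_id _)).symm
  whiskerRight_comp σ Q R := by
    refine Cell₂.ext' ?_
    exact ((Category.id_comp _).trans (Category.comp_id _)).symm
  whisker_assoc P _ _ τ R := by
    refine Cell₂.ext' ?_
    exact ((Category.id_comp _).trans (Category.comp_id _)).symm
  whisker_exchange {_ _ _ P Q R S} σ τ := by
    refine Cell₂.ext' ?_
    exact NatTrans.ext (funext fun a => (τ.γ.naturality (σ.γ.app a)).symm)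
  pentagon P Q R S := by
    refine Cell₂.ext' ?_
    refine NatTrans.ext (funext fun a => ?_)
    exact (congrArg (fun x => x ≫ 𝟙 _ ≫ 𝟙 _) (S.F.map_id _)).trans (Category.id_comp _)
  triangle P Q := by
    refine Cell₂.ext' ?_
    exact NatTrans.ext (funext fun a => (Category.id_comp _).trans (Q.F.map_id _).symm)

instance : Bicategory.Strict AWFSLadj.{v, u} where
  id_comp P := by
    refine Map.ext' ?_ ?_ ?_ ?_
    · rfl
    · rfl
    · exact heq_of_eq (DblOver.adj_id_comp _)
    · exact heq_of_eq (oplax_id_comp P)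
  comp_id P := by
    refine Map.ext' ?_ ?_ ?_ ?_
    · rfl
    · rfl
    · exact heq_of_eq (DblOver.adj_comp_id _)
    · exact heq_of_eq (oplax_comp_id P)
  assoc P Q R := by
    refine Map.ext' ?_ ?_ ?_ ?_
    · rfl
    · rfl
    · exact heq_of_eq (DblOver.adj_assoc _ _ _)
    · exact heq_of_eq (oplax_assoc P Q R)
  leftUnitor_eqToIso P := by
    exact idIso_eq (a := Adjunction.id.comp (Map.adj P)) (a' := Map.adj P) (oplax_id_comp P) _
  rightUnitor_eqToIso P := by
    exact idIso_eq (a := (Map.adj P).comp Adjunction.id) (a' := Map.adj P) (oplax_comp_id P) _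
  associator_eqToIso P Q R := by
    exact idIso_eq (a := ((Map.adj P).comp (Map.adj Q)).comp (Map.adj R))
      (a' := (Map.adj P).comp ((Map.adj Q).comp (Map.adj R))) (oplax_assoc P Q R) _

end AWFSLadj

/-! ## The semantics 2-functor `DCoalg` -/

/-- A horizontal transformation into a double category given by `ThinData`. -/
def HorTrans.thin {J : DblCat.{v, u}} {D : Type u} [Category.{v} D] {T : ThinData D}
    {F G : DblFunctor J T.dbl} (γ : F.hor ⟶ G.hor)
    (h : ∀ {a b : J.Ob} (p : J.V a b), T.IsCell (F.vmap p) (G.vmap p) (γ.app a) (γ.app b)) :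
    HorTrans F G where
  hor := γ
  cell p := ⟨h p⟩
  cell_naturality {_ _ _ _ _ _ f g} _ := holds_heq
    (congrArg₂ (fun x y => T.IsCell _ _ x y) (γ.naturality f) (γ.naturality g)) _ _
  cell_vid a := holds_heq
    (congrArg₂ (fun x y => T.IsCell x y _ _) (F.vmap_vid a) (G.vmap_vid a)) _ _
  cell_vcomp p q := holds_heq
    (congrArg₂ (fun x y => T.IsCell x y _ _) (F.vmap_vcomp p q) (G.vmap_vcomp p q)) _ _

namespace OplaxMor

variable {C D : Type u} [Category.{v} C] [Category.{v} D] {A : AWFS C} {B : AWFS D} {F : C ⥤ D}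
  (σ : OplaxMor A B F)

/-- The component of the structure map at `f : a ⟶ b`. -/
def al {a b : C} (f : a ⟶ b) : F.obj (A.ob f) ⟶ B.ob (F.map f) := σ.α.app (Arrow.mk f)

variable {a b c d : C}

theorem l_al (f : a ⟶ b) : F.map (A.l f) ≫ σ.al f = B.l (F.map f) := σ.lam_α (Arrow.mk f)

theorem al_r (f : a ⟶ b) : σ.al f ≫ B.r (F.map f) = F.map (A.r f) := σ.α_rho (Arrow.mk f)

theorem em_al {f : a ⟶ b} {g : c ⟶ d} {h : a ⟶ c} {k : b ⟶ d} (w : h ≫ g = f ≫ k) :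
    F.map (A.em h k w) ≫ σ.al g = σ.al f ≫ B.em (F.map h) (F.map k)
      (by rw [← F.map_comp, w, F.map_comp]) :=
  σ.α.naturality (Arrow.homMk (f := Arrow.mk f) (g := Arrow.mk g) h k w)

theorem sig_al (f : a ⟶ b) : F.map (A.sig f) ≫ σ.al (A.l f) ≫ B.em (𝟙 (F.obj a)) (σ.al f)
    ((Category.id_comp _).trans (σ.l_al f).symm) = σ.al f ≫ B.sig (F.map f) :=
  congrArg CommaMorphism.right (σ.comul (Arrow.mk f))

theorem pi_al (f : a ⟶ b) : F.map (A.pi f) ≫ σ.al f = σ.al (A.r f) ≫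
    B.em (σ.al f) (𝟙 (F.obj b)) ((σ.al_r f).trans (Category.comp_id _).symm) ≫ B.pi (F.map f) :=
  congrArg CommaMorphism.left (σ.mul (Arrow.mk f))

/-- The action of an oplax morphism on coalgebras: `(f, s) ↦ (F f, α f ∘ F s)`. -/
def push (p : A.Coalg a b) : B.Coalg (F.obj a) (F.obj b) where
  arr := F.map p.arr
  s := F.map p.s ≫ σ.al p.arr
  arr_s := by rw [← F.map_comp_assoc, p.arr_s, l_al]
  s_r := by rw [Category.assoc, al_r, ← F.map_comp, p.s_r, F.map_id]
  s_sig := by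
    have h : 𝟙 a ≫ A.l p.arr = p.arr ≫ p.s := by rw [Category.id_comp, p.arr_s]
    rw [Category.assoc, ← sig_al, ← F.map_comp_assoc, p.s_sig, F.map_comp_assoc,
      reassoc_of% (σ.em_al h), B.em_em]
    refine Eq.trans ?_ (Category.assoc _ _ _).symm
    congr 2
    exact B.em_congr (by rw [F.map_id, Category.id_comp]) rfl

theorem push_Φ (p : A.Coalg a b) {z : c ⟶ d} {m : a ⟶ A.ob z} {n : b ⟶ d}
    (w : m ≫ A.r z = p.arr ≫ n) :
    F.map (p.Φ m n w) ≫ σ.al z = (σ.push p).Φ (F.map m ≫ σ.al z) (F.map n)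
      (by rw [Category.assoc, al_r, ← F.map_comp, w, F.map_comp]; rfl) := by
  rw [AWFS.Coalg.Φ, F.map_comp, F.map_comp, Category.assoc, Category.assoc, pi_al,
    reassoc_of% (σ.em_al w), reassoc_of% (B.em_em)]
  refine Eq.trans ?_ (Category.assoc _ _ _).symm
  congr 3
  exact B.em_congr rfl (Category.comp_id _)

theorem push_one (a : C) : σ.push (AWFS.Coalg.one A a) = AWFS.Coalg.one B (F.obj a) := by
  refine AWFS.Coalg.ext_s (F.map_id a) ?_
  refine (heq_of_eq (σ.l_al (𝟙 a))).trans ?_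
  rw [F.map_id]
  rfl

theorem push_comp {a b c : C} (p : A.Coalg a b) (q : A.Coalg b c) :
    σ.push (p.comp q) = (σ.push p).comp (σ.push q) := by
  refine AWFS.Coalg.eq_comp (F.map_comp _ _) ?_
  refine (σ.push_Φ q _).trans (AWFS.Coalg.Φ_congr _ ?_ (F.map_id _))
  refine (σ.push_Φ p _).trans (AWFS.Coalg.Φ_congr _ ?_ rfl)
  exact σ.l_al _

theorem push_map {p : A.Coalg a b} {q : A.Coalg c d} {h : a ⟶ c} {k : b ⟶ d}
    (hk : A.IsCoalgMap p q h k) : B.IsCoalgMap (σ.push p) (σ.push q) (F.map h) (F.map k) := by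
  obtain ⟨w, e⟩ := hk
  refine ⟨by change F.map _ ≫ F.map _ = F.map _ ≫ F.map _; rw [← F.map_comp, w, F.map_comp], ?_⟩
  change (F.map p.s ≫ σ.al p.arr) ≫ _ = F.map k ≫ F.map q.s ≫ σ.al q.arr
  rw [← F.map_comp_assoc, ← e, F.map_comp_assoc, σ.em_al w]
  exact Category.assoc _ _ _

/-- The double functor on coalgebras induced by an oplax morphism. -/
def coalgMap : DblFunctor A.DCoalg B.DCoalg :=
  ThinData.functor (S := A.coalgData) (T := B.coalgData) F (fun p => σ.push p)
    (fun h => σ.push_map h) (fun a => σ.push_one a) (fun p q => σ.push_comp p q)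

theorem coalgMap_forget : σ.coalgMap.comp B.coalgForget = A.coalgForget.comp (sqMap F) := rfl

end OplaxMor

namespace AWFSLadj

/-- The double category of coalgebras over `Sq C`. -/
def coalgObj (X : AWFSLadj.{v, u}) : DblOver.{v, u} where
  C := X.C
  J := X.awfs.DCoalg
  U := X.awfs.coalgForget

/-- The action of `DCoalg` on 1-cells. -/
def coalgMap {X Y : AWFSLadj.{v, u}} (P : Map X Y) : DblOver.Map (coalgObj X) (coalgObj Y) where
  F := P.F
  G := P.G
  adj := P.adj
  bar := P.oplax.coalgMap
  comm := P.oplax.coalgMap_forget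

/-- The action of `DCoalg` on 2-cells. -/
def coalgMap₂ {X Y : AWFSLadj.{v, u}} {P Q : Map X Y} (σ : P ⟶ Q) : coalgMap P ⟶ coalgMap Q where
  γ := σ.γ
  bar := HorTrans.thin (T := Y.awfs.coalgData) (F := P.oplax.coalgMap) (G := Q.oplax.coalgMap) σ.γ
    (fun {a b} p => by
      change Y.awfs.IsCoalgMap (P.oplax.push p) (Q.oplax.push p) (σ.γ.app a) (σ.γ.app b)
      refine ⟨(σ.γ.naturality _).symm, ?_⟩
      have h := σ.comm (Arrow.mk p.arr)
      refine (Category.assoc _ _ _).trans ?_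
      refine (congrArg (fun x => P.F.map p.s ≫ x) h).trans ?_
      refine (Category.assoc _ _ _).symm.trans (Eq.trans ?_ (Category.assoc _ _ _))
      exact congrArg (fun x => x ≫ Q.oplax.al p.arr) (σ.γ.naturality p.s))
  comm := heq_of_eq (HorTrans.ext_thin rfl)

/-- As `DCoalg` is concrete, 2-cells into it are determined by their underlying transformation. -/
theorem cell_ext {X : DblOver.{v, u}} {Y : AWFSLadj.{v, u}} {P Q : DblOver.Map X (coalgObj Y)}
    {σ τ : P ⟶ Q} (h : DblOver.Cell₂.γ σ = DblOver.Cell₂.γ τ) : σ = τ := by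
  refine DblOver.Cell₂.ext' h (HorTrans.ext_thin (T := Y.awfs.coalgData) ?_)
  have h1 := DblOver.Cell₂.comm σ
  rw [h] at h1
  have h2 := eq_of_heq (h1.trans (DblOver.Cell₂.comm τ).symm)
  refine NatTrans.ext (funext fun a => ?_)
  exact congrArg (fun x => NatTrans.app x.hor a) h2

/-- The 2-functor `DCoalg(-) : AWFS_ladj ⟶ DBL / Sq(-)_ladj`. -/
def DCoalg : StrictPseudofunctor AWFSLadj.{v, u} DblOver.{v, u} :=
  StrictPseudofunctor.mk'
    { obj := coalgObj
      map := fun P => coalgMap P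
      map₂ := fun σ => coalgMap₂ σ
      map₂_id := fun _ => cell_ext rfl
      map₂_comp := fun _ _ => cell_ext rfl
      map_id := fun X => by
        refine DblOver.Map.ext' rfl rfl HEq.rfl ?_
        refine ThinData.functor_ext (T := X.awfs.coalgData) rfl fun p => heq_of_eq ?_
        exact AWFS.Coalg.ext_s rfl (heq_of_eq (Category.comp_id _))
      map_comp := fun {X Y Z} P Q => by
        refine DblOver.Map.ext' rfl rfl HEq.rfl ?_
        refine ThinData.functor_ext (T := Z.awfs.coalgData) rfl fun p => heq_of_eq ?_
        refine AWFS.Coalg.ext_s rfl (heq_of_eq ?_)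
        refine (Category.assoc _ _ _).symm.trans ?_
        exact congrArg (fun x => x ≫ Q.oplax.al _) (Q.F.map_comp _ _).symm
      map₂_whisker_left := fun {X Y Z} P Q R η => by
        refine cell_ext ?_
        refine Eq.trans ?_ (congrArg₂ (fun x y => x ≫ _ ≫ y) (DblOver.eqToHom_γ _).symm
          (DblOver.eqToHom_γ _).symm)
        exact ((Category.id_comp _).trans (Category.comp_id _)).symm
      map₂_whisker_right := fun {X Y Z} P Q η R => by
        refine cell_ext ?_
        refine Eq.trans ?_ (congrArg₂ (fun x y => x ≫ _ ≫ y) (DblOver.eqToHom_γ _).symm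
          (DblOver.eqToHom_γ _).symm)
        exact ((Category.id_comp _).trans (Category.comp_id _)).symm
      map₂_left_unitor := fun P => by
        refine cell_ext ?_
        refine Eq.trans ?_ (congrArg (fun x => x ≫ _) (DblOver.eqToHom_γ _).symm)
        exact (Category.id_comp _).symm
      map₂_right_unitor := fun P => by
        refine cell_ext ?_
        refine Eq.trans ?_ (congrArg (fun x => x ≫ _) (DblOver.eqToHom_γ _).symm)
        exact (Category.id_comp _).symm
      map₂_associator := fun P Q R => by
        refine cell_ext ?_
        refine Eq.trans ?_ (congrArg₂ (fun x y => x ≫ _ ≫ y) (DblOver.eqToHom_γ _).symm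
          (DblOver.eqToHom_γ _).symm)
        exact ((Category.id_comp _).trans (Category.comp_id _)).symm }

end AWFSLadj

/-! ## Left 2-adjoints at an object -/

section Universal

universe w₁ v₁ u₁ w₂ v₂ u₂

variable {B : Type u₁} [Bicategory.{w₁, v₁} B] {D : Type u₂} [Bicategory.{w₂, v₂} D]

open Bicategory in
/-- For a 2-functor `T : B ⟶ D` and a 1-cell `η : d ⟶ T b`, the functor
`B(b, b') ⥤ D(d, T b')` given by applying `T` and composing with `η`. -/
def homFunctor (T : StrictPseudofunctor B D) {b : B} {d : D} (η : d ⟶ T.obj b) (b' : B) :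
    (b ⟶ b') ⥤ (d ⟶ T.obj b') where
  obj f := η ≫ T.map f
  map σ := η ◁ T.map₂ σ

/-- A functor is an isomorphism of categories. -/
def IsIsoOfCategories {X : Type u₁} [Category.{v₁} X] {Y : Type u₂} [Category.{v₂} Y]
    (F : X ⥤ Y) : Prop :=
  ∃ G : Y ⥤ X, F ⋙ G = 𝟭 X ∧ G ⋙ F = 𝟭 Y

/-- The object `b` provides a left 2-adjoint at `d` for the 2-functor `T` between (strict)
2-categories: there is a unit `η : d ⟶ T b` which induces isomorphisms of categories
`B(b, b') ≅ D(d, T b')` for all `b'`. (These are automatically 2-natural in `b'`.) -/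
def IsLeftTwoAdjointAt [Bicategory.Strict B] [Bicategory.Strict D] (T : StrictPseudofunctor B D)
    (d : D) (b : B) : Prop :=
  ∃ η : d ⟶ T.obj b, ∀ b' : B, IsIsoOfCategories (homFunctor T η b')

end Universal

end AlgFact

/-! For a left adjoint `F ⊣ G`, an oplax structure on `F` should amount to a way of making `G g` an
`A`-algebra for every `B`-algebra `g`, respecting algebra maps and vertical composition. Cofibrant
generation says that an `A`-algebra is a lifting operation against `J`. Squares from `U p` to `G g`
transpose to squares from `F (U p)` to `g`, so these lifting operations come from `B`-coalgebra
structures on the arrows `F (U p)`, that is, from a double functor over `Sq F`. The proof makes this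
chain explicit.

Unit: a vertical arrow `p` of `J` lifts against the free algebra on `U p`, and the filler of the
square `(A.l, 𝟙)` is a coalgebra structure on `U p`. Coassociativity holds because the
comultiplication is an algebra map from a free algebra to a vertical composite of two free algebras
(`isAlgMap_sig`, which uses the distributive law) and fillers respect such composites. The canonical
liftings of this coalgebra are the given fillers (`coalg_lift`), whence functoriality in `p`.

Surjectivity on 1-cells: given coalgebras on the `F (U p)`, let `hat f` be the unique algebra map
from the free algebra on `f` to the algebra induced on `G (B.r (F f))` that extends the unit square
of `F ⊣ G`. Its transpose is the structure map of an oplax morphism. After transposition, its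
naturality and its compatibility with multiplication and comultiplication are equalities of algebra
maps out of a free algebra, so they can be checked along the unit (`free_hom_ext`). The given
coalgebras are recovered by `push_oplax`.

Injectivity on 1-cells and fullness: an oplax morphism `σ` induces an algebra structure `σ.pull` on
each `G g`, and its fillers against `J` are transposes of the fillers of the pushed forward
coalgebras (`fill_pull`). If `γ : F ⟶ F'` respects these coalgebras, its mate respects lifting
operations and is therefore an algebra map. Comparing two maps out of a free algebra and transposing
shows that `γ` respects the structure maps (`al_em`). General `γ` gives fullness, and the identity
gives injectivity on objects. -/

namespace AlgFact

namespace AWFS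

variable {C : Type u} [Category.{v} C] {A : AWFS C} {a b c d e x x' y y' : C}

/-! ### Free algebras and their universal property -/

namespace Alg

/-- The free algebra on an arrow. -/
abbrev free (A : AWFS C) (z : x ⟶ y) : A.Alg (A.ob z) y where
  arr := A.r z
  p := A.pi z
  l_p := A.l_pi z
  p_arr := A.pi_r z
  pi_p := (A.pi_pi z).symm

/-- The extension of a square `z ⟶ q` to the free algebra on `z`. -/
def extend (q : A.Alg a b) {z : x ⟶ y} (m : x ⟶ a) (n : y ⟶ b) (w : m ≫ q.arr = z ≫ n) :
    A.ob z ⟶ a :=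
  A.em m n w ≫ q.p

theorem l_extend (q : A.Alg a b) {z : x ⟶ y} {m : x ⟶ a} {n : y ⟶ b}
    (w : m ≫ q.arr = z ≫ n) : A.l z ≫ q.extend m n w = m := by
  rw [extend, reassoc_of% (A.l_em w), q.l_p, Category.comp_id]

/-- Naturality moves the multiplication past `A.em m n w`, and associativity of `q` absorbs it. With
`l_extend` this is the existence half of freeness, over an arbitrary map of codomains. -/
theorem isAlgMap_extend (q : A.Alg a b) {z : x ⟶ y} {m : x ⟶ a} {n : y ⟶ b}
    (w : m ≫ q.arr = z ≫ n) : A.IsAlgMap (free A z) q (q.extend m n w) n := by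
  refine ⟨?_, ?_⟩
  · rw [extend, Category.assoc, q.p_arr, A.em_r]
  · change _ = A.pi z ≫ A.em m n w ≫ q.p
    rw [reassoc_of% (A.pi_em w), q.pi_p, reassoc_of% (A.em_em (A.em_r w))]
    congr 1
    exact A.em_congr rfl (Category.comp_id _).symm

theorem extend_congr (q : A.Alg a b) {z : x ⟶ y} {m m' : x ⟶ a} {n n' : y ⟶ b}
    {w : m ≫ q.arr = z ≫ n} (hm : m = m') (hn : n = n') :
    q.extend m n w = q.extend m' n' (by rw [← hm, ← hn, w]) := by
  subst hm hn
  rfl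

theorem l_free_arr (z : x ⟶ y) : A.l z ≫ (free A z).arr = z ≫ 𝟙 y :=
  (A.l_r z).trans (Category.comp_id z).symm

theorem l_comp_arr {q : A.Alg a b} {z : x ⟶ y} {t : A.ob z ⟶ a} {n : y ⟶ b}
    (h : t ≫ q.arr = A.r z ≫ n) : (A.l z ≫ t) ≫ q.arr = z ≫ n := by
  rw [Category.assoc, h, reassoc_of% (A.l_r z)]

/-- Precomposing the algebra-map equation with `A.em (A.l z) (𝟙 y)` cancels the multiplication by
`em_l_pi`. This is the uniqueness half of freeness. -/
theorem eq_extend {q : A.Alg a b} {z : x ⟶ y} {t : A.ob z ⟶ a} {n : y ⟶ b}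
    (h : A.IsAlgMap (free A z) q t n) : t = q.extend (A.l z ≫ t) n (l_comp_arr h.1) := by
  have e0 : A.l z ≫ A.r z = z ≫ 𝟙 y := (A.l_r z).trans (Category.comp_id z).symm
  have w : t ≫ q.arr = A.r z ≫ n := h.1
  have e : A.em t n w ≫ q.p = A.pi z ≫ t := h.2
  have e1 : A.em (A.l z) (𝟙 y) e0 ≫ A.em t n w ≫ q.p = t := by
    rw [e, reassoc_of% (A.em_l_pi z)]
  rw [reassoc_of% (A.em_em e0 w)] at e1
  refine e1.symm.trans ?_
  rw [extend]

/-- Algebra maps out of a free algebra are determined by their restriction along the unit. -/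
theorem free_hom_ext {q : A.Alg a b} {z : x ⟶ y} {t t' : A.ob z ⟶ a} {n : y ⟶ b}
    (h : A.IsAlgMap (free A z) q t n) (h' : A.IsAlgMap (free A z) q t' n)
    (e : A.l z ≫ t = A.l z ≫ t') : t = t' :=
  (eq_extend h).trans ((extend_congr _ e rfl).trans (eq_extend h').symm)

/-- This is the counit of the free-forgetful adjunction. It reduces fillers against `q` to fillers
against a free algebra; for `q` itself free it says that the multiplication is an algebra map. -/
theorem isAlgMap_p (q : A.Alg a b) : A.IsAlgMap (free A q.arr) q q.p (𝟙 b) :=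
  ⟨q.p_arr.trans (Category.comp_id _).symm, q.pi_p.symm⟩

theorem isAlgMap_em {z : a ⟶ b} {z' : c ⟶ d} {h : a ⟶ c} {k : b ⟶ d} (w : h ≫ z' = z ≫ k) :
    A.IsAlgMap (free A z) (free A z') (A.em h k w) k :=
  ⟨A.em_r w, (A.pi_em w).symm⟩

/-- The comultiplication is an algebra map into a composite of free algebras. -/
theorem isAlgMap_sig (z : a ⟶ b) :
    A.IsAlgMap (free A z) ((free A (A.l z)).comp (free A z)) (A.sig z) (𝟙 b) := by
  have w : A.sig z ≫ A.r (A.l z) ≫ A.r z = A.r z ≫ 𝟙 b := by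
    rw [reassoc_of% (A.sig_r z), Category.comp_id]
  refine ⟨w, ?_⟩
  change A.em (A.sig z) (𝟙 b) w ≫ (free A (A.l z)).compP (free A z) rfl = A.pi z ≫ A.sig z
  -- The distributive law enters as `pi_sig`. What remains evaluates the structure map of the
  -- composite algebra, whose inner lifting collapses to `A.pi z` by `Ψ_self`.
  rw [A.pi_sig]
  refine (Ψ_map (free A (A.l z)) _ (A.l_em w).symm (A.em_sig w)).trans ?_
  refine congrArg (fun t => A.sig (A.r z) ≫ t ≫ A.pi (A.l z)) (A.em_congr (Category.comp_id _) ?_)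
  refine (Ψ_map (free A z) _ (A.l_em w).symm (A.em_sig w)).trans ?_
  refine (Ψ_congr _ (A.sig_r z) ?_).trans (Ψ_self (free A z))
  exact (A.em_r w).trans (Category.comp_id _)

end Alg

/-! ### Lifting coalgebras against algebras -/

namespace Coalg

/-- The canonical diagonal filler of a square from a coalgebra to an algebra. -/
def lift (p : A.Coalg a b) (q : A.Alg c d) (m : a ⟶ c) (n : b ⟶ d) (w : m ≫ q.arr = p.arr ≫ n) :
    b ⟶ c :=
  p.s ≫ A.em m n w ≫ q.p

theorem lift_congr (p : A.Coalg a b) (q : A.Alg c d) {m m' : a ⟶ c} {n n' : b ⟶ d}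
    {w : m ≫ q.arr = p.arr ≫ n} (hm : m = m') (hn : n = n') :
    p.lift q m n w = p.lift q m' n' (by rw [← hm, ← hn, w]) := by
  subst hm hn
  rfl

theorem arr_lift (p : A.Coalg a b) (q : A.Alg c d) {m : a ⟶ c} {n : b ⟶ d}
    (w : m ≫ q.arr = p.arr ≫ n) : p.arr ≫ p.lift q m n w = m := by
  rw [lift, reassoc_of% p.arr_s, reassoc_of% (A.l_em w), q.l_p, Category.comp_id]

theorem lift_arr (p : A.Coalg a b) (q : A.Alg c d) {m : a ⟶ c} {n : b ⟶ d}
    (w : m ≫ q.arr = p.arr ≫ n) : p.lift q m n w ≫ q.arr = n := by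
  rw [lift, Category.assoc, Category.assoc, q.p_arr, A.em_r, reassoc_of% p.s_r]

theorem lift_map (p : A.Coalg a b) {q : A.Alg c d} {q' : A.Alg x y} {h : c ⟶ x} {k : d ⟶ y}
    (hk : A.IsAlgMap q q' h k) {m : a ⟶ c} {n : b ⟶ d} (w : m ≫ q.arr = p.arr ≫ n) :
    p.lift q m n w ≫ h =
      p.lift q' (m ≫ h) (n ≫ k) (by rw [Category.assoc, hk.1, reassoc_of% w]) := by
  have he := hk.2
  rw [lift, lift, Category.assoc, Category.assoc, ← he, reassoc_of% (A.em_em w hk.1)]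

theorem map_lift {p : A.Coalg a b} {p' : A.Coalg x y} {h : a ⟶ x} {k : b ⟶ y}
    (hk : A.IsCoalgMap p p' h k) (q : A.Alg c d) {m : x ⟶ c} {n : y ⟶ d}
    (w : m ≫ q.arr = p'.arr ≫ n) :
    p.lift q (h ≫ m) (k ≫ n) (by rw [Category.assoc, w, reassoc_of% hk.1]) =
      k ≫ p'.lift q m n w := by
  obtain ⟨e, he⟩ := hk
  rw [lift, lift, ← reassoc_of% he, reassoc_of% (A.em_em e w)]

/-- Fillers are natural in algebra maps, and `q.p` is an algebra map to `q` from a free algebra.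
This carries `Φ_comp` over from free algebras to all algebras. -/
theorem lift_eq_Φ (p : A.Coalg a b) (q : A.Alg c d) {m : a ⟶ c} {n : b ⟶ d}
    (w : m ≫ q.arr = p.arr ≫ n) : p.lift q m n w = p.Φ (m ≫ A.l q.arr) n
      (by rw [Category.assoc, A.l_r, w]) ≫ q.p := by
  refine Eq.trans ?_ (p.lift_map (q := Alg.free A q.arr) q.isAlgMap_p _).symm
  refine p.lift_congr _ ?_ (Category.comp_id _).symm
  rw [Category.assoc, q.l_p, Category.comp_id]

/-- Lifting a composite coalgebra is successive lifting. -/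
theorem comp_lift (p : A.Coalg a b) (p' : A.Coalg b e) (q : A.Alg c d) {m : a ⟶ c} {n : e ⟶ d}
    (w : m ≫ q.arr = (p.comp p').arr ≫ n) :
    (p.comp p').lift q m n w = p'.lift q
      (p.lift q m (p'.arr ≫ n) (by rw [w]; exact Category.assoc _ _ _)) n (by rw [lift_arr]) := by
  rw [lift_eq_Φ, Φ_comp]
  refine (p'.lift_map (q := Alg.free A q.arr) q.isAlgMap_p _).trans ?_
  refine p'.lift_congr _ ?_ (Category.comp_id _)
  exact (p.lift_eq_Φ q _).symm

/-- Coassociativity of `p` replaces the comultiplication inside `Ψ` by `p.s`. Dually to `lift_eq_Φ`,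
it carries `Ψ_comp` over from cofree coalgebras to all coalgebras. -/
theorem s_Ψ (p : A.Coalg a b) (q : A.Alg c d) {m : a ⟶ c} {n : A.ob p.arr ⟶ d}
    (w : m ≫ q.arr = A.l p.arr ≫ n) :
    p.s ≫ q.Ψ m n w = p.lift q m (p.s ≫ n) (by rw [w, reassoc_of% p.arr_s]) := by
  rw [Alg.Ψ, reassoc_of% p.s_sig, lift, reassoc_of% (A.em_em (f := p.arr) (g := A.l p.arr))]
  congr 2
  exact A.em_congr (Category.id_comp _) rfl

/-- Lifting against a composite algebra is successive lifting. -/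
theorem lift_comp (p : A.Coalg a b) (q : A.Alg c d) (q' : A.Alg d e) {m : a ⟶ c} {n : b ⟶ e}
    (w : m ≫ (q.comp q').arr = p.arr ≫ n) :
    p.lift (q.comp q') m n w = p.lift q m (p.lift q' (m ≫ q.arr) n
      (by rw [← w]; exact Category.assoc _ _ _)) (by rw [arr_lift]) := by
  -- The lower edge is replaced by `A.r p.arr ≫ n`, so that the square starts at the cofree
  -- coalgebra; precomposing with `p.s` restores `n` by `s_r`.
  have e0 : m ≫ (q.comp q').arr = A.l p.arr ≫ A.r p.arr ≫ n := by
    rw [reassoc_of% (A.l_r p.arr), w]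
  have e1 := p.s_Ψ (q.comp q') e0
  rw [Alg.Ψ_comp, s_Ψ] at e1
  refine Eq.trans ?_ (e1.symm.trans ?_)
  · exact p.lift_congr _ rfl (by rw [reassoc_of% p.s_r])
  · refine p.lift_congr _ rfl ?_
    rw [s_Ψ]
    exact p.lift_congr _ rfl (by rw [reassoc_of% p.s_r])

end Coalg

end AWFS

/-! ### Cofibrant generation in terms of vertical arrows -/

theorem DblFunctor.vmap_heq {J K : DblCat.{v, u}} {F G : DblFunctor J K} (h : F = G) {a b : J.Ob}
    (p : J.V a b) : HEq (F.vmap p) (G.vmap p) := by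
  subst h
  rfl

/-- A double functor from an arbitrary double category to one given by `ThinData`. -/
def ThinData.functorTo {J : DblCat.{v, u}} {D : Type u} [Category.{v} D] (T : ThinData D)
    (F : J.Ob ⥤ D) (vmap : ∀ {a b : J.Ob}, J.V a b → T.V (F.obj a) (F.obj b))
    (h : ∀ {a b c d : J.Ob} {p : J.V a b} {q : J.V c d} {f : a ⟶ c} {g : b ⟶ d},
      J.Cell p q f g → T.IsCell (vmap p) (vmap q) (F.map f) (F.map g))
    (hid : ∀ a : J.Ob, vmap (J.vid a) = T.vid (F.obj a))
    (hcomp : ∀ {a b c : J.Ob} (p : J.V a b) (q : J.V b c),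
      vmap (J.vcomp p q) = T.vcomp (vmap p) (vmap q)) : DblFunctor J T.dbl where
  hor := F
  vmap := vmap
  cmap α := ⟨h α⟩
  vmap_vid := hid
  vmap_vcomp := hcomp
  cmap_hidCell _ := holds_heq (congrArg₂ (fun x y => T.IsCell _ _ x y) (F.map_id _) (F.map_id _))
    _ _
  cmap_hcomp _ _ := holds_heq
    (congrArg₂ (fun x y => T.IsCell _ _ x y) (F.map_comp _ _) (F.map_comp _ _)) _ _
  cmap_vidCell _ := holds_heq
    (congrArg₂ (fun x y => T.IsCell x y _ _) (hid _) (hid _)) _ _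
  cmap_vcompCell _ _ := holds_heq
    (congrArg₂ (fun x y => T.IsCell x y _ _) (hcomp _ _) (hcomp _ _)) _ _

section

variable {C : Type u} [Category.{v} C] {A : AWFS C} {J : DblCat.{v, u}}
  {U : DblFunctor J (Sq C)}

theorem LiftArr.lift_eq_of_eq {a b : C} {s t : LiftArr U a b} (h : s = t) {i j : J.Ob}
    (p : J.V i j) (x : uobj U i ⟶ a) (y : uobj U j ⟶ b) (w : uarr U p ≫ y = x ≫ s.arr)
    (w' : uarr U p ≫ y = x ≫ t.arr) : s.lift p x y w = t.lift p x y w' := by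
  subst h
  rfl

/-- The isomorphism over `Sq C` of the double categories of algebras and of arrows with a lifting
operation, expressed through its action on vertical arrows. -/
structure LiftIso (A : AWFS C) (U : DblFunctor J (Sq C)) where
  toLift : ∀ {a b : C}, A.Alg a b → LiftArr U a b
  toLift_arr : ∀ {a b : C} (q : A.Alg a b), (toLift q).arr = q.arr
  toLift_comp : ∀ {a b c : C} (q : A.Alg a b) (q' : A.Alg b c),
    toLift (q.comp q') = (toLift q).comp (toLift q')
  toLift_map_iff : ∀ {a b c d : C} {q : A.Alg a b} {q' : A.Alg c d} {h : a ⟶ c} {k : b ⟶ d},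
    (toLift q).IsMap (toLift q') h k ↔ A.IsAlgMap q q' h k
  toLift_surjective : ∀ {a b : C} (s : LiftArr U a b), ∃ q : A.Alg a b, toLift q = s

/-- Lying over `Sq C` forces the comparison, and hence its inverse, to be the identity on horizontal
arrows. Once this is substituted, the two actions on vertical arrows are inverse without transport.
-/
theorem IsCofibrantlyGenerated.exists_liftIso (hA : IsCofibrantlyGenerated A U) :
    Nonempty (LiftIso A U) := by
  obtain ⟨P, Q, h₁, h₂, h₃⟩ := hA
  obtain ⟨Ph, Pv, Pc, Pvid, Pvc, Pch, Pchc, Pcv, Pcvc⟩ := P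
  obtain rfl : Ph = 𝟭 C := congrArg DblFunctor.hor h₃
  obtain ⟨Qh, Qv, Qc, Qvid, Qvc, Qch, Qchc, Qcv, Qcvc⟩ := Q
  obtain rfl : Qh = 𝟭 C := congrArg DblFunctor.hor h₁
  have e₁ : ∀ {a b : C} (q : A.Alg a b), Qv (a := a) (b := b) (Pv (a := a) (b := b) q) = q :=
    fun {a b} q => eq_of_heq (DblFunctor.vmap_heq h₁ (a := a) (b := b) q)
  have e₂ : ∀ {a b : C} (q : LiftArr U a b),
      Pv (a := a) (b := b) (Qv (a := a) (b := b) q) = q :=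
    fun {a b} q => eq_of_heq (DblFunctor.vmap_heq h₂ (a := a) (b := b) q)
  have e₃ : ∀ {a b : C} (q : A.Alg a b),
      LiftArr.toVArr (U := U) (Pv (a := a) (b := b) q) = q.toVArr :=
    fun {a b} q => eq_of_heq (DblFunctor.vmap_heq h₃ (a := a) (b := b) q)
  refine ⟨{
    toLift := fun {a b} q => Pv (a := a) (b := b) q
    toLift_arr := fun q => congrArg VArr.arr (e₃ q)
    toLift_comp := fun {a b c} q q' => Pvc (a := a) (b := b) (c := c) q q'
    toLift_map_iff := fun {a b c d q q' h k} => ⟨fun hm => ?_, fun hm => ?_⟩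
    toLift_surjective := fun {a b} s => ⟨Qv (a := a) (b := b) s, e₂ s⟩ }⟩
  -- A map of lifting operations is a cell, so the inverse double functor sends it back to a map of
  -- algebras.
  · have := (Qc (a := a) (b := b) (c := c) (d := d) (f := h) (g := k) ⟨hm⟩).prf
    change A.IsAlgMap (Qv _) (Qv _) h k at this
    rw [e₁, e₁] at this
    exact this
  · exact (Pc (a := a) (b := b) (c := c) (d := d) (p := q) (q := q') (f := h) (g := k) ⟨hm⟩).prf

/-! ### The unit: coalgebras from vertical arrows of `J` -/

namespace LiftIso

variable (I : LiftIso A U) {a b c d : C} {i j k : J.Ob}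

/-- The filler of a square from a vertical arrow of `J` to an algebra. -/
def fill (q : A.Alg a b) (p : J.V i j) (x : uobj U i ⟶ a) (y : uobj U j ⟶ b)
    (w : x ≫ q.arr = uarr U p ≫ y) : uobj U j ⟶ a :=
  (I.toLift q).lift p x y (by rw [I.toLift_arr, w])

theorem fill_congr (q : A.Alg a b) (p : J.V i j) {x x' : uobj U i ⟶ a} {y y' : uobj U j ⟶ b}
    {w : x ≫ q.arr = uarr U p ≫ y} (hx : x = x') (hy : y = y') :
    I.fill q p x y w = I.fill q p x' y' (by rw [← hx, ← hy, w]) := by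
  subst hx hy
  rfl

theorem uarr_fill (q : A.Alg a b) (p : J.V i j) {x : uobj U i ⟶ a} {y : uobj U j ⟶ b}
    (w : x ≫ q.arr = uarr U p ≫ y) : uarr U p ≫ I.fill q p x y w = x :=
  (I.toLift q).uarr_lift _ _ _ _

theorem fill_arr (q : A.Alg a b) (p : J.V i j) {x : uobj U i ⟶ a} {y : uobj U j ⟶ b}
    (w : x ≫ q.arr = uarr U p ≫ y) : I.fill q p x y w ≫ q.arr = y := by
  rw [← I.toLift_arr]
  exact (I.toLift q).lift_arr _ _ _ _

theorem fill_map {q : A.Alg a b} {q' : A.Alg c d} {m : a ⟶ c} {n : b ⟶ d}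
    (h : A.IsAlgMap q q' m n) (p : J.V i j) {x : uobj U i ⟶ a} {y : uobj U j ⟶ b}
    (w : x ≫ q.arr = uarr U p ≫ y) : I.fill q p x y w ≫ m =
      I.fill q' p (x ≫ m) (y ≫ n) (by rw [Category.assoc, h.1, reassoc_of% w]) :=
  (I.toLift_map_iff.2 h).2 _ _ _ _

theorem fill_comp (q : A.Alg a b) (q' : A.Alg b c) (p : J.V i j) {x : uobj U i ⟶ a}
    {y : uobj U j ⟶ c} (w : x ≫ (q.comp q').arr = uarr U p ≫ y) :
    I.fill (q.comp q') p x y w = I.fill q p x (I.fill q' p (x ≫ q.arr) y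
      (by rw [← w]; exact Category.assoc _ _ _)) (by rw [uarr_fill]) := by
  refine (LiftArr.lift_eq_of_eq (I.toLift_comp q q') _ _ _ _ ?_).trans ?_
  · change _ = _ ≫ (I.toLift q).arr ≫ (I.toLift q').arr
    rw [I.toLift_arr, I.toLift_arr, ← w]
    rfl
  · refine (I.toLift q).lift_congr _ rfl ((I.toLift q').lift_congr _ ?_ rfl)
    rw [I.toLift_arr]

theorem fill_naturality (q : A.Alg a b) {i' j' : J.Ob} {p : J.V i j} {p' : J.V i' j'} {f : i ⟶ i'}
    {g : j ⟶ j'} (α : J.Cell p p' f g) {x : uobj U i' ⟶ a} {y : uobj U j' ⟶ b}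
    (w : x ≫ q.arr = uarr U p' ≫ y) : I.fill q p (umap U f ≫ x) (umap U g ≫ y)
      (by rw [Category.assoc, w, reassoc_of% (uarr_umap U α)]) = umap U g ≫ I.fill q p' x y w :=
  (I.toLift q).natural α _ _ _

theorem fill_vcomp (q : A.Alg a b) (p : J.V i j) (p' : J.V j k) {x : uobj U i ⟶ a}
    {y : uobj U k ⟶ b} (w : x ≫ q.arr = uarr U (J.vcomp p p') ≫ y) :
    I.fill q (J.vcomp p p') x y w = I.fill q p' (I.fill q p x (uarr U p' ≫ y)
      (by rw [w, uarr_vcomp, Category.assoc])) y (by rw [fill_arr]) :=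
  (I.toLift q).vertical p p' _ _ _

/-- The coalgebra structure on the arrow underlying a vertical arrow of `J`. -/
def coalg (p : J.V i j) : A.Coalg (uobj U i) (uobj U j) where
  arr := uarr U p
  s := I.fill (AWFS.Alg.free A (uarr U p)) p (A.l _) (𝟙 _)
    (AWFS.Alg.l_free_arr _)
  arr_s := I.uarr_fill _ _ _
  s_r := I.fill_arr (AWFS.Alg.free A (uarr U p)) _ _
  s_sig := by
    have e : 𝟙 _ ≫ A.l (uarr U p) = uarr U p ≫ I.fill (AWFS.Alg.free A (uarr U p)) p (A.l _) (𝟙 _)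
        (AWFS.Alg.l_free_arr _) := (Category.id_comp _).trans (I.uarr_fill _ _ _).symm
    -- Pushed along the comultiplication into a composite algebra, the filler becomes a successive
    -- lifting: first against the free algebra on `uarr U p`, giving the structure map again, and
    -- then against the free algebra on `A.l (uarr U p)`.
    refine (I.fill_map (AWFS.Alg.isAlgMap_sig _) p (AWFS.Alg.l_free_arr _)).trans ?_
    refine (I.fill_comp _ _ _ _).trans ?_
    -- On the other side `A.em (𝟙 _) s` is a map of free algebras over the structure map `s`, so it
    -- yields the same filler with `s` as lower edge.
    refine Eq.trans ?_ (I.fill_map (AWFS.Alg.isAlgMap_em e) p (AWFS.Alg.l_free_arr _)).symm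
    refine I.fill_congr _ _ ?_ ?_
    · rw [A.l_sig, A.l_em, Category.id_comp]
    · refine Eq.trans ?_ (Category.id_comp _).symm
      refine I.fill_congr _ _ ?_ (Category.comp_id _)
      rw [A.l_sig]
      exact A.l_r _

/-- The square `(x, y)` factors as `(A.l, 𝟙)` followed by the algebra map `q.extend x y w`, and
fillers are natural in algebra maps. Thus the coalgebra remembers all fillers of `p`. -/
theorem coalg_lift (p : J.V i j) (q : A.Alg a b) {x : uobj U i ⟶ a} {y : uobj U j ⟶ b}
    (w : x ≫ q.arr = uarr U p ≫ y) : (I.coalg p).lift q x y w = I.fill q p x y w := by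
  refine (I.fill_map (q.isAlgMap_extend w) p (AWFS.Alg.l_free_arr _)).trans
    (I.fill_congr _ _ ?_ (Category.id_comp _))
  exact q.l_extend w

/-- A filler along an identity is determined by its upper edge, so an identity carries only one
coalgebra structure. -/
theorem coalg_vid (i : J.Ob) : I.coalg (J.vid i) = AWFS.Coalg.one A (uobj U i) := by
  refine AWFS.Coalg.ext_Φ (uarr_vid U i) fun z m n w w' => ?_
  rw [AWFS.Coalg.one_Φ]
  refine (Category.id_comp _).symm.trans (Eq.trans ?_ (AWFS.Coalg.arr_Φ (I.coalg (J.vid i)) w))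
  exact congrArg (· ≫ _) (uarr_vid U i).symm

/-- A coalgebra is determined by its liftings against free algebras. By `coalg_lift` these are the
given fillers, and the vertical axiom for lifting operations matches `Φ_comp`. -/
theorem coalg_vcomp (p : J.V i j) (p' : J.V j k) :
    I.coalg (J.vcomp p p') = (I.coalg p).comp (I.coalg p') := by
  refine AWFS.Coalg.ext_Φ (uarr_vcomp U p p') fun z m n w w' => ?_
  rw [AWFS.Coalg.Φ_comp]
  refine (I.coalg_lift _ (AWFS.Alg.free A z) w).trans ?_
  refine (I.fill_vcomp _ _ _ _).trans ?_
  refine Eq.trans ?_ (I.coalg_lift _ (AWFS.Alg.free A z) _).symm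
  refine I.fill_congr _ _ ?_ rfl
  exact (I.coalg_lift _ (AWFS.Alg.free A z) _).symm

/-- Both composites are the same filler for `p` against the free algebra on `U p'`: one because
`A.em` of the square is an algebra map, the other by naturality in cells of `J`. -/
theorem isCoalgMap {i' j' : J.Ob} {p : J.V i j} {p' : J.V i' j'} {f : i ⟶ i'}
    {g : j ⟶ j'} (α : J.Cell p p' f g) :
    A.IsCoalgMap (I.coalg p) (I.coalg p') (umap U f) (umap U g) := by
  refine ⟨(uarr_umap U α).symm, ?_⟩
  refine (I.fill_map (AWFS.Alg.isAlgMap_em (uarr_umap U α).symm) p (AWFS.Alg.l_free_arr _)).trans ?_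
  refine Eq.trans ?_ (I.fill_naturality _ α (AWFS.Alg.l_free_arr _))
  refine I.fill_congr _ _ (A.l_em _) ?_
  rw [Category.id_comp, Category.comp_id]

end LiftIso

end

/-! ### Double functors into coalgebras, as families of coalgebras -/

/-- A double functor from `J` to the coalgebras of `B` lying over `Sq F`, expressed through its
action on vertical arrows. -/
structure CoalgFamily {C D : Type u} [Category.{v} C] [Category.{v} D] {J : DblCat.{v, u}}
    (B : AWFS D) (U : DblFunctor J (Sq C)) (F : C ⥤ D) where
  coalg : ∀ {i j : J.Ob}, J.V i j → B.Coalg (F.obj (uobj U i)) (F.obj (uobj U j))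
  coalg_arr : ∀ {i j : J.Ob} (p : J.V i j), (coalg p).arr = F.map (uarr U p)
  coalg_vid : ∀ i : J.Ob, coalg (J.vid i) = AWFS.Coalg.one B (F.obj (uobj U i))
  coalg_vcomp : ∀ {i j k : J.Ob} (p : J.V i j) (p' : J.V j k),
    coalg (J.vcomp p p') = (coalg p).comp (coalg p')
  isCoalgMap : ∀ {i j i' j' : J.Ob} {p : J.V i j} {p' : J.V i' j'} {f : i ⟶ i'} {g : j ⟶ j'},
    J.Cell p p' f g →
      B.IsCoalgMap (coalg p) (coalg p') (F.map (umap U f)) (F.map (umap U g))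

namespace CoalgFamily

variable {C D : Type u} [Category.{v} C] [Category.{v} D] {J : DblCat.{v, u}}
    {B : AWFS D} {U : DblFunctor J (Sq C)} {F : C ⥤ D}

theorem ext' {s t : CoalgFamily B U F}
    (h : ∀ {i j : J.Ob} (p : J.V i j), s.coalg p = t.coalg p) : s = t := by
  obtain ⟨c, _, _, _, _⟩ := s
  obtain ⟨c', _, _, _, _⟩ := t
  have : @c = @c' := by
    funext i j p
    exact h p
  subst this
  rfl

/-- The double functor given by a family of coalgebras. -/
def bar (s : CoalgFamily B U F) : DblFunctor J B.DCoalg :=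
  ThinData.functorTo B.coalgData (U.hor ⋙ F) (fun p => s.coalg p) (fun α => s.isCoalgMap α)
    s.coalg_vid s.coalg_vcomp

theorem bar_comm (s : CoalgFamily B U F) : s.bar.comp B.coalgForget = U.comp (sqMap F) :=
  ThinData.functor_ext (T := sqData D) rfl fun p =>
    heq_of_eq (congrArg VArr.mk (s.coalg_arr p))

theorem bar_injective {s t : CoalgFamily B U F} (h : s.bar = t.bar) : s = t :=
  ext' fun p => eq_of_heq (DblFunctor.vmap_heq h p)

/-- Commuting with the forgetful functors forces the horizontal part, and cells of coalgebras are
mere properties, so the action on vertical arrows is the only datum left. -/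
theorem exists_eq_bar (K : DblFunctor J B.DCoalg)
    (h : K.comp B.coalgForget = U.comp (sqMap F)) : ∃ s : CoalgFamily B U F, K = s.bar := by
  obtain ⟨Kh, Kv, Kc, Kvid, Kvc, Kch, Kchc, Kcv, Kcvc⟩ := K
  obtain rfl : Kh = U.hor ⋙ F := congrArg DblFunctor.hor h
  refine ⟨{
    coalg := fun p => Kv p
    coalg_arr := fun p => congrArg VArr.arr (eq_of_heq (DblFunctor.vmap_heq h p))
    coalg_vid := Kvid
    coalg_vcomp := fun p p' => Kvc p p'
    isCoalgMap := fun α => (Kc α).prf }, rfl⟩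

/-- The image of a family of coalgebras under an oplax morphism. -/
def push {A : AWFS C} (s : CoalgFamily A U (𝟭 C)) (σ : OplaxMor A B F) : CoalgFamily B U F where
  coalg p := σ.push (s.coalg p)
  coalg_arr p := congrArg (fun f => F.map f) (s.coalg_arr p)
  coalg_vid i := (congrArg _ (s.coalg_vid i)).trans (σ.push_one _)
  coalg_vcomp p p' := (congrArg _ (s.coalg_vcomp p p')).trans (σ.push_comp _ _)
  isCoalgMap α := σ.push_map (s.isCoalgMap α)

end CoalgFamily

/-- The family of coalgebras underlying the unit. -/
def LiftIso.family {C : Type u} [Category.{v} C] {A : AWFS C} {J : DblCat.{v, u}}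
    {U : DblFunctor J (Sq C)} (I : LiftIso A U) : CoalgFamily A U (𝟭 C) where
  coalg p := I.coalg p
  coalg_arr _ := rfl
  coalg_vid := I.coalg_vid
  coalg_vcomp := I.coalg_vcomp
  isCoalgMap := I.isCoalgMap

/-! ### Lifting operations on `G g` by transposition -/

section

variable {C D : Type u} [Category.{v} C] [Category.{v} D] {J : DblCat.{v, u}}
  {U : DblFunctor J (Sq C)} {A : AWFS C} {B : AWFS D} {F F' : C ⥤ D} {G G' : D ⥤ C}

theorem transpose_square (adj : F ⊣ G) {a b : C} {x y : D} {z : a ⟶ b} {g : x ⟶ y}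
    {m : a ⟶ G.obj x} {n : b ⟶ G.obj y} (w : m ≫ G.map g = z ≫ n) :
    (adj.homEquiv _ _).symm m ≫ g = F.map z ≫ (adj.homEquiv _ _).symm n := by
  rw [← adj.homEquiv_naturality_right_symm, w, adj.homEquiv_naturality_left_symm]

namespace CoalgFamily

variable (s : CoalgFamily B U F) (adj : F ⊣ G) {x y z x' y' : D}

/-- The lifting operation on `G g`, for `g` an algebra, obtained by transposing the liftings of a
family of coalgebras over `F` against `g`. -/
def liftArr (q : B.Alg x y) : LiftArr U (G.obj x) (G.obj y) where
  arr := G.map q.arr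
  lift p m n w := adj.homEquiv _ _ ((s.coalg p).lift q ((adj.homEquiv _ _).symm m)
    ((adj.homEquiv _ _).symm n) (by rw [s.coalg_arr]; exact transpose_square adj w.symm))
  uarr_lift p m n w := by
    rw [← adj.homEquiv_naturality_left, ← Equiv.eq_symm_apply]
    exact (congrArg (· ≫ _) (s.coalg_arr p).symm).trans (AWFS.Coalg.arr_lift _ _ _)
  lift_arr p m n w := by
    rw [← adj.homEquiv_naturality_right, ← Equiv.eq_symm_apply, AWFS.Coalg.lift_arr]
  natural α m n w := by
    rw [← adj.homEquiv_naturality_left, ← AWFS.Coalg.map_lift (s.isCoalgMap α)]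
    exact congrArg _ (AWFS.Coalg.lift_congr _ _ (adj.homEquiv_naturality_left_symm _ _)
      (adj.homEquiv_naturality_left_symm _ _))
  vertical p p' m n w := by
    -- Equal coalgebras have equal fillers; this is isolated because the commutativity proof depends
    -- on the coalgebra.
    have e : ∀ {i j : J.Ob} {t t' : B.Coalg (F.obj (uobj U i)) (F.obj (uobj U j))} (_ : t = t')
        {m n} (w : m ≫ q.arr = t.arr ≫ n) (w' : m ≫ q.arr = t'.arr ≫ n),
        t.lift q m n w = t'.lift q m n w' := by
      rintro i j t _ rfl m n w w'
      rfl
    have w₁ : (adj.homEquiv _ _).symm m ≫ q.arr =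
        ((s.coalg p).comp (s.coalg p')).arr ≫ (adj.homEquiv _ _).symm n := by
      rw [← s.coalg_vcomp, s.coalg_arr]
      exact transpose_square adj w.symm
    refine congrArg _ ((e (s.coalg_vcomp p p') _ w₁).trans ?_)
    rw [AWFS.Coalg.comp_lift]
    refine AWFS.Coalg.lift_congr _ _ ?_ rfl
    rw [Equiv.symm_apply_apply]
    refine AWFS.Coalg.lift_congr _ _ rfl ?_
    rw [s.coalg_arr, adj.homEquiv_naturality_left_symm]

/-- Lifting a coalgebra against a composite algebra is successive by `lift_comp`, and transposition
commutes with postcomposition by `G.map q.arr`. -/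
theorem liftArr_comp (q : B.Alg x y) (q' : B.Alg y z) :
    s.liftArr adj (q.comp q') = (s.liftArr adj q).comp (s.liftArr adj q') := by
  refine LiftArr.ext' (G.map_comp _ _) fun p m n w w' => ?_
  refine congrArg (adj.homEquiv _ _) (((s.coalg p).lift_comp q q' _).trans ?_)
  refine AWFS.Coalg.lift_congr _ _ rfl ?_
  refine Eq.trans ?_ (Equiv.symm_apply_apply _ _).symm
  refine AWFS.Coalg.lift_congr _ _ ?_ rfl
  exact (adj.homEquiv_naturality_right_symm _ _).symm

theorem liftArr_map {q : B.Alg x y} {q' : B.Alg x' y'} {h : x ⟶ x'} {k : y ⟶ y'}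
    (e : B.IsAlgMap q q' h k) :
    (s.liftArr adj q).IsMap (s.liftArr adj q') (G.map h) (G.map k) := by
  refine ⟨?_, fun p m n w => ?_⟩
  · change G.map h ≫ G.map q'.arr = G.map q.arr ≫ G.map k
    rw [← G.map_comp, e.1, G.map_comp]
  · refine (adj.homEquiv_naturality_right _ _).symm.trans (congrArg _ ?_)
    refine (AWFS.Coalg.lift_map _ e _).trans ?_
    exact AWFS.Coalg.lift_congr _ _ (adj.homEquiv_naturality_right_symm _ _).symm
      (adj.homEquiv_naturality_right_symm _ _).symm

end CoalgFamily

/-! ### Algebra structures on `G g` from families of coalgebras -/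

namespace LiftIso

variable (I : LiftIso A U) (s : CoalgFamily B U F) (adj : F ⊣ G)

section

variable {x y z x' y' : D}

/-- The algebra structure on `G g`, for `g` an algebra, induced by a family of coalgebras over
`F`. -/
noncomputable def alg (q : B.Alg x y) : A.Alg (G.obj x) (G.obj y) :=
  -- The choice is harmless, since `toLift` is also injective (`eq_of_toLift_eq`).
  (I.toLift_surjective (s.liftArr adj q)).choose

theorem toLift_alg (q : B.Alg x y) : I.toLift (I.alg s adj q) = s.liftArr adj q :=
  (I.toLift_surjective (s.liftArr adj q)).choose_spec

theorem alg_arr (q : B.Alg x y) : (I.alg s adj q).arr = G.map q.arr := by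
  rw [← I.toLift_arr, toLift_alg]
  rfl

theorem isAlgMap_alg {q : B.Alg x y} {q' : B.Alg x' y'} {h : x ⟶ x'} {k : y ⟶ y'}
    (e : B.IsAlgMap q q' h k) :
    A.IsAlgMap (I.alg s adj q) (I.alg s adj q') (G.map h) (G.map k) := by
  rw [← I.toLift_map_iff, toLift_alg, toLift_alg]
  exact s.liftArr_map adj e

/-- The identity square is a map between equal lifting operations, hence an algebra map because
`toLift` reflects maps. An algebra map with identity components equates the structure maps. -/
theorem eq_of_toLift_eq {a b : C} {q q' : A.Alg a b} (h : I.toLift q = I.toLift q') : q = q' := by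
  have h₁ : A.IsAlgMap q q' (𝟙 a) (𝟙 b) := by
    rw [← I.toLift_map_iff, h]
    exact (rlData U).hid _
  have h₂ : q.arr = q'.arr := by rw [← I.toLift_arr, h, I.toLift_arr]
  obtain ⟨⟨f⟩, p, _, _, _⟩ := q
  obtain ⟨⟨f'⟩, p', _, _, _⟩ := q'
  obtain rfl : f = f' := h₂
  refine AWFS.Alg.ext_p rfl (heq_of_eq ?_)
  obtain ⟨w, e⟩ := h₁
  have e₀ : A.em (𝟙 a) (𝟙 b) w = 𝟙 (A.ob f) := A.E.map_id _
  exact ((Category.comp_id _).symm.trans e.symm).trans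
    ((congrArg (· ≫ p') e₀).trans (Category.id_comp _))

/-- Both `toLift` and `liftArr` respect vertical composition. The comultiplication axiom `sig_al`
rests on this. -/
theorem alg_comp (q : B.Alg x y) (q' : B.Alg y z) :
    I.alg s adj (q.comp q') = (I.alg s adj q).comp (I.alg s adj q') := by
  refine I.eq_of_toLift_eq ?_
  rw [I.toLift_comp, toLift_alg, toLift_alg, toLift_alg, s.liftArr_comp]

end

/-! ### The oplax morphism of a family of coalgebras -/

section

variable {a b c d : C}

theorem unit_square (f : a ⟶ b) :
    (adj.unit.app a ≫ G.map (B.l (F.map f))) ≫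
      (I.alg s adj (AWFS.Alg.free B (F.map f))).arr = f ≫ adj.unit.app b := by
  rw [alg_arr, Category.assoc, ← G.map_comp, AWFS.Alg.l_free_arr, Category.comp_id]
  exact (adj.unit.naturality f).symm

/-- The transpose of the structure map `al` below. -/
noncomputable def hat (f : a ⟶ b) : A.ob f ⟶ G.obj (B.ob (F.map f)) :=
  (I.alg s adj (AWFS.Alg.free B (F.map f))).extend _ _ (I.unit_square s adj f)

theorem l_hat (f : a ⟶ b) : A.l f ≫ I.hat s adj f = adj.unit.app a ≫ G.map (B.l (F.map f)) :=
  AWFS.Alg.l_extend _ _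

theorem isAlgMap_hat (f : a ⟶ b) : A.IsAlgMap (AWFS.Alg.free A f)
    (I.alg s adj (AWFS.Alg.free B (F.map f))) (I.hat s adj f) (adj.unit.app b) :=
  AWFS.Alg.isAlgMap_extend _ _

/-- The structure map of the oplax morphism induced by a family of coalgebras over `F`. -/
noncomputable def al (f : a ⟶ b) : F.obj (A.ob f) ⟶ B.ob (F.map f) :=
  (adj.homEquiv _ _).symm (I.hat s adj f)

theorem unit_al (f : a ⟶ b) : adj.unit.app _ ≫ G.map (I.al s adj f) = I.hat s adj f := by
  exact (adj.homEquiv_unit _ _ _).symm.trans (Equiv.apply_symm_apply _ _)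

theorem homEquiv_map_comp {x y : C} {z : D} (h : x ⟶ y) (k : F.obj y ⟶ z) :
    adj.homEquiv _ _ (F.map h ≫ k) = h ≫ adj.homEquiv _ _ k :=
  adj.homEquiv_naturality_left _ _

theorem homEquiv_al_comp (f : a ⟶ b) {z : D} (k : B.ob (F.map f) ⟶ z) :
    adj.homEquiv _ _ (I.al s adj f ≫ k) = I.hat s adj f ≫ G.map k := by
  rw [adj.homEquiv_naturality_right, al, Equiv.apply_symm_apply]

theorem map_l_al (f : a ⟶ b) : F.map (A.l f) ≫ I.al s adj f = B.l (F.map f) := by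
  rw [al, ← adj.homEquiv_naturality_left_symm, l_hat, Equiv.symm_apply_eq, adj.homEquiv_unit]

theorem al_r (f : a ⟶ b) : I.al s adj f ≫ B.r (F.map f) = F.map (A.r f) := by
  apply (adj.homEquiv _ _).injective
  rw [homEquiv_al_comp, adj.homEquiv_unit]
  have h := (I.isAlgMap_hat s adj f).1
  rw [alg_arr] at h
  exact h.trans (adj.unit.naturality (A.r f))

/-- After transposition both sides are algebra maps out of the free algebra on `f`, over maps of
codomains that agree by naturality of the unit. It suffices to compare them along `A.l f`; `pi_al`
and `sig_al` follow the same pattern. -/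
theorem em_al {f : a ⟶ b} {g : c ⟶ d} {h : a ⟶ c} {k : b ⟶ d} (w : h ≫ g = f ≫ k) :
    F.map (A.em h k w) ≫ I.al s adj g = I.al s adj f ≫ B.em (F.map h) (F.map k)
      (by rw [← F.map_comp, w, F.map_comp]) := by
  apply (adj.homEquiv _ _).injective
  rw [homEquiv_al_comp, homEquiv_map_comp]
  have w' : F.map h ≫ F.map g = F.map f ≫ F.map k := by rw [← F.map_comp, w, F.map_comp]
  change A.em h k w ≫ (adj.homEquiv _ _) ((adj.homEquiv _ _).symm (I.hat s adj g)) = _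
  rw [Equiv.apply_symm_apply]
  have h₁ := A.algData.hcomp (AWFS.Alg.isAlgMap_em w) (I.isAlgMap_hat s adj g)
  have h₂ := A.algData.hcomp (I.isAlgMap_hat s adj f)
    (I.isAlgMap_alg s adj (AWFS.Alg.isAlgMap_em w'))
  rw [show adj.unit.app b ≫ G.map (F.map k) = k ≫ adj.unit.app d from
    (adj.unit.naturality k).symm] at h₂
  refine AWFS.Alg.free_hom_ext h₁ h₂ ?_
  rw [reassoc_of% (A.l_em w), reassoc_of% (I.l_hat s adj f), l_hat, ← G.map_comp, B.l_em w',
    G.map_comp]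
  exact (reassoc_of% (adj.unit.naturality h)) _

/-- `A.pi f` is the structure map of a free algebra, and `B.em _ _ _ ≫ B.pi _` is an extension to a
free algebra, so both are algebra maps. Along the unit of the free algebra on `A.r f`, both
transposes restrict to `hat f`. -/
theorem pi_al (f : a ⟶ b) : F.map (A.pi f) ≫ I.al s adj f = I.al s adj (A.r f) ≫
    B.em (I.al s adj f) (𝟙 (F.obj b)) ((I.al_r s adj f).trans (Category.comp_id _).symm) ≫
      B.pi (F.map f) := by
  have w : I.al s adj f ≫ B.r (F.map f) = F.map (A.r f) ≫ 𝟙 _ :=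
    (I.al_r s adj f).trans (Category.comp_id _).symm
  apply (adj.homEquiv _ _).injective
  rw [homEquiv_al_comp, homEquiv_map_comp]
  change A.pi f ≫ (adj.homEquiv _ _) ((adj.homEquiv _ _).symm (I.hat s adj f)) = _
  rw [Equiv.apply_symm_apply]
  have h₁ := A.algData.hcomp (AWFS.Alg.isAlgMap_p (AWFS.Alg.free A f)) (I.isAlgMap_hat s adj f)
  have h₂ := A.algData.hcomp (I.isAlgMap_hat s adj (A.r f))
    (I.isAlgMap_alg s adj (AWFS.Alg.isAlgMap_extend (AWFS.Alg.free B (F.map f)) w))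
  rw [Category.id_comp] at h₁
  rw [G.map_id, Category.comp_id] at h₂
  refine AWFS.Alg.free_hom_ext h₁ h₂ ?_
  rw [reassoc_of% (A.l_pi f), reassoc_of% (I.l_hat s adj (A.r f)), ← G.map_comp,
    show B.l _ ≫ B.em _ _ _ ≫ B.pi _ = I.al s adj f from
      (AWFS.Alg.free B (F.map f)).l_extend w, unit_al]

/-- Both transposes are algebra maps from the free algebra on `f` into the vertical composite of the
algebras induced on `G (B.r (B.l (F f)))` and `G (B.r (F f))`. -/
theorem sig_al (f : a ⟶ b) : F.map (A.sig f) ≫ I.al s adj (A.l f) ≫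
    B.em (𝟙 (F.obj a)) (I.al s adj f) ((Category.id_comp _).trans (I.map_l_al s adj f).symm) =
      I.al s adj f ≫ B.sig (F.map f) := by
  have w : 𝟙 (F.obj a) ≫ B.l (F.map f) = F.map (A.l f) ≫ I.al s adj f :=
    (Category.id_comp _).trans (I.map_l_al s adj f).symm
  apply (adj.homEquiv _ _).injective
  rw [homEquiv_al_comp, homEquiv_map_comp, homEquiv_al_comp]
  -- The lower edge of this cell is the unit followed by `G` of the structure map, which is `hat f`.
  -- The cell can therefore be stacked on that of `hat f`.
  have h₀ := A.algData.hcomp (I.isAlgMap_hat s adj (A.l f))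
    (I.isAlgMap_alg s adj (AWFS.Alg.isAlgMap_em w))
  rw [unit_al] at h₀
  have h₁ := A.algData.hcomp (AWFS.Alg.isAlgMap_sig f)
    (A.algData.vcompCell h₀ (I.isAlgMap_hat s adj f))
  have h₂ := A.algData.hcomp (I.isAlgMap_hat s adj f)
    (I.isAlgMap_alg s adj (AWFS.Alg.isAlgMap_sig (F.map f)))
  rw [Category.id_comp] at h₁
  -- `alg_comp` turns the induced structure on a composite algebra into the composite target reached
  -- by `h₁`.
  rw [G.map_id, Category.comp_id, alg_comp] at h₂
  refine AWFS.Alg.free_hom_ext h₁ h₂ ?_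
  rw [reassoc_of% (A.l_sig f), reassoc_of% (I.l_hat s adj (A.l f)), reassoc_of% (I.l_hat s adj f),
    ← G.map_comp, ← G.map_comp, B.l_em, B.l_sig, Category.id_comp]

/-- The oplax morphism induced by a family of coalgebras over a left adjoint functor. -/
noncomputable def oplax : OplaxMor A B F where
  α := { app := fun f => I.al s adj f.hom
         naturality := fun _ _ φ => I.em_al s adj φ.w }
  lam_α f := I.map_l_al s adj f.hom
  α_rho f := I.al_r s adj f.hom
  comul f := by
    ext
    -- Comultiplications have identity domain components, so only the codomain component has
    -- content; dually for multiplications below.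
    · have h₁ : F.map (A.str.Δ.app f).left = 𝟙 (F.obj f.left) :=
        (congrArg (fun t => F.map t) (A.Δ_left f)).trans (F.map_id _)
      have h₂ : (B.str.Δ.app (F.mapArrow.obj f)).left = 𝟙 (F.obj f.left) := B.Δ_left _
      refine (congrArg (fun t => t ≫ 𝟙 (F.obj f.left) ≫ 𝟙 (F.obj f.left)) h₁).trans ?_
      refine (Category.id_comp _).trans ?_
      exact congrArg (fun t => 𝟙 (F.obj f.left) ≫ t) h₂.symm
    · exact I.sig_al s adj f.hom
  mul f := by
    ext
    · exact I.pi_al s adj f.hom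
    · have h₁ : F.map (A.str.μ.app f).right = 𝟙 (F.obj f.right) :=
        (congrArg (fun t => F.map t) (A.μ_right f)).trans (F.map_id _)
      have h₂ : (B.str.μ.app (F.mapArrow.obj f)).right = 𝟙 (F.obj f.right) := B.μ_right _
      refine (congrArg (fun t => t ≫ 𝟙 (F.obj f.right)) h₁).trans ?_
      refine congrArg (fun t => 𝟙 (F.obj f.right) ≫ t) ?_
      refine (Category.id_comp _).symm.trans ?_
      exact congrArg (fun t => 𝟙 (F.obj f.right) ≫ t) h₂.symm

/-- By construction, fillers against the algebra on `G (B.r (F f))` are transposes of fillers from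
`s.coalg p`. So `hat` carries the structure map of `I.coalg p` to the transpose of the lifting of
`(B.l, 𝟙)` against a free algebra, which is the structure map of `s.coalg p` by `Φ_self`. -/
theorem push_oplax : I.family.push (I.oplax s adj) = s := by
  refine CoalgFamily.ext' fun {i j} p => ?_
  have harr := s.coalg_arr p
  have e : I.fill (AWFS.Alg.free A (uarr U p)) p (A.l _) (𝟙 _) (AWFS.Alg.l_free_arr _) ≫
      I.hat s adj (uarr U p) = adj.homEquiv _ _ ((s.coalg p).lift
        (AWFS.Alg.free B (F.map (uarr U p))) (B.l _) (𝟙 _)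
          (by rw [harr]; exact AWFS.Alg.l_free_arr _)) := by
    refine (I.fill_map (I.isAlgMap_hat s adj _) p (AWFS.Alg.l_free_arr _)).trans ?_
    refine (LiftArr.lift_eq_of_eq (I.toLift_alg s adj _) p _ _ _ ?_).trans ?_
    · change _ = _ ≫ G.map (B.r _)
      rw [Category.assoc, Category.id_comp]
      have := (I.isAlgMap_hat s adj (uarr U p)).1
      rw [alg_arr] at this
      rw [this]
      exact ((reassoc_of% (A.l_r (uarr U p))) _).symm
    · refine congrArg (adj.homEquiv _ _) ((s.coalg p).lift_congr _ ?_ ?_)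
      · rw [Equiv.symm_apply_eq, adj.homEquiv_unit]
        exact I.l_hat s adj _
      · rw [Equiv.symm_apply_eq, adj.homEquiv_unit, G.map_id]
        exact (Category.id_comp _).trans (Category.comp_id _).symm
  have e' : F.map (I.coalg p).s ≫ I.al s adj (uarr U p) = (s.coalg p).lift
        (AWFS.Alg.free B (F.map (uarr U p))) (B.l _) (𝟙 _)
          (by rw [harr]; exact AWFS.Alg.l_free_arr _) := by
    exact (adj.homEquiv_naturality_left_symm _ _).symm.trans ((Equiv.symm_apply_eq _).2 e)
  refine AWFS.Coalg.ext_s harr.symm ((heq_of_eq e').trans ?_)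
  -- The arrow of `s.coalg p` is only propositionally `F.map (uarr U p)`; generalizing the coalgebra
  -- permits substitution.
  generalize s.coalg p = t at harr
  obtain ⟨⟨f⟩, t, _, _, _⟩ := t
  dsimp only at harr
  subst harr
  exact heq_of_eq (AWFS.Coalg.Φ_self _)

end

end LiftIso

/-! ### Algebras pulled back along an oplax morphism -/

namespace OplaxMor

variable (σ : OplaxMor A B F) (adj : F ⊣ G) {x y : D}

theorem counit_square {x y : D} (g : x ⟶ y) :
    adj.counit.app x ≫ g = F.map (G.map g) ≫ adj.counit.app y :=
  (adj.counit.naturality g).symm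

/-- The transpose of the structure map of `pull`. -/
def pullHat (q : B.Alg x y) : F.obj (A.ob (G.map q.arr)) ⟶ x :=
  σ.al (G.map q.arr) ≫ q.extend (adj.counit.app x) (adj.counit.app y) (counit_square adj q.arr)

theorem l_pullHat (q : B.Alg x y) :
    F.map (A.l (G.map q.arr)) ≫ σ.pullHat adj q = adj.counit.app x := by
  rw [pullHat, reassoc_of% (σ.l_al (G.map q.arr)), AWFS.Alg.l_extend]

theorem pullHat_arr (q : B.Alg x y) :
    σ.pullHat adj q ≫ q.arr = F.map (A.r (G.map q.arr)) ≫ adj.counit.app y := by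
  rw [pullHat, AWFS.Alg.extend, Category.assoc, Category.assoc, q.p_arr, B.em_r,
    reassoc_of% (σ.al_r (G.map q.arr))]

/-- Naturality of `σ` moves `A.em m n w` past its structure map, and composing with the counit
transposes `m` and `n`. -/
theorem em_pullHat (q : B.Alg x y) {a b : C} {f : a ⟶ b} {m : a ⟶ G.obj x} {n : b ⟶ G.obj y}
    (w : m ≫ G.map q.arr = f ≫ n) : F.map (A.em m n w) ≫ σ.pullHat adj q =
      σ.al f ≫ q.extend ((adj.homEquiv _ _).symm m) ((adj.homEquiv _ _).symm n)
        (transpose_square adj w) := by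
  have w' : F.map m ≫ F.map (G.map q.arr) = F.map f ≫ F.map n := by
    rw [← F.map_comp, w, F.map_comp]
  rw [pullHat, reassoc_of% (σ.em_al w), AWFS.Alg.extend, AWFS.Alg.extend,
    reassoc_of% (B.em_em w' (counit_square adj q.arr))]
  refine congrArg (fun t => σ.al f ≫ t ≫ q.p) (B.em_congr ?_ ?_)
  · exact (adj.homEquiv_counit _ _ _).symm
  · exact (adj.homEquiv_counit _ _ _).symm

/-- The algebra structure on `G g`, for `g` an algebra, induced by an oplax morphism over `F`. -/
def pull (q : B.Alg x y) : A.Alg (G.obj x) (G.obj y) where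
  arr := G.map q.arr
  p := adj.homEquiv _ _ (σ.pullHat adj q)
  l_p := by
    rw [← adj.homEquiv_naturality_left, l_pullHat, adj.homEquiv_unit]
    exact adj.right_triangle_components x
  p_arr := by
    rw [← adj.homEquiv_naturality_right, pullHat_arr, adj.homEquiv_naturality_left,
      adj.homEquiv_unit, adj.right_triangle_components, Category.comp_id]
  pi_p := by
    have w : adj.homEquiv _ _ (σ.pullHat adj q) ≫ G.map q.arr = A.r (G.map q.arr) ≫ 𝟙 _ := by
      rw [← adj.homEquiv_naturality_right, pullHat_arr, adj.homEquiv_naturality_left,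
        adj.homEquiv_unit, adj.right_triangle_components]
    rw [← adj.homEquiv_naturality_left, ← adj.homEquiv_naturality_left]
    refine congrArg _ ?_
    -- In transposed form, the right side is an extension along the structure map itself. The
    -- multiplication axiom of `σ`, with the extension being an algebra map, gives the same for the
    -- left side.
    refine Eq.trans ?_ (σ.em_pullHat adj q w).symm
    have w₁ := counit_square adj q.arr
    have w₂ : σ.al (G.map q.arr) ≫ B.r (F.map (G.map q.arr)) =
        F.map (A.r (G.map q.arr)) ≫ 𝟙 _ := (σ.al_r _).trans (Category.comp_id _).symm
    have w₃ := (q.isAlgMap_extend w₁).1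
    have e₁ : B.em _ _ w₃ ≫ q.p = B.pi _ ≫ q.extend _ _ w₁ := (q.isAlgMap_extend w₁).2
    refine (reassoc_of% (σ.pi_al (G.map q.arr))) _ |>.trans ?_
    rw [← e₁, reassoc_of% (B.em_em w₂ w₃)]
    refine congrArg (fun t => σ.al (A.r (G.map q.arr)) ≫ t ≫ q.p) (B.em_congr ?_ ?_)
    · rw [Equiv.symm_apply_apply]
      rfl
    · rw [adj.homEquiv_counit, F.map_id]
      exact (Category.id_comp _).symm

/-- This is how `σ` is read off from its pulled back algebras: for a free `q` and the transposes of
`(B.l, 𝟙)` the right side reduces to `σ.al f`. -/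
theorem symm_extend_pull (q : B.Alg x y) {a b : C} {f : a ⟶ b} {m : a ⟶ G.obj x}
    {n : b ⟶ G.obj y} (w : m ≫ G.map q.arr = f ≫ n) :
    (adj.homEquiv _ _).symm ((σ.pull adj q).extend m n w) =
      σ.al f ≫ q.extend ((adj.homEquiv _ _).symm m) ((adj.homEquiv _ _).symm n)
        (transpose_square adj w) := by
  rw [Equiv.symm_apply_eq, ← em_pullHat σ adj q w, adj.homEquiv_naturality_left]
  rfl

end OplaxMor

/-! ### Mates, and compatibility of 2-cells -/

namespace LiftIso

variable (I : LiftIso A U) {σ : OplaxMor A B F} {τ : OplaxMor A B F'}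
  (adj : F ⊣ G) (adj' : F' ⊣ G') {x y : D}

/-- The filler against the pulled back algebra is the transpose of the filler for the pushed forward
coalgebra. -/
theorem fill_pull (q : B.Alg x y) {i j : J.Ob} (p : J.V i j) {m : uobj U i ⟶ G.obj x}
    {n : uobj U j ⟶ G.obj y} (w : m ≫ G.map q.arr = uarr U p ≫ n) :
    I.fill (σ.pull adj q) p m n w = adj.homEquiv _ _ ((σ.push (I.coalg p)).lift q
      ((adj.homEquiv _ _).symm m) ((adj.homEquiv _ _).symm n) (transpose_square adj w)) := by
  refine (I.coalg_lift p (σ.pull adj q) w).symm.trans ?_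
  refine (congrArg (fun t => (I.coalg p).s ≫ t) (adj.homEquiv_naturality_left _ _).symm).trans ?_
  refine (adj.homEquiv_naturality_left _ _).symm.trans (congrArg (adj.homEquiv _ _) ?_)
  refine (congrArg (fun t => F.map (I.coalg p).s ≫ t) (σ.em_pullHat adj q w)).trans ?_
  exact (Category.assoc _ _ _).symm

/-- Under the adjunction bijections, composing with the mate corresponds to precomposing with `γ`;
this is naturality of the unit and of `γ`. -/
theorem symm_comp_conjugate (γ : F ⟶ F') {a : C} (m : a ⟶ G'.obj x) :
    (adj.homEquiv _ _).symm (m ≫ (conjugateEquiv adj' adj γ).app x) =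
      γ.app a ≫ (adj'.homEquiv _ _).symm m := by
  rw [Equiv.symm_apply_eq, adj.homEquiv_unit, adj'.homEquiv_counit, conjugateEquiv_apply_app]
  have h : m ≫ adj.unit.app _ = adj.unit.app a ≫ G.map (F.map m) := adj.unit.naturality m
  have h' := γ.naturality m
  rw [reassoc_of% h, ← G.map_comp_assoc, h', G.map_comp, G.map_comp, G.map_comp, Category.assoc]

variable {adj adj'} in
/-- The mate of a transformation compatible with coalgebras is compatible with algebras. -/
theorem isAlgMap_conjugate {γ : F ⟶ F'}
    (h : ∀ {i j : J.Ob} (p : J.V i j), B.IsCoalgMap (σ.push (I.coalg p)) (τ.push (I.coalg p))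
      (γ.app (uobj U i)) (γ.app (uobj U j))) (q : B.Alg x y) :
    A.IsAlgMap (τ.pull adj' q) (σ.pull adj q) ((conjugateEquiv adj' adj γ).app x)
      ((conjugateEquiv adj' adj γ).app y) := by
  have e : (conjugateEquiv adj' adj γ).app x ≫ G.map q.arr =
    G'.map q.arr ≫ (conjugateEquiv adj' adj γ).app y :=
      ((conjugateEquiv adj' adj γ).naturality q.arr).symm
  -- Algebra maps are tested on lifting operations. There `fill_pull` expresses both fillers through
  -- pushed forward coalgebras, transposition turns the mate into `γ`, and `h` moves `γ` through the
  -- filler.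
  rw [← I.toLift_map_iff]
  refine ⟨?_, fun {i j} p m n w => ?_⟩
  · rw [I.toLift_arr, I.toLift_arr]
    exact e
  · rw [I.toLift_arr] at w
    have w : m ≫ G'.map q.arr = uarr U p ≫ n := w.symm
    have w' : (m ≫ (conjugateEquiv adj' adj γ).app x) ≫ G.map q.arr =
        uarr U p ≫ n ≫ (conjugateEquiv adj' adj γ).app y := by
      rw [Category.assoc, e, reassoc_of% w]
    refine Eq.trans ?_ (I.fill_pull (σ := σ) adj q p w').symm
    rw [← Equiv.symm_apply_eq, symm_comp_conjugate]
    refine (congrArg (fun t => _ ≫ (adj'.homEquiv _ _).symm t)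
      (I.fill_pull (σ := τ) adj' q p w)).trans ?_
    rw [Equiv.symm_apply_apply]
    refine (AWFS.Coalg.map_lift (h p) q (transpose_square adj' w)).symm.trans ?_
    exact AWFS.Coalg.lift_congr _ _ (symm_comp_conjugate adj adj' γ m).symm
      (symm_comp_conjugate adj adj' γ n).symm

include adj adj' in
/-- A transformation compatible with the coalgebras underlying `J` is compatible with the structure
maps of the oplax morphisms. -/
theorem al_em {γ : F ⟶ F'}
    (h : ∀ {i j : J.Ob} (p : J.V i j), B.IsCoalgMap (σ.push (I.coalg p)) (τ.push (I.coalg p))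
      (γ.app (uobj U i)) (γ.app (uobj U j))) {a b : C} (f : a ⟶ b) :
    σ.al f ≫ B.em (γ.app a) (γ.app b) (γ.naturality f).symm = γ.app (A.ob f) ≫ τ.al f := by
  -- The generic case: `m` and `n` are the transposes of the two edges of `(B.l, 𝟙)`, whose
  -- extension to the free algebra transposes back to `τ.al f`.
  let q := AWFS.Alg.free B (F'.map f)
  let m := adj'.homEquiv _ _ (B.l (F'.map f))
  let n := adj'.homEquiv _ _ (𝟙 (F'.obj b))
  let κ := conjugateEquiv adj' adj γ
  have w : m ≫ G'.map q.arr = f ≫ n := by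
    rw [← adj'.homEquiv_naturality_right, ← adj'.homEquiv_naturality_left, AWFS.Alg.l_free_arr]
  have h₁ := A.algData.hcomp ((τ.pull adj' q).isAlgMap_extend w)
    (I.isAlgMap_conjugate (adj := adj) (adj' := adj') h q)
  have w' : (m ≫ κ.app _) ≫ G.map q.arr = f ≫ n ≫ κ.app _ := by
    rw [Category.assoc, ← κ.naturality, reassoc_of% w]
  have h₂ := (σ.pull adj q).isAlgMap_extend w'
  -- Extending and then applying the mate agrees with extending the composite square, both being
  -- algebra maps out of the free algebra on `f` over the same map.
  have h₃ := AWFS.Alg.free_hom_ext h₁ h₂ (by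
    refine Eq.trans ?_ ((σ.pull adj q).l_extend w').symm
    refine (Category.assoc _ _ _).symm.trans ?_
    exact congrArg (fun t => t ≫ κ.app _) ((τ.pull adj' q).l_extend w))
  have h₄ := congrArg (adj.homEquiv _ _).symm h₃
  rw [symm_comp_conjugate, σ.symm_extend_pull adj q w', τ.symm_extend_pull adj' q w] at h₄
  refine Eq.trans ?_ (h₄.symm.trans ?_)
  · refine congrArg (fun t => σ.al f ≫ t) ?_
    have w₁ := (γ.naturality f).symm
    refine Eq.trans ?_ (q.extend_congr (m := γ.app a ≫ B.l (F'.map f)) (n := γ.app b ≫ 𝟙 _)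
      (w := by rw [Category.assoc, AWFS.Alg.l_free_arr, reassoc_of% w₁]) ?_ ?_)
    · have w₃ : B.l (F'.map f) ≫ B.r (F'.map f) = F'.map f ≫ 𝟙 _ := AWFS.Alg.l_free_arr _
      rw [AWFS.Alg.extend, ← B.em_em w₁ w₃, Category.assoc, B.em_l_pi, Category.comp_id]
    · exact ((symm_comp_conjugate adj adj' γ m).trans
        (congrArg _ (Equiv.symm_apply_apply _ _))).symm
    · exact ((symm_comp_conjugate adj adj' γ n).trans
        (congrArg _ (Equiv.symm_apply_apply _ _))).symm
  · refine congrArg (fun t => γ.app (A.ob f) ≫ t) ?_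
    refine Eq.trans ?_ (Category.comp_id _)
    refine congrArg (fun t => τ.al f ≫ t) (Eq.trans ?_ (B.em_l_pi (F'.map f)))
    exact q.extend_congr (Equiv.symm_apply_apply _ _) (Equiv.symm_apply_apply _ _)

end LiftIso

end

/-! ### Recognizing isomorphisms of categories -/

section

universe v₁ u₁ v₂ u₂

/-- A fully faithful functor which is bijective on objects is an isomorphism of categories. -/
theorem isIsoOfCategories_of_bijective {X : Type u₁} [Category.{v₁} X] {Y : Type u₂}
    [Category.{v₂} Y] (T : X ⥤ Y) [T.Full] [T.Faithful] (h : Function.Bijective T.obj) :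
    IsIsoOfCategories T := by
  obtain ⟨g, hg, hg'⟩ := Function.bijective_iff_has_inverse.1 h
  refine ⟨{ obj := g
            -- `T.obj (g y)` is only propositionally `y`, so `f` is conjugated by `eqToHom` before
            -- taking its preimage.
            map := fun {y y'} f => T.preimage (eqToHom (hg' y) ≫ f ≫ eqToHom (hg' y').symm)
            map_id := fun y => T.map_injective (by simp)
            map_comp := fun f f' => T.map_injective (by simp) }, ?_, ?_⟩
  · exact CategoryTheory.Functor.ext hg fun x x' f => T.map_injective (by simp [eqToHom_map])
  · exact CategoryTheory.Functor.ext hg' fun y y' f => by simp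

end

/-! ### The comparison functor between hom-categories -/

theorem HorTrans.hor_app_heq {J K : DblCat.{v, u}} {F F' G G' : DblFunctor J K} (hF : F = F')
    (hG : G = G') {α : HorTrans F G} {β : HorTrans F' G'} (h : HEq α β) (a : J.Ob) :
    HEq (α.hor.app a) (β.hor.app a) := by
  subst hF hG
  cases h
  rfl

variable {C : Type u} [Category.{v} C] {J : DblCat.{v, u}} {U : DblFunctor J (Sq C)} {A : AWFS C}

namespace LiftIso

variable (I : LiftIso A U)

/-- The unit of the left 2-adjoint. -/
def unit : DblOver.Map (DblOver.mk C J U) (AWFSLadj.coalgObj (AWFSLadj.mk C A)) where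
  F := 𝟭 C
  G := 𝟭 C
  adj := Adjunction.id
  bar := I.family.bar
  comm := I.family.bar_comm

/-- The functor induced by the unit. -/
abbrev compare (Y : AWFSLadj.{v, u}) :
    AWFSLadj.Map (AWFSLadj.mk C A) Y ⥤
      DblOver.Map (DblOver.mk C J U) (AWFSLadj.coalgObj Y) :=
  homFunctor AWFSLadj.DCoalg (b := AWFSLadj.mk C A) (d := DblOver.mk C J U) I.unit Y

instance (Y : AWFSLadj.{v, u}) : (I.compare Y).Faithful where
  map_injective {_ _ σ τ} h :=
    AWFSLadj.Cell₂.ext' (show AWFSLadj.Cell₂.γ σ = AWFSLadj.Cell₂.γ τ from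
      congrArg DblOver.Cell₂.γ h)

instance (Y : AWFSLadj.{v, u}) : (I.compare Y).Full where
  map_surjective {P Q} τ := by
    let γ : P.F ⟶ Q.F := DblOver.Cell₂.γ τ
    -- Lying over `Sq γ` identifies the horizontal part of `τ` with `γ` on objects of `J`, so the
    -- cells of `τ` say that `γ` is a map of pushed forward coalgebras.
    have hγ : ∀ i : J.Ob, (DblOver.Cell₂.bar τ).hor.app i = γ.app (uobj U i) := fun i =>
      eq_of_heq (HorTrans.hor_app_heq ((I.compare Y).obj P).comm ((I.compare Y).obj Q).comm
        (DblOver.Cell₂.comm τ) i)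
    have h : ∀ {i j : J.Ob} (p : J.V i j), Y.awfs.IsCoalgMap (P.oplax.push (I.coalg p))
        (Q.oplax.push (I.coalg p)) (γ.app (uobj U i)) (γ.app (uobj U j)) := fun {i j} p => by
      rw [← hγ, ← hγ]
      exact ((DblOver.Cell₂.bar τ).cell p).prf
    exact ⟨⟨γ, fun f => I.al_em P.adj Q.adj h f.hom⟩, AWFSLadj.cell_ext rfl⟩

/-- The image determines `F`, `G`, the adjunction (composition with the identity adjunction changes
nothing) and the pushed forward coalgebras. The identity of `F` then respects these coalgebras, and
`al_em` for it equates the structure maps. -/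
theorem compare_obj_injective (Y : AWFSLadj.{v, u}) : Function.Injective (I.compare Y).obj := by
  intro P Q h
  change DblOver.compMap I.unit (AWFSLadj.coalgMap P) =
    DblOver.compMap I.unit (AWFSLadj.coalgMap Q) at h
  obtain ⟨F, G, a, σ⟩ := P
  obtain ⟨F', G', a', τ⟩ := Q
  obtain rfl : F = F' := congrArg DblOver.Map.F h
  obtain rfl : G = G' := congrArg DblOver.Map.G h
  have ha : Adjunction.id.comp a = Adjunction.id.comp a' :=
    eq_of_heq (congr_arg_heq DblOver.Map.adj h)
  have hb : (I.family.push σ).bar = (I.family.push τ).bar := congrArg DblOver.Map.bar h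
  rw [DblOver.adj_id_comp, DblOver.adj_id_comp] at ha
  have hb' := CoalgFamily.bar_injective hb
  have h₁ : ∀ {i j : J.Ob} (p : J.V i j), Y.awfs.IsCoalgMap (σ.push (I.coalg p))
      (τ.push (I.coalg p)) ((𝟙 F : F ⟶ F).app (uobj U i)) ((𝟙 F : F ⟶ F).app (uobj U j)) := by
    intro i j p
    have : σ.push (I.coalg p) = τ.push (I.coalg p) :=
      congrArg (fun s : CoalgFamily Y.awfs U F => s.coalg p) hb'
    rw [this]
    exact Y.awfs.coalgData.hid _
  refine AWFSLadj.Map.ext' rfl rfl (heq_of_eq ha) (heq_of_eq (OplaxMor.ext' fun f => ?_))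
  have h₂ := I.al_em a a h₁ f.hom
  refine Eq.trans ?_ (h₂.trans (Category.id_comp _))
  refine (Category.comp_id _).symm.trans (congrArg (fun t => σ.α.app f ≫ t) ?_)
  exact (Y.awfs.E.map_id _).symm

/-- A double functor over `Sq F` is a family of coalgebras, and `push_oplax` exhibits that family as
the image of the oplax morphism it induces. -/
theorem compare_obj_surjective (Y : AWFSLadj.{v, u}) : Function.Surjective (I.compare Y).obj := by
  intro M
  obtain ⟨F, G, a, K, hK⟩ := M
  obtain ⟨s, rfl⟩ := CoalgFamily.exists_eq_bar (U := U) (F := F) (B := Y.awfs) K hK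
  refine ⟨⟨F, G, a, I.oplax s a⟩, DblOver.Map.ext' rfl rfl ?_ ?_⟩
  · exact heq_of_eq (DblOver.adj_id_comp a)
  · exact congrArg CoalgFamily.bar (I.push_oplax s a)

end LiftIso

end AlgFact

theorem mainTheorem9 {C : Type u} [CategoryTheory.Category.{v} C] (A : AlgFact.AWFS C)
    (J : AlgFact.DblCat.{v, u}) (U : AlgFact.DblFunctor J (AlgFact.Sq C))
    (hA : AlgFact.IsCofibrantlyGenerated A U) :
    AlgFact.IsLeftTwoAdjointAt AlgFact.AWFSLadj.DCoalg
      (AlgFact.DblOver.mk C J U) (AlgFact.AWFSLadj.mk C A) := by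
  obtain ⟨I⟩ := hA.exists_liftIso
  exact ⟨I.unit, fun Y => AlgFact.isIsoOfCategories_of_bijective (I.compare Y)
    ⟨I.compare_obj_injective Y, I.compare_obj_surjective Y⟩⟩
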